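/- Let $N,M\ge 1$, $q\in\mathbb C$ with $0<|q|<1$, fix a value of $\log q$, and let $a_j=q^{\alpha_j}$, $c_j=q^{\gamma_j}$ $(1\le j\le N)$, $b_i=q^{\beta_i}$ $(1\le i\le M)$ with $\alpha_j,\beta_i,\gamma_j\in\mathbb C$. For $n\ge 0$ put $(x)_n=\prod_{k=0}^{n-1}(1-xq^k)$ and $(x)_{-n}=\prod_{k=1}^{n}(1-xq^{-k})^{-1}$; for $m\in\mathbb Z_{\ge0}^M$ and $0\le l\le M$ put $m(l)=\sum_{i\le l}m_i-\sum_{i>l}m_i$. Let $T_s$ be the $q$-shift $t_s\mapsto qt_s$ and $T=T_1\cdots T_M$. The system $E_{N,M}$ is $$\Big\{t_s\prod_{j=1}^N(1-a_jT)\,(1-b_sT_s)-\prod_{j=1}^N(1-c_jq^{-1}T)\,(1-T_s)\Big\}f=0\quad(1\le s\le M),$$ $$\{t_r(1-b_rT_r)(1-T_s)-t_s(1-b_sT_s)(1-T_r)\}f=0\quad(1\le r<s\le M).$$ For $0\le L\le M$, $1\le k\le N$, define the following series, where each sum is over $m\in\mathbb Z_{\ge0}^M$: $$\mathcal F^{L}(b;t)=\sum_{m}\prod_{j=1}^N\frac{(a_j/b_{L+1}\cdots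 b_M)_{m(L)}}{(c_j/b_{L+1}\cdots b_M)_{m(L)}}\prod_{i=1}^M\frac{(b_i)_{m_i}}{(q)_{m_i}}\prod_{i=1}^Lt_i^{m_i}\prod_{i=L+1}^M\Big(\frac q{b_it_i}\Big)^{m_i};$$ for $L+1\le l\le M$, with $m'_i=m_i$ for $i\le L$ or $i>l$ and $m'_i=m_{i+1}$ for $L<i<l$, $$\mathcal F^{L;k,l}(b;t)=\sum_m\prod_{j=1}^N\frac{(qa_k/c_j)_{m_{L+1}}}{(qa_k/a_j)_{m_{L+1}}}\prod_{i\ne l}\frac{(b_i)_{m'_i}}{(q)_{m'_i}}\cdot\frac{(a_k/b_{l+1}\cdots b_M)_{m(l)}}{(qa_k/b_l\cdots b_M)_{m(l)}}\prod_{i<l}\Big(\frac{qt_i}{b_lt_l}\Big)^{m'_i}\prod_{i>l}\Big(\frac{b_lt_l}{b_it_i}\Big)^{m'_i}\Big(\prod_{j=1}^N\frac{c_j}{a_j}\cdot\frac q{b_lt_l}\Big)^{m_{L+1}};$$ for $1\le l\le L$, with $m''_i=m_i$ for $i<l$ or $i>L$ and $m''_i=m_{i-1}$ for $l<i\le L$,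 $$\mathcal G^{L;k,l}(b;t)=\sum_m\prod_{j=1}^N\frac{(qa_j/c_k)_{m_L}}{(qc_j/c_k)_{m_L}}\prod_{i\ne l}\frac{(b_i)_{m''_i}}{(q)_{m''_i}}\cdot\frac{(c_k/(qb_{l+1}\cdots b_M))_{m(l-1)}}{(c_k/b_l\cdots b_M)_{m(l-1)}}\prod_{i<l}\Big(\frac{qt_i}{b_lt_l}\Big)^{m''_i}\prod_{i>l}\Big(\frac{b_lt_l}{b_it_i}\Big)^{m''_i}\Big(\frac{b_lt_l}q\Big)^{m_L}.$$ For $\sigma\in\mathfrak S_M$ write $b^\sigma=(b_{\sigma(i)})_i$, $t^\sigma=(t_{\sigma(i)})_i$ and set $$u_0^{L,\sigma}=\prod_{i=L+1}^Mt_{\sigma(i)}^{-\beta_{\sigma(i)}}\,\mathcal F^L(b^\sigma;t^\sigma),$$ $$u_{k,l}^{L,\sigma}=t_{\sigma(l)}^{1+\sum_{i>l}\beta_{\sigma(i)}-\gamma_k}\prod_{i>l}t_{\sigma(i)}^{-\beta_{\sigma(i)}}\,\mathcal G^{L;k,l}(b^\sigma;t^\sigma)\ (1\le l\le L),\qquad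 u_{k,l}^{L,\sigma}=t_{\sigma(l)}^{-\alpha_k+\sum_{i>l}\beta_{\sigma(i)}}\prod_{i>l}t_{\sigma(i)}^{-\beta_{\sigma(i)}}\,\mathcal F^{L;k,l}(b^\sigma;t^\sigma)\ (L<l\le M).$$ Let $$D^{L,\sigma}=\Big\{|t_{\sigma(i)}|<1\ (i\le L),\ \Big|\prod_{j=1}^N\frac{c_j}{a_j}\cdot\frac q{b_{\sigma(i)}t_{\sigma(i)}}\Big|<1\ (i>L),\ \Big|\frac{qt_{\sigma(i)}}{b_{\sigma(j)}t_{\sigma(j)}}\Big|<1\ (i<j)\Big\}\subset(\mathbb C^*)^M,$$ and assume that $a_j/a_k,\ c_j/c_k\notin q^{\mathbb Z}$ for $j\ne k$ and $a_j/(b_{\sigma(i)}\cdots b_{\sigma(M)}),\ c_j/(b_{\sigma(i)}\cdots b_{\sigma(M)})\notin q^{\mathbb Z}$ for $1\le j\le N$, $1\le i\le M+1$. Then all the series in $u_0^{L,\sigma}$, $u_{k,l}^{L,\sigma}$ converge absolutely in $D^{L,\sigma}$, and the vector of these $NM+1$ functions is a fundamental solution of $E_{N,M}$ in $D^{L,\sigma}$.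 That is: each of them is a solution in $D^{L,\sigma}$; they are linearly independent over the pseudo-constants $K=\{C(t):T_sC=C\text{ for all }s\}$; and every solution in $D^{L,\sigma}$ is a linear combination of them with coefficients in $K$. Here functions may be multivalued, i.e. they are functions of $(\log t_1,\dots,\log t_M)$, with $T_s$ acting by $\log t_s\mapsto\log t_s+\log q$, and a solution in a region $D$ is a function on $D$ that satisfies each equation at every point of $D$ for which all the shifted points that occur in the equation lie in $D$. -/

import Mathlib

/-!
Conventions.

* `0 < ‖q‖ < 1`, and `τ` is a fixed logarithm of `q` (`exp τ = q`), so that `q ^ δ = exp (τ * δ)`.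
* The functions `t ^ δ` are multivalued, so all functions live on the universal covering of the
  torus `(ℂ^*)^M`: a point is `z : Fin M → ℂ`, its coordinates are `t i = exp (z i)`,
  `t i ^ δ = exp (δ * z i)`, and the `q`-shift `t s ↦ q * t s` is `z s ↦ z s + τ`.
* Indices start at `0`: the index `i` of a formula with `1 ≤ i ≤ M` is the element of `Fin M`
  with value `i - 1`. The cut `L` with `0 ≤ L ≤ M` is a number of variables and is not shifted:
  "`1 ≤ i ≤ L`" is `(i : ℕ) < L`, and "`L + 1 ≤ i ≤ M`" is `L ≤ (i : ℕ)`.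
-/

noncomputable section

namespace QHyp

/-- The `q`-shifted factorial `(x)_n` for an integer `n`: `∏_{0 ≤ k < n} (1 - x q^k)` for `n ≥ 0`,
and `(x)_{-n} = 1 / ∏_{1 ≤ k ≤ n} (1 - x q^{-k})`. This is `(x)_∞ / (x q^n)_∞`, simplified. -/
def qPoch (q x : ℂ) : ℤ → ℂ
  | Int.ofNat n => ∏ k ∈ Finset.range n, (1 - x * q ^ k)
  | Int.negSucc n => (∏ k ∈ Finset.range (n + 1), (1 - x / q ^ (k + 1)))⁻¹

/-- `m(l) = ∑_{i=1}^{l} m_i - ∑_{i=l+1}^{M} m_i`, for `0 ≤ l ≤ M`. -/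
def signedSum {M : ℕ} (m : Fin M → ℕ) (l : ℕ) : ℤ :=
  ∑ i : Fin M, if (i : ℕ) < l then (m i : ℤ) else -(m i : ℤ)

/-- The product `b_{l+1} ⋯ b_M`, for `0 ≤ l ≤ M` (it is `1` for `l = M`). -/
def tailProd {M : ℕ} (b : Fin M → ℂ) (l : ℕ) : ℂ :=
  ∏ i : Fin M with l ≤ i.val, b i

/-! ### The three families of series -/

/-- The term of index `m` of the series `𝓕^L`. -/
def termF0 {N M : ℕ} (q : ℂ) (a : Fin N → ℂ) (b : Fin M → ℂ) (c : Fin N → ℂ) (L : ℕ)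
    (t : Fin M → ℂ) (m : Fin M → ℕ) : ℂ :=
  (∏ j, qPoch q (a j / tailProd b L) (signedSum m L) /
      qPoch q (c j / tailProd b L) (signedSum m L)) *
    (∏ i, qPoch q (b i) (m i) / qPoch q q (m i)) *
    (∏ i : Fin M with i.val < L, t i ^ m i) *
    (∏ i : Fin M with L ≤ i.val, (q / (b i * t i)) ^ m i)

/-- The term of index `m` of the series `𝓕^{L;k,l}`, `L + 1 ≤ l ≤ M`.

The summation index `m_{L+1}` is `m p`. The summation index that goes with `b_i`, `t_i` is `m_i`
for `i ≤ L` and for `i > l`, and it is `m_{i+1}` for `L + 1 ≤ i ≤ l - 1`; that is `m (s i)`,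
where `s` is the cycle `L+1 ↦ L+2 ↦ ⋯ ↦ l ↦ L+1`. -/
def termF {N M : ℕ} (q : ℂ) (a : Fin N → ℂ) (b : Fin M → ℂ) (c : Fin N → ℂ) (L : ℕ)
    (k : Fin N) (l : Fin M) (hl : L ≤ (l : ℕ)) (t : Fin M → ℂ) (m : Fin M → ℕ) : ℂ :=
  let p : Fin M := ⟨L, hl.trans_lt l.isLt⟩
  let s : Equiv.Perm (Fin M) := Fin.cycleIcc p l
  (∏ j, qPoch q (q * a k / c j) (m p) / qPoch q (q * a k / a j) (m p)) *
    (∏ i with i ≠ l, qPoch q (b i) (m (s i)) / qPoch q q (m (s i))) *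
    (qPoch q (a k / tailProd b ((l : ℕ) + 1)) (signedSum m ((l : ℕ) + 1)) /
      qPoch q (q * a k / tailProd b (l : ℕ)) (signedSum m ((l : ℕ) + 1))) *
    (∏ i with i < l, (q * t i / (b l * t l)) ^ m (s i)) *
    (∏ i with l < i, (b l * t l / (b i * t i)) ^ m (s i)) *
    ((∏ j, c j / a j) * (q / (b l * t l))) ^ m p

/-- The term of index `m` of the series `𝓖^{L;k,l}`, `1 ≤ l ≤ L`.

The summation index `m_L` is `m p`. The summation index that goes with `b_i`, `t_i` is `m_i`
for `i < l` and for `i > L`, and it is `m_{i-1}` for `l + 1 ≤ i ≤ L`; that is `m (s i)`,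
where `s` is the cycle `L ↦ L-1 ↦ ⋯ ↦ l ↦ L`. -/
def termG {N M : ℕ} (q : ℂ) (a : Fin N → ℂ) (b : Fin M → ℂ) (c : Fin N → ℂ) (L : ℕ) (hL : L ≤ M)
    (k : Fin N) (l : Fin M) (hl : (l : ℕ) < L) (t : Fin M → ℂ) (m : Fin M → ℕ) : ℂ :=
  let p : Fin M := ⟨L - 1, by omega⟩
  let s : Equiv.Perm (Fin M) := (Fin.cycleIcc l p).symm
  (∏ j, qPoch q (q * a j / c k) (m p) / qPoch q (q * c j / c k) (m p)) *
    (∏ i with i ≠ l, qPoch q (b i) (m (s i)) / qPoch q q (m (s i))) *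
    (qPoch q (c k / (q * tailProd b ((l : ℕ) + 1))) (signedSum m (l : ℕ)) /
      qPoch q (c k / tailProd b (l : ℕ)) (signedSum m (l : ℕ))) *
    (∏ i with i < l, (q * t i / (b l * t l)) ^ m (s i)) *
    (∏ i with l < i, (b l * t l / (b i * t i)) ^ m (s i)) *
    (b l * t l / q) ^ m p

/-! ### The functions `u_0^{L,σ}` and `u_{k,l}^{L,σ}`

They are indexed by `Option (Fin N × Fin M)`: `none` stands for `u_0`, `some (k, l)` for `u_{k,l}`.
The parameters are `a_j = q^{α_j}`, `b_i = q^{β_i}`, `c_j = q^{γ_j}`. -/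

/-- The terms of the series in the component `i` of `u^{L,id}`, at the point `t`. -/
def uTerm {N M : ℕ} (q : ℂ) (a : Fin N → ℂ) (b : Fin M → ℂ) (c : Fin N → ℂ) (L : ℕ) (hL : L ≤ M)
    (t : Fin M → ℂ) : Option (Fin N × Fin M) → (Fin M → ℕ) → ℂ
  | none => termF0 q a b c L t
  | some (k, l) =>
    if h : (l : ℕ) < L then termG q a b c L hL k l h t
    else termF q a b c L k l (not_lt.mp h) t

/-- The monomial prefactor `t^δ` of the component `i` of `u^{L,id}`, at `t = exp z`. -/
def uMonomial {N M : ℕ} (α : Fin N → ℂ) (β : Fin M → ℂ) (γ : Fin N → ℂ) (L : ℕ)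
    (z : Fin M → ℂ) : Option (Fin N × Fin M) → ℂ
  | none => ∏ i : Fin M with L ≤ i.val, Complex.exp (-β i * z i)
  | some (k, l) =>
    (if (l : ℕ) < L then Complex.exp ((1 + (∑ i with l < i, β i) - γ k) * z l)
      else Complex.exp ((-α k + ∑ i with l < i, β i) * z l)) *
    ∏ i with l < i, Complex.exp (-β i * z i)

/-- `x ↦ q^x` in each coordinate, where `q = exp τ`. -/
def qPow {ι : Type*} (τ : ℂ) (x : ι → ℂ) : ι → ℂ := fun i => Complex.exp (τ * x i)

/-- The terms of the series in the component `i` of `u^{L,σ}`, at `t = exp z`. -/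
def uSeriesTerm {N M : ℕ} (τ : ℂ) (α : Fin N → ℂ) (β : Fin M → ℂ) (γ : Fin N → ℂ)
    (L : ℕ) (hL : L ≤ M) (σ : Equiv.Perm (Fin M)) (i : Option (Fin N × Fin M))
    (z : Fin M → ℂ) (m : Fin M → ℕ) : ℂ :=
  uTerm (Complex.exp τ) (qPow τ α) (fun i => qPow τ β (σ i)) (qPow τ γ) L hL
    (fun i => Complex.exp (z (σ i))) i m

/-- The component `i` of the vector `u^{L,σ}`, as a function on the covering. -/
def u {N M : ℕ} (τ : ℂ) (α : Fin N → ℂ) (β : Fin M → ℂ) (γ : Fin N → ℂ)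
    (L : ℕ) (hL : L ≤ M) (σ : Equiv.Perm (Fin M)) (i : Option (Fin N × Fin M))
    (z : Fin M → ℂ) : ℂ :=
  uMonomial α (fun i => β (σ i)) γ L (fun i => z (σ i)) i *
    ∑' m : Fin M → ℕ, uSeriesTerm τ α β γ L hL σ i z m

/-! ### The `q`-difference system -/

/-- The point `(…, q t_s, …)`. -/
def shiftPt {M : ℕ} (τ : ℂ) (s : Fin M) (z : Fin M → ℂ) : Fin M → ℂ :=
  Function.update z s (z s + τ)

/-- The point `q t = (q t_1, …, q t_M)`. -/
def shiftAllPt {M : ℕ} (τ : ℂ) (z : Fin M → ℂ) : Fin M → ℂ := fun i => z i + τ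

/-- Linear operators on the functions on the covering. -/
abbrev Op (M : ℕ) : Type := Module.End ℂ ((Fin M → ℂ) → ℂ)

/-- The `q`-shift operator `T_s`. -/
def T {M : ℕ} (τ : ℂ) (s : Fin M) : Op M where
  toFun f z := f (shiftPt τ s z)
  map_add' _ _ := rfl
  map_smul' _ _ := rfl

/-- The operator `T = T_1 ⋯ T_M`. -/
def TAll {M : ℕ} (τ : ℂ) : Op M where
  toFun f z := f (shiftAllPt τ z)
  map_add' _ _ := rfl
  map_smul' _ _ := rfl

/-- The operator `∏_{j=1}^N (1 - x_j T)`. -/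
def prodOneSub {N M : ℕ} (τ : ℂ) (x : Fin N → ℂ) : Op M :=
  (List.ofFn fun j => 1 - x j • TAll τ).prod

/-- `f` is a solution in the region `D` of the system `E_{N,M}`
`{t_s ∏_j (1 - a_j T) (1 - b_s T_s) - ∏_j (1 - c_j q⁻¹ T) (1 - T_s)} f = 0`, `1 ≤ s ≤ M`,
`{t_r (1 - b_r T_r) (1 - T_s) - t_s (1 - b_s T_s) (1 - T_r)} f = 0`, `1 ≤ r < s ≤ M`.
`D` is not stable under the shifts, and only the values of `f` in `D` matter: an equation is imposed
at those points of `D` for which all the shifted points that occur in it lie in `D`. -/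
structure IsSolutionOn {N M : ℕ} (τ : ℂ) (a : Fin N → ℂ) (b : Fin M → ℂ) (c : Fin N → ℂ)
    (D : Set (Fin M → ℂ)) (f : (Fin M → ℂ) → ℂ) : Prop where
  eq_one : ∀ (s : Fin M) (z : Fin M → ℂ),
    (∀ n ≤ N, (shiftAllPt τ)^[n] z ∈ D ∧ (shiftAllPt τ)^[n] (shiftPt τ s z) ∈ D) →
    Complex.exp (z s) * (prodOneSub τ a * (1 - b s • T τ s) : Op M) f z -
      (prodOneSub τ (fun j => c j * (Complex.exp τ)⁻¹) * (1 - T τ s) : Op M) f z = 0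
  eq_two : ∀ (r s : Fin M), r < s → ∀ z : Fin M → ℂ,
    z ∈ D → shiftPt τ r z ∈ D → shiftPt τ s z ∈ D → shiftPt τ r (shiftPt τ s z) ∈ D →
    Complex.exp (z r) * ((1 - b r • T τ r) * (1 - T τ s) : Op M) f z -
      Complex.exp (z s) * ((1 - b s • T τ s) * (1 - T τ r) : Op M) f z = 0

/-- The pseudo-constants `K = {C ; T_s C = C for all s}`. -/
def IsPseudoConstant {M : ℕ} (τ : ℂ) (C : (Fin M → ℂ) → ℂ) : Prop :=
  ∀ s : Fin M, T τ s C = C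

/-- A finite family `v` is a fundamental solution of `E_{N,M}` in the region `D`: it is a basis, over
the pseudo-constants, of the space of solutions in `D`. -/
structure IsFundamentalSolutionOn {N M : ℕ} (τ : ℂ) (a : Fin N → ℂ) (b : Fin M → ℂ)
    (c : Fin N → ℂ) (D : Set (Fin M → ℂ)) {ι : Type*} [Fintype ι]
    (v : ι → (Fin M → ℂ) → ℂ) : Prop where
  isSolution : ∀ i, IsSolutionOn τ a b c D (v i)
  linearIndependent : ∀ C : ι → (Fin M → ℂ) → ℂ, (∀ i, IsPseudoConstant τ (C i)) →
    (∀ z ∈ D, ∑ i, C i z * v i z = 0) → ∀ i, C i = 0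
  spanning : ∀ f : (Fin M → ℂ) → ℂ, IsSolutionOn τ a b c D f →
    ∃ C : ι → (Fin M → ℂ) → ℂ, (∀ i, IsPseudoConstant τ (C i)) ∧
      ∀ z ∈ D, f z = ∑ i, C i z * v i z

/-! ### The region and the condition on the parameters -/

/-- The region `D^{L,σ}` (its preimage in the covering). -/
def region {N M : ℕ} (q : ℂ) (a : Fin N → ℂ) (b : Fin M → ℂ) (c : Fin N → ℂ) (L : ℕ)
    (σ : Equiv.Perm (Fin M)) : Set (Fin M → ℂ) :=
  {z | (∀ i : Fin M, (i : ℕ) < L → ‖Complex.exp (z (σ i))‖ < 1) ∧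
    (∀ i : Fin M, L ≤ (i : ℕ) →
      ‖(∏ j, c j / a j) * (q / (b (σ i) * Complex.exp (z (σ i))))‖ < 1) ∧
    (∀ i j : Fin M, i < j →
      ‖q * Complex.exp (z (σ i)) / (b (σ j) * Complex.exp (z (σ j)))‖ < 1)}

/-- The non-resonance condition: `a_j / a_k`, `c_j / c_k` (for `j ≠ k`) and
`a_j / (b_{σ(i)} ⋯ b_{σ(M)})`, `c_j / (b_{σ(i)} ⋯ b_{σ(M)})` (for all `j` and `1 ≤ i ≤ M + 1`)
are not in `q^ℤ`. -/
structure NonResonant {N M : ℕ} (q : ℂ) (a : Fin N → ℂ) (b : Fin M → ℂ) (c : Fin N → ℂ)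
    (σ : Equiv.Perm (Fin M)) : Prop where
  a_div_a : ∀ j k : Fin N, j ≠ k → ∀ n : ℤ, a j / a k ≠ q ^ n
  c_div_c : ∀ j k : Fin N, j ≠ k → ∀ n : ℤ, c j / c k ≠ q ^ n
  a_div_b : ∀ (j : Fin N) (i : ℕ), i ≤ M → ∀ n : ℤ, a j / tailProd (fun i => b (σ i)) i ≠ q ^ n
  c_div_b : ∀ (j : Fin N) (i : ℕ), i ≤ M → ∀ n : ℤ, c j / tailProd (fun i => b (σ i)) i ≠ q ^ n

end QHyp

end

section

open Finset Filter Topology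

namespace QHyp

/-! ### The `q`-shifted factorial -/

section QPoch

variable {q : ℂ}

/-! Permuting the variables and the parameters b together reduces everything to σ = id
(`IsFundamentalSolutionOn.comp_perm`). Pseudo-constants are arbitrary constants on each orbit z + τ
ℤ^M of the shifts, so the theorem is a statement about one orbit at a time: there the solutions form
a complex space of dimension NM + 1 with the components of u as a basis.

Solutions. After a permutation of the summation indices every component is a monomial times a series
in the normal form `genTerm`. Rewritten over the lattice of exponents, it becomes ∑ Φ(|n|) ∏
φ_i(n_i) t^(δ+n) with |n| = ∑ n_i. The operators T and T_s are diagonal on monomials, so the whole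
system follows from first order recurrences for Φ and for each φ_i (`isSolutionOn_of_recurrence`).
The choice of δ decides which factors may be cut off to n ≥ 0 or n ≤ 0 and which remain two-sided.
Convergence comes from a geometric bound for the factor that depends on a signed sum of the indices
(`summable_genTerm`); its hypotheses are the inequalities that define the region.

Independence. Along a suitable direction into the region all series tend to 1, and each component
behaves like a character of ℤ^M. Comparing the dominant terms at all translates leaves a linear
relation among characters. Non-resonance makes these distinct (`exp_compExp_injective`), and
Dedekind's theorem finishes (`linearIndependent_u_one`).

Dimension bound. Adjoining a dummy variable equal to 1 between the first L variables and the others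
turns the region, on an orbit, into a polyhedron of inequalities P_a - P_b ≥ D_ab for a < b
(`Admissible.exists_region_iff`). Deep inside, all coefficients needed to solve the equations for a
corner value are nonzero, so the vanishing of NM + 1 initial values is carried by unit steps in
every direction (`initZero_add_single_iff`). From the deep part zeros reach the whole polyhedron
(`eq_zero_of_deep`), because there the inequalities of the region themselves keep the required
coefficients nonzero (`IsSolutionOn.corner_side`, `IsSolutionOn.corner_bot`,
`IsSolutionOn.corner_top`).

Evaluating combinations of the NM + 1 components at the NM + 1 initial points is thus an injective
linear map between spaces of equal dimension, hence surjective, and every solution agrees with some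
combination on the orbit (`exists_eq_sum_u_one`). -/

@[simp]
lemma qPoch_zero (q x : ℂ) : qPoch q x 0 = 1 := by
  change qPoch q x (Int.ofNat 0) = 1
  simp [qPoch]

lemma qPoch_natCast (q x : ℂ) (n : ℕ) :
    qPoch q x (n : ℤ) = ∏ k ∈ range n, (1 - x * q ^ k) := rfl

lemma qPoch_add_one (x : ℂ) (n : ℤ) (h : n < 0 → x * q ^ n ≠ 1) :
    qPoch q x (n + 1) = qPoch q x n * (1 - x * q ^ n) := by
  rcases n with n | n
  · change qPoch q x ((n : ℤ) + 1) = qPoch q x (n : ℤ) * (1 - x * q ^ (n : ℤ))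
    have : ((n : ℤ) + 1) = ((n + 1 : ℕ) : ℤ) := by push_cast; rfl
    rw [this, qPoch_natCast, qPoch_natCast, prod_range_succ, zpow_natCast]
  · have hx : 1 - x / q ^ (n + 1) ≠ 0 := by
      have := h (Int.negSucc_lt_zero n)
      rw [zpow_negSucc, ← div_eq_mul_inv] at this
      exact sub_ne_zero.mpr (Ne.symm this)
    have h1 : qPoch q x (Int.negSucc n) = (∏ k ∈ range n, (1 - x / q ^ (k + 1)))⁻¹ *
        (1 - x / q ^ (n + 1))⁻¹ := by
      simp [qPoch, prod_range_succ, mul_comm]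
    have h2 : qPoch q x (Int.negSucc n + 1) = (∏ k ∈ range n, (1 - x / q ^ (k + 1)))⁻¹ := by
      cases n with
      | zero => simp
      | succ n =>
        have : Int.negSucc (n + 1) + 1 = Int.negSucc n := by omega
        rw [this]; rfl
    rw [h1, h2, zpow_negSucc, ← div_eq_mul_inv x, mul_assoc, inv_mul_cancel₀ hx, mul_one]

lemma exists_norm_prod_one_add_le {e : ℕ → ℂ} (he : Summable fun n => ‖e n‖) :
    ∃ K : ℝ, ∀ n, ‖∏ k ∈ range n, (1 + e k)‖ ≤ K := by
  refine ⟨Real.exp (∑' n, ‖e n‖), fun n => ?_⟩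
  have h1 := (range n).norm_prod_one_add_sub_one_le e
  have h2 : ∑ k ∈ range n, ‖e k‖ ≤ ∑' n, ‖e n‖ := he.sum_le_tsum _ fun _ _ => norm_nonneg _
  have h3 := Real.exp_le_exp.mpr h2
  have h4 := norm_le_norm_sub_add (∏ k ∈ range n, (1 + e k)) 1
  rw [norm_one] at h4
  linarith

/-- Quotients of `q`-shifted factorials with natural index are bounded. -/
lemma exists_norm_qPoch_div_le (hq1 : ‖q‖ < 1) (x : ℂ) {y : ℂ} (hy : ∀ n : ℕ, y * q ^ n ≠ 1) :
    ∃ K : ℝ, ∀ n : ℕ, ‖qPoch q x n / qPoch q y n‖ ≤ K := by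
  -- Chosen so that 1 + e n = (1 - x q^n) / (1 - y q^n); it is O(q^n), hence summable.
  set e : ℕ → ℂ := fun n => (y - x) * q ^ n / (1 - y * q ^ n) with he
  have hne : ∀ n : ℕ, 1 - y * q ^ n ≠ 0 := fun n => sub_ne_zero.mpr (Ne.symm (hy n))
  have hlim : Tendsto (fun n : ℕ => (y - x) / (1 - y * q ^ n)) atTop (𝓝 ((y - x) / (1 - y * 0))) :=
    tendsto_const_nhds.div
      ((tendsto_pow_atTop_nhds_zero_of_norm_lt_one hq1).const_mul y |>.const_sub 1) (by simp)
  obtain ⟨B, hB⟩ := (Metric.isBounded_range_of_tendsto _ hlim).exists_norm_le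
  have hs : Summable fun n => ‖e n‖ := by
    refine Summable.of_nonneg_of_le (fun _ => norm_nonneg _) (fun n => ?_)
      ((summable_geometric_of_lt_one (norm_nonneg q) hq1).mul_left B)
    have : e n = (y - x) / (1 - y * q ^ n) * q ^ n := by simp only [he]; ring
    rw [this, norm_mul, norm_pow]
    exact mul_le_mul_of_nonneg_right (hB _ ⟨n, rfl⟩) (by positivity)
  obtain ⟨K, hK⟩ := exists_norm_prod_one_add_le hs
  refine ⟨K, fun n => ?_⟩
  rw [qPoch_natCast, qPoch_natCast, ← prod_div_distrib]
  refine le_of_eq_of_le (congrArg _ (prod_congr rfl fun k _ => ?_)) (hK n)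
  simp only [he]
  rw [div_eq_iff (hne k), add_mul, div_mul_cancel₀ _ (hne k)]
  ring

/-- Reflection of a quotient of `q`-shifted factorials to a negative index. -/
lemma qPoch_neg_div (hq : q ≠ 0) {x y : ℂ} (hx0 : x ≠ 0) (hy0 : y ≠ 0) (n : ℕ) :
    qPoch q x (-n) / qPoch q y (-n) =
      (y / x) ^ n * (qPoch q (q / y) n / qPoch q (q / x) n) := by
  have key : ∀ w : ℂ, w ≠ 0 → qPoch q w (-n) = (∏ k ∈ range n, (1 - w / q ^ (k + 1)))⁻¹ := by
    intro w _
    cases n with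
    | zero => simp
    | succ n => rfl
  have key2 : ∀ w : ℂ, w ≠ 0 → ∏ k ∈ range n, (1 - w / q ^ (k + 1)) =
      w ^ n * (∏ k ∈ range n, (-(q ^ (k + 1))⁻¹)) * qPoch q (q / w) n := by
    intro w hw
    rw [qPoch_natCast, ← card_range n, ← prod_const, card_range, ← prod_mul_distrib,
      ← prod_mul_distrib]
    refine prod_congr rfl fun k _ => ?_
    field_simp
    ring
  have h3 : ∏ k ∈ range n, (-(q ^ (k + 1))⁻¹) ≠ 0 :=
    prod_ne_zero_iff.mpr fun k _ => neg_ne_zero.mpr (inv_ne_zero (pow_ne_zero _ hq))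
  rw [key x hx0, key y hy0, key2 x hx0, key2 y hy0, div_pow, inv_div_inv]
  set P := ∏ k ∈ range n, (-(q ^ (k + 1))⁻¹)
  have hxn := pow_ne_zero n hx0
  rw [div_mul_div_comm, mul_right_comm, mul_right_comm (x ^ n),
    mul_div_mul_right _ _ h3]

/-- Growth of a function on the integers: bounded at `+∞`, geometric of ratio `ρ` at `-∞`. -/
def GrowthLE (R : ℤ → ℂ) (ρ : ℝ) : Prop :=
  ∃ K : ℝ, ∀ n : ℤ, ‖R n‖ ≤ K * ρ ^ (-n).toNat

/-- For n ≥ 0 the quotient is bounded; for n < 0 the reflection formula gives (y/x)^|n| times a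
quotient that is bounded for the same reason. -/
lemma growthLE_qPoch_div (hq : q ≠ 0) (hq1 : ‖q‖ < 1) {x y : ℂ} (hx0 : x ≠ 0) (hy0 : y ≠ 0)
    (hx : ∀ n : ℤ, x * q ^ n ≠ 1) (hy : ∀ n : ℤ, y * q ^ n ≠ 1) :
    GrowthLE (fun n => qPoch q x n / qPoch q y n) ‖y / x‖ := by
  obtain ⟨K1, h1⟩ := exists_norm_qPoch_div_le hq1 x (y := y) fun n => by exact_mod_cast hy n
  obtain ⟨K2, h2⟩ := exists_norm_qPoch_div_le hq1 (q / y) (y := q / x) fun n h => by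
    refine hx (-(n + 1)) ?_
    rw [zpow_neg, zpow_add_one₀ hq, zpow_natCast]
    field_simp at h ⊢
    rw [← h]
  refine ⟨max K1 K2, fun n => ?_⟩
  rcases le_total 0 n with hn | hn
  · lift n to ℕ using hn
    simpa using (h1 n).trans (le_max_left _ _)
  · obtain ⟨m, rfl⟩ : ∃ m : ℕ, n = -m := ⟨(-n).toNat, by omega⟩
    simp only [neg_neg, Int.toNat_natCast]
    rw [qPoch_neg_div hq hx0 hy0, norm_mul, norm_pow, mul_comm]
    exact mul_le_mul_of_nonneg_right ((h2 m).trans (le_max_right _ _)) (by positivity)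

lemma GrowthLE.prod {ι : Type*} (s : Finset ι) {R : ι → ℤ → ℂ} {ρ : ι → ℝ}
    (h : ∀ i, GrowthLE (R i) (ρ i)) : GrowthLE (fun n => ∏ i ∈ s, R i n) (∏ i ∈ s, ρ i) := by
  choose K hK using h
  refine ⟨∏ i ∈ s, K i, fun n => ?_⟩
  rw [norm_prod, ← prod_pow, ← prod_mul_distrib]
  exact prod_le_prod (fun _ _ => norm_nonneg _) fun i _ => hK i n

end QPoch

/-! ### Multiple series with a factor that depends on a signed sum -/

section GenTerm

variable {M : ℕ}

/-- The general term `R(m(l)) ∏ w_i(m_i) ∏ x_i^{m_i}`. -/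
def genTerm (l : ℕ) (R : ℤ → ℂ) (w : Fin M → ℕ → ℂ) (x : Fin M → ℂ) (m : Fin M → ℕ) : ℂ :=
  R (signedSum m l) * (∏ i, w i (m i)) * ∏ i, x i ^ m i

lemma signedSum_eq_sub (m : Fin M → ℕ) (l : ℕ) :
    signedSum m l = ((∑ i : Fin M with i.val < l, m i : ℕ) : ℤ) - ((∑ i : Fin M with ¬ i.val < l, m i : ℕ) : ℤ) := by
  rw [signedSum, sum_ite, sum_neg_distrib]
  push_cast
  ring

lemma summable_prod_pow (M : ℕ) {r : ℝ} (h0 : 0 ≤ r) (h1 : r < 1) :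
    Summable fun m : Fin M → ℕ => ∏ i, r ^ m i := by
  induction M with
  | zero => exact (hasSum_fintype _).summable
  | succ M ih =>
    rw [← (Fin.consEquiv fun _ : Fin (M + 1) => ℕ).summable_iff]
    have := (summable_geometric_of_lt_one h0 h1).mul_of_nonneg ih (fun _ => by positivity)
      (fun _ => prod_nonneg fun _ _ => by positivity)
    refine this.congr fun p => ?_
    simp [Fin.consEquiv, Fin.prod_univ_succ]

/-- Passes from pairwise strict inequalities to uniform ones, with one bound for the variables
counted with sign + and one for those with sign -. Finite suprema of strict bounds stay strict. -/
lemma exists_bound_pos_neg (l : ℕ) (y : Fin M → NNReal) (ρ : NNReal)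
    (h1 : ∀ i : Fin M, (i : ℕ) < l → y i < 1) (h2 : ∀ i : Fin M, ¬ (i : ℕ) < l → ρ * y i < 1)
    (h3 : ∀ i j : Fin M, (i : ℕ) < l → ¬ (j : ℕ) < l → y i * y j < 1) :
    ∃ X Y : NNReal, (∀ i : Fin M, (i : ℕ) < l → y i ≤ X) ∧ (∀ i : Fin M, ¬ (i : ℕ) < l → y i ≤ Y) ∧
      X < 1 ∧ ρ * Y < 1 ∧ X * Y < 1 := by
  set X := ({i : Fin M | (i : ℕ) < l} : Finset _).sup y with hX
  set Y := ({i : Fin M | ¬ (i : ℕ) < l} : Finset _).sup y with hY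
  have hXle : ∀ i : Fin M, (i : ℕ) < l → y i ≤ X := fun i hi => le_sup (f := y) (by simpa using hi)
  have hYle : ∀ i : Fin M, ¬ (i : ℕ) < l → y i ≤ Y := fun i hi => le_sup (f := y) (by simpa using hi)
  have key : ∀ (s : Finset (Fin M)) (a : NNReal), (∀ i ∈ s, a * y i < 1) → a * s.sup y < 1 := by
    intro s a h
    rw [NNReal.mul_finset_sup]
    exact (Finset.sup_lt_iff (by simp)).mpr h
  refine ⟨X, Y, hXle, hYle, (Finset.sup_lt_iff (by simp)).mpr fun i hi => h1 i (by simpa using hi),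
    key _ _ fun i hi => h2 i (by simpa using hi), key _ _ fun j hj => ?_⟩
  rw [mul_comm]
  exact key _ _ fun i hi => by
    rw [mul_comm]; exact h3 i j (by simpa using hi) (by simpa using hj)

/-- Let S₁ and S₂ be the sums of the indices with sign + and -. If S₁ ≥ S₂, a term is O((XY)^S₂
X^(S₁-S₂)); otherwise it is O((XY)^S₁ (ρY)^(S₂-S₁)). Both are at most θ^max(S₁,S₂), where θ < 1
bounds the three bases. -/
lemma summable_genTerm (l : ℕ) {R : ℤ → ℂ} {w : Fin M → ℕ → ℂ} {x : Fin M → ℂ} {ρ : ℝ} (hρ : 0 ≤ ρ)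
    (hR : GrowthLE R ρ) (hw : ∀ i, ∃ K : ℝ, ∀ n, ‖w i n‖ ≤ K)
    (h1 : ∀ i : Fin M, (i : ℕ) < l → ‖x i‖ < 1) (h2 : ∀ i : Fin M, ¬ (i : ℕ) < l → ρ * ‖x i‖ < 1)
    (h3 : ∀ i j : Fin M, (i : ℕ) < l → ¬ (j : ℕ) < l → ‖x i‖ * ‖x j‖ < 1) :
    Summable (genTerm l R w x) := by
  obtain ⟨K, hK⟩ := hR
  choose B hB using hw
  obtain ⟨X, Y, hX, hY, hX1, hY1, hXY⟩ := exists_bound_pos_neg l (fun i => ‖x i‖₊) ⟨ρ, hρ⟩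
    (fun i hi => h1 i hi) (fun i hi => h2 i hi) (fun i j hi hj => h3 i j hi hj)
  set θ : ℝ := max (X * Y) (max X (ρ * Y)) with hθ
  have hθ1 : θ < 1 := max_lt hXY (max_lt hX1 hY1)
  have hX0 : (0 : ℝ) ≤ X := X.2
  have hY0 : (0 : ℝ) ≤ Y := Y.2
  have hθ0 : 0 ≤ θ := le_max_of_le_left (by positivity)
  -- Since 2 max(S₁,S₂) ≥ S₁ + S₂, a square root of θ gives a bound by a product of geometric
  -- sequences.
  set η := √θ with hη
  have hη0 : 0 ≤ η := Real.sqrt_nonneg _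
  have hη1 : η < 1 := by rw [hη, Real.sqrt_lt' one_pos]; simpa using hθ1
  have hηθ : η ^ 2 = θ := Real.sq_sqrt hθ0
  have hK0 : 0 ≤ K := by simpa using (norm_nonneg _).trans (hK 0)
  have hbound : ∀ m : Fin M → ℕ, ρ ^ (-(signedSum m l)).toNat * ∏ i, ‖x i‖ ^ m i ≤
      ∏ i, η ^ m i := by
    intro m
    set S₁ := ∑ i : Fin M with i.val < l, m i with hS1
    set S₂ := ∑ i : Fin M with ¬ i.val < l, m i with hS2
    have e1 : ∏ i, ‖x i‖ ^ m i ≤ X ^ S₁ * Y ^ S₂ := by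
      rw [← prod_filter_mul_prod_filter_not univ fun i : Fin M => (i : ℕ) < l,
        hS1, hS2, ← prod_pow_eq_pow_sum, ← prod_pow_eq_pow_sum]
      refine mul_le_mul (prod_le_prod (fun _ _ => by positivity) fun i hi => ?_)
        (prod_le_prod (fun _ _ => by positivity) fun i hi => ?_)
        (prod_nonneg fun _ _ => by positivity) (prod_nonneg fun _ _ => by positivity)
      · exact pow_le_pow_left₀ (norm_nonneg _) (hX i (by simpa using hi)) _
      · exact pow_le_pow_left₀ (norm_nonneg _) (hY i (by simpa using hi)) _
    have e2 : ∏ i, η ^ m i = η ^ (S₁ + S₂) := by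
      rw [prod_pow_eq_pow_sum, hS1, hS2, sum_filter_add_sum_filter_not]
    rw [signedSum_eq_sub, e2, ← hS1, ← hS2]
    refine (mul_le_mul_of_nonneg_left e1 (by positivity)).trans ?_
    rcases le_total S₂ S₁ with h | h
    · obtain ⟨d, hd⟩ := Nat.exists_eq_add_of_le h
      have : (-((S₁ : ℤ) - S₂)).toNat = 0 := by omega
      rw [this, hd]
      calc ρ ^ 0 * ((X : ℝ) ^ (S₂ + d) * Y ^ S₂) = (X * Y) ^ S₂ * X ^ d := by ring
        _ ≤ θ ^ S₂ * θ ^ d := by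
          gcongr
          · exact le_max_left _ _
          · exact le_max_of_le_right (le_max_left _ _)
        _ = η ^ (S₂ + d + S₂) * η ^ d := by rw [← hηθ]; ring
        _ ≤ η ^ (S₂ + d + S₂) := mul_le_of_le_one_right (by positivity) (pow_le_one₀ hη0 hη1.le)
    · obtain ⟨d, hd⟩ := Nat.exists_eq_add_of_le h
      have : (-((S₁ : ℤ) - S₂)).toNat = d := by omega
      rw [this, hd]
      calc ρ ^ d * ((X : ℝ) ^ S₁ * Y ^ (S₁ + d)) = (X * Y) ^ S₁ * (ρ * Y) ^ d := by ring
        _ ≤ θ ^ S₁ * θ ^ d := by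
          gcongr
          · exact le_max_left _ _
          · exact le_max_of_le_right (le_max_right _ _)
        _ = η ^ (S₁ + (S₁ + d)) * η ^ d := by rw [← hηθ]; ring
        _ ≤ η ^ (S₁ + (S₁ + d)) := mul_le_of_le_one_right (by positivity) (pow_le_one₀ hη0 hη1.le)
  refine Summable.of_norm_bounded ((summable_prod_pow M hη0 hη1).mul_left (K * ∏ i, B i))
    fun m => ?_
  rw [genTerm, norm_mul, norm_mul, norm_prod, norm_prod]
  simp only [norm_pow]
  calc ‖R (signedSum m l)‖ * (∏ i, ‖w i (m i)‖) * ∏ i, ‖x i‖ ^ m i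
      ≤ (K * ρ ^ (-(signedSum m l)).toNat) * (∏ i, B i) * ∏ i, ‖x i‖ ^ m i := by
        refine mul_le_mul_of_nonneg_right ?_ (prod_nonneg fun _ _ => by positivity)
        exact mul_le_mul (hK _) (prod_le_prod (fun _ _ => norm_nonneg _) fun i _ => hB i _)
          (prod_nonneg fun _ _ => norm_nonneg _) (by positivity)
    _ = (K * ∏ i, B i) * (ρ ^ (-(signedSum m l)).toNat * ∏ i, ‖x i‖ ^ m i) := by ring
    _ ≤ (K * ∏ i, B i) * ∏ i, η ^ m i := by
        refine mul_le_mul_of_nonneg_left (hbound m) (mul_nonneg hK0 (prod_nonneg fun i _ => ?_))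
        exact (norm_nonneg _).trans (hB i 0)

/-- A series with general term `genTerm` and constant term `1` tends to `1` when its variables
shrink geometrically. -/
lemma tendsto_tsum_genTerm (l : ℕ) {R : ℤ → ℂ} {w : Fin M → ℕ → ℂ} {x : ℕ → Fin M → ℂ} {y : Fin M → ℂ}
    (hs : Summable (genTerm l R w y)) (hR : R 0 = 1) (hw : ∀ i, w i 0 = 1)
    (hle : ∀ᶠ k in atTop, ∀ i, ‖x k i‖ ≤ ‖y i‖) (hx : ∀ i, Tendsto (fun k => x k i) atTop (𝓝 0)) :
    Tendsto (fun k => ∑' m, genTerm l R w (x k) m) atTop (𝓝 1) := by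
  have hsum : ∑' m : Fin M → ℕ, (if m = 0 then (1 : ℂ) else 0) = 1 := by simp
  rw [← hsum]
  refine tendsto_tsum_of_dominated_convergence (bound := fun m => ‖genTerm l R w y m‖) hs.norm
    (fun m => ?_) ?_
  · have h0 : ∀ i, Tendsto (fun k => x k i ^ m i) atTop (𝓝 (0 ^ m i)) := fun i => (hx i).pow _
    have h1 := (tendsto_finsetProd univ fun i _ => h0 i).const_mul
      (R (signedSum m l) * ∏ i, w i (m i))
    convert h1 using 1
    congr 1
    split_ifs with hm
    · subst hm
      simp [hw, hR, signedSum]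
    · obtain ⟨i, hi⟩ := Function.ne_iff.mp hm
      rw [prod_eq_zero (f := fun c => (0 : ℂ) ^ m c) (mem_univ i) (zero_pow hi), mul_zero]
  · filter_upwards [hle] with k hk m
    rw [genTerm, genTerm, norm_mul, norm_mul _ (∏ i, y i ^ m i), norm_prod, norm_prod _ fun i => y i ^ m i]
    refine mul_le_mul_of_nonneg_left (prod_le_prod (fun _ _ => norm_nonneg _) fun i _ => ?_)
      (norm_nonneg _)
    rw [norm_pow, norm_pow]
    exact pow_le_pow_left₀ (norm_nonneg _) (hk i) _

end GenTerm

/-! ### The components of `u` in the normal form `genTerm` -/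

lemma tailProd_eq_mul {M : ℕ} (b : Fin M → ℂ) (l : Fin M) :
    tailProd b l = b l * tailProd b (l + 1) := by
  unfold tailProd
  rw [← mul_prod_erase _ _ (show l ∈ ({i : Fin M | (l : ℕ) ≤ i.val} : Finset _) by simp)]
  congr 1
  refine prod_congr ?_ fun _ _ => rfl
  ext i
  simp only [mem_erase, mem_filter, mem_univ, true_and, ne_eq, Fin.ext_iff]
  omega

lemma tailProd_ne_zero {M : ℕ} {b : Fin M → ℂ} (hb : ∀ i, b i ≠ 0) (l : ℕ) : tailProd b l ≠ 0 :=
  prod_ne_zero_iff.mpr fun i _ => hb i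

lemma prod_lt_mul_prod_gt_mul {M : ℕ} (l : Fin M) (f : Fin M → ℂ) :
    (∏ i with i < l, f i) * (∏ i with l < i, f i) * f l = ∏ i, f i := by
  rw [← prod_erase_mul univ f (mem_univ l),
    ← prod_filter_mul_prod_filter_not (univ.erase l) fun i => i < l]
  congr 2
  · refine prod_congr ?_ fun _ _ => rfl
    ext i
    simp only [mem_filter, mem_erase, mem_univ, true_and, and_true]
    exact ⟨fun h => ⟨h.ne, h⟩, fun h => h.2⟩
  · refine prod_congr ?_ fun _ _ => rfl
    ext i
    simp only [mem_filter, mem_erase, mem_univ, true_and, and_true, not_lt]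
    exact ⟨fun h => ⟨h.ne', h.le⟩, fun h => lt_of_le_of_ne h.2 (Ne.symm h.1)⟩

/-- The cycles in the definition of the series move indices only within one side of the cut, so the
signed sum is unaffected by the reindexing. -/
lemma signedSum_comp {M : ℕ} (m : Fin M → ℕ) (s : Equiv.Perm (Fin M)) (l : ℕ)
    (h : ∀ i, (s i : ℕ) < l ↔ (i : ℕ) < l) : signedSum (fun i => m (s i)) l = signedSum m l := by
  unfold signedSum
  rw [← Equiv.sum_comp s fun i : Fin M => if (i : ℕ) < l then (m i : ℤ) else -(m i : ℤ)]
  simp only [h]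

lemma cycleIcc_le_iff {M : ℕ} {p l : Fin M} (h : p ≤ l) (i : Fin M) :
    Fin.cycleIcc p l i ≤ l ↔ i ≤ l := by
  have : NeZero M := ⟨by have := l.isLt; omega⟩
  rcases lt_or_ge l i with hi | hi
  · rw [Fin.cycleIcc_of_gt hi]
  · refine iff_of_true ?_ hi
    rcases lt_or_ge i p with h1 | h1
    · rw [Fin.cycleIcc_of_lt h1]; exact hi
    · rcases hi.lt_or_eq with h2 | h2
      · rw [Fin.cycleIcc_of_ge_of_lt h1 h2]
        rw [Fin.le_def, Fin.val_add_one_of_lt' (by omega)]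
        omega
      · rw [h2, Fin.cycleIcc_of_last h]; exact h

lemma cycleIcc_lt_iff {M : ℕ} {p l : Fin M} (h : p ≤ l) (i : Fin M) :
    Fin.cycleIcc p l i < p ↔ i < p := by
  have : NeZero M := ⟨by have := l.isLt; omega⟩
  rcases lt_or_ge i p with hi | hi
  · rw [Fin.cycleIcc_of_lt hi]
  · refine iff_of_false ?_ (not_lt.mpr hi)
    rcases lt_or_ge l i with h1 | h1
    · rw [Fin.cycleIcc_of_gt h1]; exact not_lt.mpr hi
    · rcases h1.lt_or_eq with h2 | h2
      · rw [Fin.cycleIcc_of_ge_of_lt hi h2]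
        rw [Fin.lt_def, Fin.val_add_one_of_lt' (by omega)]
        omega
      · rw [h2, Fin.cycleIcc_of_last h]; exact lt_irrefl _

noncomputable section NormalForm

variable {N M : ℕ} (q : ℂ) (a : Fin N → ℂ) (b : Fin M → ℂ) (c : Fin N → ℂ) (L : ℕ)

/-- The number of indices that enter the signed sum of the component `i` with the sign `+`. -/
def compCut : Option (Fin N × Fin M) → ℕ
  | none => L
  | some (_, l) => if (l : ℕ) < L then l else l + 1

/-- The base of the two-sided factor of `u_{k,l}`. -/
def twoSidedBase (k : Fin N) (l : Fin M) : ℂ :=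
  if (l : ℕ) < L then c k / (q * tailProd b (l + 1)) else a k / tailProd b (l + 1)

/-- The factor of the component `i` that depends on the signed sum of the indices. -/
def compTwoSided : Option (Fin N × Fin M) → ℤ → ℂ
  | none => fun n => ∏ j, qPoch q (a j / tailProd b L) n / qPoch q (c j / tailProd b L) n
  | some (k, l) => fun n =>
      qPoch q (twoSidedBase q a b c L k l) n / qPoch q (q * twoSidedBase q a b c L k l / b l) n

/-- The one-sided factor that replaces the factor of `b_l` in `u_{k,l}`. -/
def pivotFactor (k : Fin N) (l : Fin M) (n : ℕ) : ℂ :=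
  if (l : ℕ) < L then ∏ j, qPoch q (q * a j / c k) n / qPoch q (q * c j / c k) n
  else ∏ j, qPoch q (q * a k / c j) n / qPoch q (q * a k / a j) n

/-- The factors of the component `i` that depend on a single index. -/
def compOneSided : Option (Fin N × Fin M) → Fin M → ℕ → ℂ
  | none => fun i n => qPoch q (b i) n / qPoch q q n
  | some (k, l) => fun i n =>
      if i = l then pivotFactor q a c L k l n else qPoch q (b i) n / qPoch q q n

/-- The variables of the power series in the component `i`. -/
def compVar (t : Fin M → ℂ) : Option (Fin N × Fin M) → Fin M → ℂ
  | none => fun i => if (i : ℕ) < L then t i else q / (b i * t i)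
  | some (_, l) => fun i =>
      if i < l then q * t i / (b l * t l)
      else if l < i then b l * t l / (b i * t i)
      else if (l : ℕ) < L then b l * t l / q
      else (∏ j, c j / a j) * (q / (b l * t l))

variable {L} in
lemma compVar_of_lt (t : Fin M → ℂ) (k : Fin N) {i l : Fin M} (h : i < l) :
    compVar q a b c L t (some (k, l)) i = q * t i / (b l * t l) := by
  simp only [compVar]; rw [if_pos h]

variable {L} in
lemma compVar_of_gt (t : Fin M → ℂ) (k : Fin N) {i l : Fin M} (h : l < i) :
    compVar q a b c L t (some (k, l)) i = b l * t l / (b i * t i) := by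
  simp only [compVar]; rw [if_neg (not_lt.mpr h.le), if_pos h]

lemma compVar_self (t : Fin M → ℂ) (k : Fin N) (l : Fin M) :
    compVar q a b c L t (some (k, l)) l = if (l : ℕ) < L then b l * t l / q
      else (∏ j, c j / a j) * (q / (b l * t l)) := by
  simp only [compVar, lt_irrefl, if_false]

lemma termF0_eq_genTerm (t : Fin M → ℂ) (m : Fin M → ℕ) :
    termF0 q a b c L t m = genTerm L (compTwoSided q a b c L none) (compOneSided q a b c L none)
      (compVar q a b c L t none) m := by
  simp only [termF0, genTerm, compTwoSided, compOneSided, compVar]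
  rw [mul_assoc _ (∏ i : Fin M with i.val < L, t i ^ m i)]
  congr 1
  rw [← prod_filter_mul_prod_filter_not univ fun i : Fin M => (i : ℕ) < L]
  congr 1
  · exact prod_congr rfl fun i hi => by rw [if_pos (by simpa using hi)]
  · simp only [not_lt]
    exact prod_congr rfl fun i hi => by
      have hi' : L ≤ (i : ℕ) := by simpa using hi
      rw [if_neg (not_lt.mpr hi')]

variable {b} in
lemma two_sided_denominator (hb : ∀ i, b i ≠ 0) (l : Fin M) (x : ℂ) :
    q * (x / tailProd b (l + 1)) / b l = q * x / tailProd b l := by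
  have h1 := tailProd_ne_zero hb (l + 1)
  have h2 := hb l
  rw [tailProd_eq_mul]
  field_simp

lemma genTerm_some_eq (t : Fin M → ℂ) (k : Fin N) (l : Fin M) (l' : ℕ) (μ : Fin M → ℕ) :
    genTerm l' (compTwoSided q a b c L (some (k, l))) (compOneSided q a b c L (some (k, l)))
      (compVar q a b c L t (some (k, l))) μ =
    pivotFactor q a c L k l (μ l) *
      (∏ i with i ≠ l, qPoch q (b i) (μ i) / qPoch q q (μ i)) *
      compTwoSided q a b c L (some (k, l)) (signedSum μ l') *
      (∏ i with i < l, (q * t i / (b l * t l)) ^ μ i) *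
      (∏ i with l < i, (b l * t l / (b i * t i)) ^ μ i) *
      compVar q a b c L t (some (k, l)) l ^ μ l := by
  rw [genTerm, ← prod_lt_mul_prod_gt_mul l fun i => compVar q a b c L t (some (k, l)) i ^ μ i,
    ← mul_prod_erase univ _ (mem_univ l), ← filter_ne']
  have e1 : ∏ i with i ≠ l, compOneSided q a b c L (some (k, l)) i (μ i) =
      ∏ i with i ≠ l, qPoch q (b i) (μ i) / qPoch q q (μ i) :=
    prod_congr rfl fun i hi => by simp only [compOneSided]; rw [if_neg (by simpa using hi)]
  have e2 : ∏ i with i < l, compVar q a b c L t (some (k, l)) i ^ μ i =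
      ∏ i with i < l, (q * t i / (b l * t l)) ^ μ i :=
    prod_congr rfl fun i hi => by
      rw [compVar_of_lt q a b c t k (by simpa using hi)]
  have e3 : ∏ i with l < i, compVar q a b c L t (some (k, l)) i ^ μ i =
      ∏ i with l < i, (b l * t l / (b i * t i)) ^ μ i :=
    prod_congr rfl fun i hi => by
      rw [compVar_of_gt q a b c t k (by simpa using hi)]
  have e4 : compOneSided q a b c L (some (k, l)) l (μ l) = pivotFactor q a c L k l (μ l) := by
    simp [compOneSided]
  rw [e1, e2, e3, e4]
  ring

variable {q b} in
/-- After a permutation of the summation indices, the terms of every component are in the normal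
form `genTerm`. -/
lemma exists_uTerm_eq_genTerm (hq : q ≠ 0) (hb : ∀ i, b i ≠ 0) (hL : L ≤ M) (i : Option (Fin N × Fin M)) :
    ∃ s : Equiv.Perm (Fin M), ∀ (t : Fin M → ℂ) (m : Fin M → ℕ),
      uTerm q a b c L hL t i m = genTerm (compCut L i) (compTwoSided q a b c L i)
        (compOneSided q a b c L i) (compVar q a b c L t i) fun j => m (s j) := by
  rcases i with _ | ⟨k, l⟩
  · exact ⟨1, fun t m => termF0_eq_genTerm q a b c L t m⟩
  have hM : M ≠ 0 := by have := l.isLt; omega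
  have : NeZero M := ⟨hM⟩
  by_cases hl : (l : ℕ) < L
  · have hle : l ≤ (⟨L - 1, by omega⟩ : Fin M) := by rw [Fin.le_def]; dsimp; omega
    refine ⟨(Fin.cycleIcc l ⟨L - 1, by omega⟩).symm, fun t m => ?_⟩
    have hsl : (Fin.cycleIcc l (⟨L - 1, by omega⟩ : Fin M)).symm l = ⟨L - 1, by omega⟩ := by
      rw [Equiv.symm_apply_eq, Fin.cycleIcc_of_last hle]
    have hsum : signedSum (fun j => m ((Fin.cycleIcc l (⟨L - 1, by omega⟩ : Fin M)).symm j)) l =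
        signedSum m l := by
      refine signedSum_comp m _ _ fun i => ?_
      have := cycleIcc_lt_iff hle ((Fin.cycleIcc l (⟨L - 1, by omega⟩ : Fin M)).symm i)
      rw [Equiv.apply_symm_apply] at this
      rw [← Fin.lt_def, ← Fin.lt_def]
      exact this.symm
    have hbase : q * twoSidedBase q a b c L k l / b l = c k / tailProd b l := by
      rw [← mul_div_cancel₀ (c k) hq, ← two_sided_denominator q hb, twoSidedBase, if_pos hl,
        ← div_div]
    rw [genTerm_some_eq]
    simp only [uTerm, dif_pos hl, termG, compCut, if_pos hl, pivotFactor, compTwoSided, hsum, hsl,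
      hbase]
    simp only [twoSidedBase, compVar_self, if_pos hl]
  · have hle : (⟨L, by omega⟩ : Fin M) ≤ l := by rw [Fin.le_def]; dsimp; omega
    refine ⟨Fin.cycleIcc ⟨L, by omega⟩ l, fun t m => ?_⟩
    have hsl : Fin.cycleIcc (⟨L, by omega⟩ : Fin M) l l = ⟨L, by omega⟩ :=
      Fin.cycleIcc_of_last hle
    have hsum : signedSum (fun j => m (Fin.cycleIcc (⟨L, by omega⟩ : Fin M) l j)) (l + 1) =
        signedSum m (l + 1) := by
      refine signedSum_comp m _ _ fun i => ?_
      have := cycleIcc_le_iff hle i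
      rw [Nat.lt_succ_iff, Nat.lt_succ_iff, ← Fin.le_def, ← Fin.le_def]
      exact this
    have hbase : q * twoSidedBase q a b c L k l / b l = q * a k / tailProd b l := by
      rw [← two_sided_denominator q hb, twoSidedBase, if_neg hl]
    rw [genTerm_some_eq]
    simp only [uTerm, dif_neg hl, termF, compCut, if_neg hl, pivotFactor, compTwoSided, hsum, hsl,
      hbase]
    simp only [twoSidedBase, compVar_self, if_neg hl]

end NormalForm

/-! ### Convergence -/

section Convergence

variable {N M : ℕ} {q : ℂ} {a : Fin N → ℂ} {b : Fin M → ℂ} {c : Fin N → ℂ}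

/-- The standing assumptions on the parameters, for the trivial permutation. -/
structure Admissible (q : ℂ) (a : Fin N → ℂ) (b : Fin M → ℂ) (c : Fin N → ℂ) : Prop where
  q_ne : q ≠ 0
  q_lt : ‖q‖ < 1
  a_ne : ∀ j, a j ≠ 0
  b_ne : ∀ i, b i ≠ 0
  c_ne : ∀ j, c j ≠ 0
  a_div_a : ∀ j k : Fin N, j ≠ k → ∀ n : ℤ, a j / a k ≠ q ^ n
  c_div_c : ∀ j k : Fin N, j ≠ k → ∀ n : ℤ, c j / c k ≠ q ^ n
  a_div_b : ∀ (j : Fin N) (i : ℕ), i ≤ M → ∀ n : ℤ, a j / tailProd b i ≠ q ^ n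
  c_div_b : ∀ (j : Fin N) (i : ℕ), i ≤ M → ∀ n : ℤ, c j / tailProd b i ≠ q ^ n

lemma mul_zpow_ne_one {x : ℂ} (hq : q ≠ 0) (h : ∀ n : ℤ, x ≠ q ^ n) (d n : ℤ) :
    q ^ d * x * q ^ n ≠ 1 := by
  intro h1
  refine h (-(d + n)) ?_
  rw [zpow_neg, zpow_add₀ hq]
  refine eq_inv_of_mul_eq_one_left ?_
  rw [← h1]; ring

lemma Admissible.pow_ne_one (h : Admissible q a b c) (n : ℕ) : q * q ^ n ≠ 1 := by
  intro h1
  have := congrArg norm h1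
  rw [← pow_succ', norm_pow, norm_one] at this
  exact (pow_lt_one₀ (norm_nonneg _) h.q_lt (by omega)).ne this

lemma Admissible.zpow_ne_one (h : Admissible q a b c) {n : ℤ} (hn : n ≠ 0) : q ^ n ≠ 1 := by
  rcases lt_or_gt_of_ne hn with h1 | h1
  · obtain ⟨m, rfl⟩ : ∃ m : ℕ, n = -(m + 1 : ℕ) := ⟨(-n - 1).toNat, by omega⟩
    rw [zpow_neg, zpow_natCast, pow_succ']
    exact fun h2 => h.pow_ne_one m (inv_eq_one.mp h2)
  · obtain ⟨m, rfl⟩ : ∃ m : ℕ, n = (m + 1 : ℕ) := ⟨(n - 1).toNat, by omega⟩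
    rw [zpow_natCast, pow_succ']
    exact h.pow_ne_one m

variable {L : ℕ}

lemma Admissible.tailProd_ne (h : Admissible q a b c) (l : ℕ) : tailProd b l ≠ 0 :=
  tailProd_ne_zero h.b_ne l

lemma Admissible.a_div_tail (h : Admissible q a b c) (j : Fin N) {i : ℕ} (hi : i ≤ M) (n : ℤ) :
    a j / tailProd b i * q ^ n ≠ 1 := by
  simpa using mul_zpow_ne_one h.q_ne (h.a_div_b j i hi) 0 n

lemma Admissible.c_div_tail (h : Admissible q a b c) (j : Fin N) {i : ℕ} (hi : i ≤ M) (n : ℤ) :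
    c j / tailProd b i * q ^ n ≠ 1 := by
  simpa using mul_zpow_ne_one h.q_ne (h.c_div_b j i hi) 0 n

lemma Admissible.twoSidedBase_ne (h : Admissible q a b c) (k : Fin N) (l : Fin M) :
    twoSidedBase q a b c L k l ≠ 0 := by
  unfold twoSidedBase
  split_ifs
  · exact div_ne_zero (h.c_ne k) (mul_ne_zero h.q_ne (h.tailProd_ne _))
  · exact div_ne_zero (h.a_ne k) (h.tailProd_ne _)

lemma Admissible.twoSidedBase_mul (h : Admissible q a b c) (k : Fin N) (l : Fin M) (n : ℤ) :
    twoSidedBase q a b c L k l * q ^ n ≠ 1 := by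
  unfold twoSidedBase
  have hl := l.isLt
  split_ifs
  · have := mul_zpow_ne_one h.q_ne (h.c_div_b k (l + 1) (by omega)) (-1) n
    rwa [zpow_neg_one, inv_mul_eq_div, div_div, mul_comm (tailProd b _)] at this
  · exact h.a_div_tail k (by omega) n

lemma Admissible.twoSidedBase_div_mul (h : Admissible q a b c) (k : Fin N) (l : Fin M) (n : ℤ) :
    q * twoSidedBase q a b c L k l / b l * q ^ n ≠ 1 := by
  unfold twoSidedBase
  have hl := l.isLt
  have hq := h.q_ne
  split_ifs
  · rw [← div_div, two_sided_denominator q h.b_ne, mul_div_cancel₀ _ hq]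
    exact h.c_div_tail k hl.le n
  · rw [two_sided_denominator q h.b_ne, mul_div_assoc]
    simpa using mul_zpow_ne_one hq (h.a_div_b k l hl.le) 1 n

/-- The geometric growth rate of the two-sided factor. -/
noncomputable def compRate (q : ℂ) (a : Fin N → ℂ) (b : Fin M → ℂ) (c : Fin N → ℂ) :
    Option (Fin N × Fin M) → ℝ
  | none => ‖∏ j, c j / a j‖
  | some (_, l) => ‖q / b l‖

/-- The rate is the quotient of the bases of denominator and numerator: for u_0 the products of the
b_i cancel and ∏ c_j/a_j is left, for u_{k,l} it is q/b_l. -/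
lemma Admissible.growthLE (h : Admissible q a b c) (hL : L ≤ M) (i : Option (Fin N × Fin M)) :
    GrowthLE (compTwoSided q a b c L i) (compRate q a b c i) := by
  rcases i with _ | ⟨k, l⟩
  · have h1 := GrowthLE.prod univ fun j => growthLE_qPoch_div h.q_ne h.q_lt
      (div_ne_zero (h.a_ne j) (h.tailProd_ne L)) (div_ne_zero (h.c_ne j) (h.tailProd_ne L))
      (h.a_div_tail j hL) (h.c_div_tail j hL)
    have h2 : compRate q a b c none = ∏ j, ‖c j / tailProd b L / (a j / tailProd b L)‖ := by
      simp only [compRate]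
      rw [norm_prod]
      refine prod_congr rfl fun j _ => ?_
      rw [div_div_div_cancel_right₀ (h.tailProd_ne L)]
    rw [h2]
    exact h1
  · have h0 := h.twoSidedBase_ne (L := L) k l
    have h1 := growthLE_qPoch_div h.q_ne h.q_lt h0
      (div_ne_zero (mul_ne_zero h.q_ne h0) (h.b_ne l)) (h.twoSidedBase_mul k l)
      (h.twoSidedBase_div_mul k l)
    rw [mul_div_right_comm, mul_div_cancel_right₀ _ h0, ← mul_div_right_comm] at h1
    exact h1

lemma Admissible.pivot_denominator_ne (h : Admissible q a b c) (j k : Fin N) (n : ℕ) :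
    q * c j / c k * q ^ n ≠ 1 ∧ q * a k / a j * q ^ n ≠ 1 := by
  by_cases hjk : j = k
  · subst hjk
    rw [mul_div_cancel_right₀ _ (h.c_ne j), mul_div_cancel_right₀ _ (h.a_ne j)]
    exact ⟨h.pow_ne_one n, h.pow_ne_one n⟩
  · constructor
    · simpa [mul_div_assoc] using mul_zpow_ne_one h.q_ne (h.c_div_c j k hjk) 1 n
    · simpa [mul_div_assoc] using mul_zpow_ne_one h.q_ne (h.a_div_a k j (Ne.symm hjk)) 1 n

lemma exists_norm_prod_le {f : Fin N → ℕ → ℂ} (h : ∀ j, ∃ K : ℝ, ∀ n, ‖f j n‖ ≤ K) :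
    ∃ K : ℝ, ∀ n, ‖∏ j, f j n‖ ≤ K := by
  choose K hK using h
  refine ⟨∏ j, K j, fun n => ?_⟩
  rw [norm_prod]
  exact prod_le_prod (fun _ _ => norm_nonneg _) fun j _ => hK j n

lemma Admissible.pivotFactor_le (h : Admissible q a b c) (k : Fin N) (l : Fin M) :
    ∃ K : ℝ, ∀ n, ‖pivotFactor q a c L k l n‖ ≤ K := by
  unfold pivotFactor
  split_ifs
  · exact exists_norm_prod_le fun j =>
      exists_norm_qPoch_div_le h.q_lt _ fun n => (h.pivot_denominator_ne j k n).1
  · exact exists_norm_prod_le fun j =>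
      exists_norm_qPoch_div_le h.q_lt _ fun n => (h.pivot_denominator_ne j k n).2

lemma Admissible.compOneSided_le (h : Admissible q a b c) (i : Option (Fin N × Fin M)) (j : Fin M) :
    ∃ K : ℝ, ∀ n, ‖compOneSided q a b c L i j n‖ ≤ K := by
  have h0 := exists_norm_qPoch_div_le h.q_lt (b j) h.pow_ne_one
  rcases i with _ | ⟨k, l⟩
  · exact h0
  · simp only [compOneSided]
    split_ifs
    · exact h.pivotFactor_le k l
    · exact h0

lemma compTwoSided_zero (i : Option (Fin N × Fin M)) : compTwoSided q a b c L i 0 = 1 := by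
  rcases i with _ | ⟨k, l⟩ <;> simp [compTwoSided]

lemma compOneSided_zero (i : Option (Fin N × Fin M)) (j : Fin M) :
    compOneSided q a b c L i j 0 = 1 := by
  rcases i with _ | ⟨k, l⟩ <;> simp [compOneSided, pivotFactor]

/-- The region of convergence in the coordinates `t`. -/
structure InRegion (q : ℂ) (a : Fin N → ℂ) (b : Fin M → ℂ) (c : Fin N → ℂ) (L : ℕ)
    (t : Fin M → ℂ) : Prop where
  ne_zero : ∀ i, t i ≠ 0
  small : ∀ i : Fin M, (i : ℕ) < L → ‖t i‖ < 1
  large : ∀ i : Fin M, L ≤ (i : ℕ) → ‖(∏ j, c j / a j) * (q / (b i * t i))‖ < 1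
  ratio : ∀ i j : Fin M, i < j → ‖q * t i / (b j * t j)‖ < 1

/-- Each hypothesis of `summable_genTerm` turns into one inequality of the region. The product of
two variables on opposite sides of the cut telescopes, as in (q t_i/(b_l t_l)) (b_l t_l/(b_j t_j)) =
q t_i/(b_j t_j); with the pivot variable it gives a condition on a single t_i. -/
lemma Admissible.summable (h : Admissible q a b c) (hL : L ≤ M) {t : Fin M → ℂ}
    (ht : InRegion q a b c L t) (i : Option (Fin N × Fin M)) :
    Summable (genTerm (compCut L i) (compTwoSided q a b c L i) (compOneSided q a b c L i)
      (compVar q a b c L t i)) := by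
  have hρ : 0 ≤ compRate q a b c i := by rcases i with _ | ⟨k, l⟩ <;> exact norm_nonneg _
  refine summable_genTerm _ hρ (h.growthLE hL i) (h.compOneSided_le i) ?_ ?_ ?_
  · intro j hj
    rcases i with _ | ⟨k, l⟩
    · simp only [compCut] at hj
      simpa only [compVar, if_pos hj] using ht.small j hj
    · simp only [compCut] at hj
      rcases lt_trichotomy j l with h1 | rfl | h1
      · rw [compVar_of_lt q a b c t k h1]
        exact ht.ratio _ _ h1
      · by_cases hl : (j : ℕ) < L
        · simp [hl] at hj
        · rw [compVar_self, if_neg hl]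
          exact ht.large j (by omega)
      · rw [Fin.lt_def] at h1
        split_ifs at hj <;> omega
  · intro j hj
    rcases i with _ | ⟨k, l⟩
    · simp only [compCut] at hj
      simp only [compVar, if_neg hj, compRate]
      rw [← norm_mul]
      exact ht.large j (by omega)
    · have e1 : l < j → ‖q / b l‖ * ‖b l * t l / (b j * t j)‖ < 1 := fun hlj => by
        rw [← norm_mul, ← mul_div_assoc, ← mul_assoc, div_mul_cancel₀ _ (h.b_ne l)]
        exact ht.ratio _ _ hlj
      simp only [compCut] at hj
      simp only [compRate]
      rcases lt_trichotomy j l with h1 | rfl | h1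
      · rw [Fin.lt_def] at h1
        split_ifs at hj <;> omega
      · by_cases hl : (j : ℕ) < L
        · rw [compVar_self, if_pos hl, ← norm_mul, div_mul_div_cancel₀' h.q_ne,
            mul_div_cancel_left₀ _ (h.b_ne j)]
          exact ht.small j hl
        · simp [hl] at hj
      · rw [compVar_of_gt q a b c t k h1]
        exact e1 h1
  · intro j j' hj hj'
    rw [← norm_mul]
    rcases i with _ | ⟨k, l⟩
    · simp only [compCut] at hj hj'
      simp only [compVar, if_pos hj, if_neg hj']
      rw [← mul_div_assoc, mul_comm (t j)]
      exact ht.ratio _ _ (by rw [Fin.lt_def]; omega)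
    · have hlt := mul_ne_zero (h.b_ne l) (ht.ne_zero l)
      simp only [compCut] at hj hj'
      by_cases hl : (l : ℕ) < L
      · simp only [if_pos hl] at hj hj'
        rw [compVar_of_lt q a b c t k (show j < l from hj)]
        rcases (show l ≤ j' from not_lt.mp hj').lt_or_eq with h2 | rfl
        · rw [compVar_of_gt q a b c t k h2, div_mul_div_cancel₀ hlt]
          exact ht.ratio _ _ (lt_trans hj h2)
        · rw [compVar_self, if_pos hl, div_mul_div_cancel₀ hlt, mul_div_cancel_left₀ _ h.q_ne]
          exact ht.small j (by omega)
      · simp only [if_neg hl] at hj hj'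
        have h2 : l < j' := by rw [Fin.lt_def]; omega
        rw [compVar_of_gt q a b c t k h2]
        rcases (show j ≤ l by rw [Fin.le_def]; omega).lt_or_eq with h3 | rfl
        · rw [compVar_of_lt q a b c t k h3, div_mul_div_cancel₀ hlt]
          exact ht.ratio _ _ (h3.trans h2)
        · rw [compVar_self, if_neg hl, mul_assoc, div_mul_div_cancel₀ hlt]
          exact ht.large j' (by rw [Fin.lt_def] at h2; omega)

end Convergence

/-! ### The system in expanded form -/

section System

variable {N M : ℕ}

/-- The polynomial `∏_j (1 - x_j X)`. -/
noncomputable def oneSubPoly (x : Fin N → ℂ) : Polynomial ℂ :=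
  ∏ j, (1 - Polynomial.C (x j) * Polynomial.X)

lemma eval_oneSubPoly (x : Fin N → ℂ) (w : ℂ) : (oneSubPoly x).eval w = ∏ j, (1 - x j * w) := by
  simp [oneSubPoly, Polynomial.eval_prod]

lemma natDegree_one_sub_le (x : ℂ) : (1 - Polynomial.C x * Polynomial.X).natDegree ≤ 1 :=
  (Polynomial.natDegree_sub_le _ _).trans (by
    simpa using Polynomial.natDegree_C_mul_le x Polynomial.X)

lemma natDegree_oneSubPoly_le (x : Fin N → ℂ) : (oneSubPoly x).natDegree ≤ N := by
  refine (Polynomial.natDegree_prod_le _ _).trans ?_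
  simpa using sum_le_sum fun j (_ : j ∈ (univ : Finset (Fin N))) => natDegree_one_sub_le (x j)

lemma coeff_zero_oneSubPoly (x : Fin N → ℂ) : (oneSubPoly x).coeff 0 = 1 := by
  rw [Polynomial.coeff_zero_eq_eval_zero, eval_oneSubPoly]
  simp

lemma coeff_top_oneSubPoly (x : Fin N → ℂ) : (oneSubPoly x).coeff N = ∏ j, (-x j) := by
  have h := Polynomial.coeff_prod_of_natDegree_le (s := univ)
    (fun j => 1 - Polynomial.C (x j) * Polynomial.X) 1 fun j _ => natDegree_one_sub_le (x j)
  simp only [card_univ, Fintype.card_fin, mul_one] at h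
  rw [oneSubPoly, h]
  refine prod_congr rfl fun j _ => ?_
  simp [Polynomial.coeff_one]

lemma shiftAllPt_iterate (τ : ℂ) (k : ℕ) (z : Fin M → ℂ) :
    (shiftAllPt τ)^[k] z = fun i => z i + k * τ := by
  induction k with
  | zero => simp
  | succ k ih =>
    rw [Function.iterate_succ_apply', ih]
    ext i
    simp only [shiftAllPt]
    push_cast
    ring

lemma shiftPt_shiftAllPt_iterate (τ : ℂ) (k : ℕ) (s : Fin M) (z : Fin M → ℂ) :
    shiftPt τ s ((shiftAllPt τ)^[k] z) = (shiftAllPt τ)^[k] (shiftPt τ s z) := by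
  rw [shiftAllPt_iterate, shiftAllPt_iterate]
  ext i
  by_cases h : i = s
  · subst h; simp [shiftPt]; ring
  · simp [shiftPt, h]

lemma shiftPt_comm (τ : ℂ) (r s : Fin M) (z : Fin M → ℂ) :
    shiftPt τ r (shiftPt τ s z) = shiftPt τ s (shiftPt τ r z) := by
  by_cases h : r = s
  · rw [h]
  · ext i
    by_cases h1 : i = r
    · subst h1; simp [shiftPt, h]
    · by_cases h2 : i = s
      · subst h2; simp [shiftPt, h1]
      · simp [shiftPt, h1, h2]

lemma TAll_pow_apply (τ : ℂ) (k : ℕ) (f : (Fin M → ℂ) → ℂ) (z : Fin M → ℂ) :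
    ((TAll τ : Op M) ^ k) f z = f ((shiftAllPt τ)^[k] z) := by
  induction k generalizing z with
  | zero => simp
  | succ k ih =>
    rw [pow_succ', Module.End.mul_apply, Function.iterate_succ_apply]
    exact ih (shiftAllPt τ z)

lemma prodOneSub_apply (τ : ℂ) (x : Fin N → ℂ) (f : (Fin M → ℂ) → ℂ) (z : Fin M → ℂ) :
    (prodOneSub τ x : Op M) f z =
      ∑ k ∈ range (N + 1), (oneSubPoly x).coeff k * f ((shiftAllPt τ)^[k] z) := by
  have h : (prodOneSub τ x : Op M) = Polynomial.aeval (TAll τ : Op M) (oneSubPoly x) := by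
    rw [oneSubPoly, ← List.prod_ofFn, map_list_prod, List.map_ofFn, prodOneSub]
    congr 2
    ext1 j
    simp [Algebra.smul_def]
  rw [h, Polynomial.aeval_eq_sum_range' (Nat.lt_succ_of_le (natDegree_oneSubPoly_le x))]
  simp [LinearMap.sum_apply, TAll_pow_apply]

/-- The first family of equations at the point `z`. -/
def EqOneAt (τ : ℂ) (a : Fin N → ℂ) (b : Fin M → ℂ) (c : Fin N → ℂ) (f : (Fin M → ℂ) → ℂ)
    (s : Fin M) (z : Fin M → ℂ) : Prop :=
  Complex.exp (z s) * ∑ k ∈ range (N + 1), (oneSubPoly a).coeff k *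
      (f ((shiftAllPt τ)^[k] z) - b s * f ((shiftAllPt τ)^[k] (shiftPt τ s z))) =
    ∑ k ∈ range (N + 1), (oneSubPoly fun j => c j * (Complex.exp τ)⁻¹).coeff k *
      (f ((shiftAllPt τ)^[k] z) - f ((shiftAllPt τ)^[k] (shiftPt τ s z)))

/-- The second family of equations at the point `z`. -/
def EqTwoAt (τ : ℂ) (b : Fin M → ℂ) (f : (Fin M → ℂ) → ℂ) (r s : Fin M) (z : Fin M → ℂ) : Prop :=
  Complex.exp (z r) * (f z - f (shiftPt τ s z) -
      b r * (f (shiftPt τ r z) - f (shiftPt τ r (shiftPt τ s z)))) =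
    Complex.exp (z s) * (f z - f (shiftPt τ r z) -
      b s * (f (shiftPt τ s z) - f (shiftPt τ r (shiftPt τ s z))))

/-- The second equation is symmetric in r and s, so r < s can be relaxed to r ≠ s. This is needed
for permutations of the variables, which do not respect the order. -/
lemma isSolutionOn_iff (τ : ℂ) (a : Fin N → ℂ) (b : Fin M → ℂ) (c : Fin N → ℂ)
    (D : Set (Fin M → ℂ)) (f : (Fin M → ℂ) → ℂ) :
    IsSolutionOn τ a b c D f ↔
      (∀ s z, (∀ n ≤ N, (shiftAllPt τ)^[n] z ∈ D ∧ (shiftAllPt τ)^[n] (shiftPt τ s z) ∈ D) →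
        EqOneAt τ a b c f s z) ∧
      (∀ r s, r ≠ s → ∀ z, z ∈ D → shiftPt τ r z ∈ D → shiftPt τ s z ∈ D →
        shiftPt τ r (shiftPt τ s z) ∈ D → EqTwoAt τ b f r s z) := by
  have h1 : ∀ s z, Complex.exp (z s) * (prodOneSub τ a * (1 - b s • T τ s) : Op M) f z -
      (prodOneSub τ (fun j => c j * (Complex.exp τ)⁻¹) * (1 - T τ s) : Op M) f z = 0 ↔
      EqOneAt τ a b c f s z := by
    intro s z
    rw [sub_eq_zero, Module.End.mul_apply, Module.End.mul_apply, prodOneSub_apply,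
      prodOneSub_apply, EqOneAt]
    simp [T, shiftPt_shiftAllPt_iterate]
  have h2 : ∀ r s z, Complex.exp (z r) * ((1 - b r • T τ r) * (1 - T τ s) : Op M) f z -
      Complex.exp (z s) * ((1 - b s • T τ s) * (1 - T τ r) : Op M) f z = 0 ↔
      EqTwoAt τ b f r s z := by
    intro r s z
    rw [sub_eq_zero, Module.End.mul_apply, Module.End.mul_apply, EqTwoAt]
    simp [T, shiftPt_comm τ s r]
  constructor
  · intro h
    refine ⟨fun s z hz => (h1 s z).mp (h.eq_one s z hz), fun r s hrs z hz hr hs hrs' => ?_⟩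
    rcases lt_or_gt_of_ne hrs with hlt | hlt
    · exact (h2 r s z).mp (h.eq_two r s hlt z hz hr hs hrs')
    · have := (h2 s r z).mp (h.eq_two s r hlt z hz hs hr (shiftPt_comm τ s r z ▸ hrs'))
      rw [EqTwoAt, shiftPt_comm τ s r] at this
      exact this.symm
  · rintro ⟨h3, h4⟩
    exact ⟨fun s z hz => (h1 s z).mpr (h3 s z hz), fun r s hrs z hz hr hs hrs' =>
      (h2 r s z).mpr (h4 r s hrs.ne z hz hr hs hrs')⟩

end System

/-! ### Formal solutions -/

section Formal

variable {N M : ℕ}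

lemma hasSum_of_eq {ι : Type*} {f g : ι → ℂ} {x : ℂ} (h : HasSum f x) (e : ∀ n, g n = f n) :
    HasSum g x := by
  rwa [funext e]

/-- The monomial `t^(δ+n)` at `t = exp z`. -/
noncomputable def latticeMonomial (δ : Fin M → ℂ) (n : Fin M → ℤ) (z : Fin M → ℂ) : ℂ :=
  Complex.exp (∑ i, (δ i + n i) * z i)

lemma exp_mul_add_intCast (τ x : ℂ) (n : ℤ) :
    Complex.exp (τ * (x + n)) = Complex.exp (τ * x) * Complex.exp τ ^ n := by
  rw [← Complex.exp_int_mul, ← Complex.exp_add]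
  ring_nf

lemma latticeMonomial_shiftPt (τ : ℂ) (δ : Fin M → ℂ) (n : Fin M → ℤ) (s : Fin M) (z : Fin M → ℂ) :
    latticeMonomial δ n (shiftPt τ s z) =
      Complex.exp (τ * δ s) * Complex.exp τ ^ n s * latticeMonomial δ n z := by
  unfold latticeMonomial
  rw [← exp_mul_add_intCast, ← Complex.exp_add]
  congr 1
  have h : ∀ i, (δ i + n i) * shiftPt τ s z i =
      (if i = s then τ * (δ i + n i) else 0) + (δ i + n i) * z i := by
    intro i
    by_cases h : i = s
    · subst h; simp [shiftPt]; ring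
    · simp [shiftPt, h]
  rw [sum_congr rfl fun i _ => h i, sum_add_distrib]
  simp

lemma latticeMonomial_shiftAllPt (τ : ℂ) (δ : Fin M → ℂ) (n : Fin M → ℤ) (k : ℕ) (z : Fin M → ℂ) :
    latticeMonomial δ n ((shiftAllPt τ)^[k] z) =
      (Complex.exp (τ * ∑ i, δ i) * Complex.exp τ ^ (∑ i, n i)) ^ k * latticeMonomial δ n z := by
  unfold latticeMonomial
  rw [← exp_mul_add_intCast, ← Complex.exp_nat_mul, ← Complex.exp_add, shiftAllPt_iterate]
  congr 1
  push_cast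
  rw [← sum_add_distrib, mul_sum, mul_sum, ← sum_add_distrib]
  exact sum_congr rfl fun i _ => by ring

lemma latticeMonomial_add_single (δ : Fin M → ℂ) (n : Fin M → ℤ) (s : Fin M) (z : Fin M → ℂ) :
    latticeMonomial δ (n + Pi.single s 1) z = Complex.exp (z s) * latticeMonomial δ n z := by
  unfold latticeMonomial
  rw [← Complex.exp_add]
  congr 1
  have h : ∀ i, (δ i + ((n + Pi.single s 1 : Fin M → ℤ) i : ℤ)) * z i =
      (if i = s then z i else 0) + (δ i + n i) * z i := by
    intro i
    by_cases h : i = s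
    · subst h; simp; ring
    · simp [h]
  rw [sum_congr rfl fun i _ => h i, sum_add_distrib]
  simp

lemma sum_add_single (n : Fin M → ℤ) (s : Fin M) :
    ∑ i, (n + Pi.single s 1 : Fin M → ℤ) i = ∑ i, n i + 1 := by
  simp [sum_add_distrib]

/-- A convergent series `∑ Φ(|n|) ∏ φ_i(n_i) t^(δ+n)` over `n ∈ ℤ^M` whose factors satisfy the
first order recurrences is a solution. -/
theorem isSolutionOn_of_recurrence (τ : ℂ) (a : Fin N → ℂ) (b : Fin M → ℂ) (c : Fin N → ℂ)
    (D : Set (Fin M → ℂ)) (f : (Fin M → ℂ) → ℂ) (δ : Fin M → ℂ) (Φ : ℤ → ℂ) (φ : Fin M → ℤ → ℂ)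
    (hΦ : ∀ n : ℤ, Φ (n + 1) * ∏ j, (1 - c j * (Complex.exp (τ * ∑ i, δ i) * Complex.exp τ ^ n)) =
      Φ n * ∏ j, (1 - a j * (Complex.exp (τ * ∑ i, δ i) * Complex.exp τ ^ n)))
    (hφ : ∀ i (n : ℤ), φ i (n + 1) * (1 - Complex.exp (τ * δ i) * Complex.exp τ ^ (n + 1)) =
      φ i n * (1 - b i * (Complex.exp (τ * δ i) * Complex.exp τ ^ n)))
    (hf : ∀ z ∈ D, HasSum (fun n : Fin M → ℤ =>
      Φ (∑ i, n i) * (∏ i, φ i (n i)) * latticeMonomial δ n z) (f z)) :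
    IsSolutionOn τ a b c D f := by
  set q := Complex.exp τ with hq
  have hq0 : q ≠ 0 := Complex.exp_ne_zero τ
  set Q := Complex.exp (τ * ∑ i, δ i) with hQ
  set Qs : Fin M → ℂ := fun i => Complex.exp (τ * δ i) with hQs
  set G : (Fin M → ℤ) → ℂ := fun n => ∏ i, φ i (n i) with hG
  have key : ∀ (s : Fin M) (n : Fin M → ℤ), (1 - b s * (Qs s * q ^ n s)) * G n =
      (1 - Qs s * q ^ (n s + 1)) * G (n + Pi.single s 1) := by
    intro s n
    have e0 : ∀ m : Fin M → ℤ, G m = φ s (m s) * ∏ i ∈ univ.erase s, φ i (m i) :=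
      fun m => (mul_prod_erase univ (fun i => φ i (m i)) (mem_univ s)).symm
    have e1 : G (n + Pi.single s 1) = φ s (n s + 1) * ∏ i ∈ univ.erase s, φ i (n i) := by
      rw [e0]
      congr 1
      · simp
      · exact prod_congr rfl fun i hi => by simp [(mem_erase.mp hi).1]
    have e2 := hφ s (n s)
    rw [e1, e0 n]
    linear_combination (-∏ i ∈ univ.erase s, φ i (n i)) * e2
  rw [isSolutionOn_iff]
  constructor
  · intro s z hz
    have hs1 : ∀ k ≤ N, HasSum (fun n : Fin M → ℤ => (Q * q ^ ∑ i, n i) ^ k *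
        (Φ (∑ i, n i) * G n * latticeMonomial δ n z)) (f ((shiftAllPt τ)^[k] z)) := by
      intro k hk
      refine hasSum_of_eq (hf _ (hz k hk).1) fun n => ?_
      rw [latticeMonomial_shiftAllPt]
      ring
    have hs2 : ∀ k ≤ N, HasSum (fun n : Fin M → ℤ => (Q * q ^ ∑ i, n i) ^ k * (Qs s * q ^ n s) *
        (Φ (∑ i, n i) * G n * latticeMonomial δ n z))
        (f ((shiftAllPt τ)^[k] (shiftPt τ s z))) := by
      intro k hk
      refine hasSum_of_eq (hf _ (hz k hk).2) fun n => ?_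
      rw [latticeMonomial_shiftAllPt, latticeMonomial_shiftPt]
      ring
    have hs3 : ∀ (x : Fin N → ℂ) (y : ℂ), HasSum (fun n : Fin M → ℤ =>
        (∏ j, (1 - x j * (Q * q ^ ∑ i, n i))) * (1 - y * (Qs s * q ^ n s)) *
          (Φ (∑ i, n i) * G n * latticeMonomial δ n z))
        (∑ k ∈ range (N + 1), (oneSubPoly x).coeff k * (f ((shiftAllPt τ)^[k] z) -
          y * f ((shiftAllPt τ)^[k] (shiftPt τ s z)))) := by
      intro x y
      have := hasSum_sum (s := range (N + 1)) fun k hk =>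
        ((hs1 k (Nat.lt_succ_iff.mp (mem_range.mp hk))).sub
          ((hs2 k (Nat.lt_succ_iff.mp (mem_range.mp hk))).mul_left y)).mul_left
          ((oneSubPoly x).coeff k)
      refine hasSum_of_eq this fun n => ?_
      rw [← eval_oneSubPoly,
        Polynomial.eval_eq_sum_range' (Nat.lt_succ_of_le (natDegree_oneSubPoly_le x)), sum_mul,
        sum_mul]
      exact sum_congr rfl fun k _ => by ring
    -- Multiplication by t_s moves the exponent n to n + e_s; the other series is reindexed by this
    -- shift, so that the two sides can be compared term by term.
    have h1 := (hs3 a (b s)).mul_left (Complex.exp (z s))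
    have h2 := (Equiv.addRight (Pi.single s 1 : Fin M → ℤ)).hasSum_iff.mpr
      (hs3 (fun j => c j * q⁻¹) 1)
    simp only [one_mul] at h2
    refine h1.unique ?_
    refine hasSum_of_eq h2 fun n => ?_
    simp only [Function.comp, Equiv.coe_addRight, sum_add_single, latticeMonomial_add_single]
    simp only [Pi.add_apply, Pi.single_eq_same]
    have e1 := hΦ (∑ i, n i)
    have e2 := key s n
    -- The factor q⁻¹ that accompanies c_j in the system absorbs the increase of |n| by one.
    have e3 : ∏ j, (1 - c j * q⁻¹ * (Q * q ^ (∑ i, n i + 1))) =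
        ∏ j, (1 - c j * (Q * q ^ (∑ i, n i))) := by
      refine prod_congr rfl fun j _ => ?_
      rw [zpow_add_one₀ hq0]
      field_simp
    rw [e3]
    linear_combination (∏ j, (1 - a j * (Q * q ^ ∑ i, n i))) * Complex.exp (z s) *
      Φ (∑ i, n i) * latticeMonomial δ n z * e2 - Complex.exp (z s) * latticeMonomial δ n z *
      (1 - Qs s * q ^ (n s + 1)) * G (n + Pi.single s 1) * e1
  · have main : ∀ r s : Fin M, r ≠ s → ∀ z, z ∈ D → shiftPt τ r z ∈ D → shiftPt τ s z ∈ D →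
        shiftPt τ r (shiftPt τ s z) ∈ D → HasSum (fun n : Fin M → ℤ =>
          Φ (∑ i, n i - 1) * ((1 - Qs r * q ^ n r) * (1 - Qs s * q ^ n s)) * G n *
            latticeMonomial δ n z)
          (Complex.exp (z r) * (f z - f (shiftPt τ s z) -
            b r * (f (shiftPt τ r z) - f (shiftPt τ r (shiftPt τ s z))))) := by
      intro r s hrs z hz hr hs hrs'
      have h1 := (((hf z hz).sub (hf _ hs)).sub
        (((hf _ hr).sub (hf _ hrs')).mul_left (b r))).mul_left (Complex.exp (z r))
      rw [← (Equiv.addRight (Pi.single r 1 : Fin M → ℤ)).hasSum_iff]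
      refine hasSum_of_eq h1 fun n => ?_
      simp only [Function.comp, Equiv.coe_addRight, sum_add_single, latticeMonomial_add_single,
        latticeMonomial_shiftPt]
      simp only [Pi.add_apply, Pi.single_eq_same, Pi.single_eq_of_ne hrs.symm, add_zero,
        add_sub_cancel_right]
      have e2 := key r n
      linear_combination (-Complex.exp (z r) * Φ (∑ i, n i) * latticeMonomial δ n z *
        (1 - Qs s * q ^ n s)) * e2
    intro r s hrs z hz hr hs hrs'
    have h1 := main r s hrs z hz hr hs hrs'
    have h2 := main s r hrs.symm z hz hs hr (shiftPt_comm τ s r z ▸ hrs')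
    rw [shiftPt_comm τ s r] at h2
    refine h1.unique ?_
    refine hasSum_of_eq h2 fun n => ?_
    ring

end Formal

/-! ### First order recurrences -/

section Recurrence

variable {q : ℂ}

lemma qPoch_div_add_one {x y : ℂ} (n : ℤ) (hx : n < 0 → x * q ^ n ≠ 1)
    (hy : y * q ^ n ≠ 1) :
    qPoch q x (n + 1) / qPoch q y (n + 1) * (1 - y * q ^ n) =
      qPoch q x n / qPoch q y n * (1 - x * q ^ n) := by
  rw [qPoch_add_one x n hx, qPoch_add_one y n fun _ => hy, mul_div_mul_comm, mul_assoc,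
    div_mul_cancel₀ _ (sub_ne_zero.mpr (Ne.symm hy))]

lemma one_sub_inv_mul_one_sub {x r : ℂ} (hx : x ≠ 0) (hr : r ≠ 0) :
    (1 - x⁻¹) * (1 - r * x) = r * (1 - x) * (1 - r⁻¹ * x⁻¹) := by
  field_simp
  ring

/-- The factor of `b_i` in the exponents `n ≥ 0`. -/
noncomputable def plusFactor (q b : ℂ) (n : ℤ) : ℂ :=
  if 0 ≤ n then qPoch q b n / qPoch q q n else 0

/-- Cutting off the negative exponents is compatible with the recurrence because 1 - q^(n+1)
vanishes at n = -1. -/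
lemma plusFactor_recurrence (hq : ∀ n : ℕ, q * q ^ n ≠ 1) (hq0 : q ≠ 0) (b : ℂ) (n : ℤ) :
    plusFactor q b (n + 1) * (1 - q ^ (n + 1)) = plusFactor q b n * (1 - b * q ^ n) := by
  unfold plusFactor
  rcases lt_or_ge n 0 with h | h
  · rw [if_neg (not_le.mpr h), zero_mul]
    split_ifs with h1
    · have : n + 1 = 0 := by omega
      simp [this]
    · simp
  · rw [if_pos h, if_pos (by omega)]
    have h1 : q ^ (n + 1) = q * q ^ n := by rw [zpow_add_one₀ hq0, mul_comm]
    rw [h1]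
    refine qPoch_div_add_one n (fun h2 => absurd h (not_le.mpr h2)) ?_
    lift n to ℕ using h
    exact_mod_cast hq n

/-- A two-sided factor, in the exponents `-n`. -/
noncomputable def twoSidedFactor (q A b : ℂ) (n : ℤ) : ℂ :=
  (q / b) ^ (-n) * (qPoch q A (-n) / qPoch q (q * A / b) (-n))

/-- This is the recurrence of the quotient of q-shifted factorials at the reflected index -(n+1),
for an exponent δ with q^δ = A⁻¹. The prefactor (q/b)^(-n) compensates the constant q/b that appears
when 1 - x is rewritten through 1 - x⁻¹. -/
lemma twoSidedFactor_recurrence {A b : ℂ} (hq0 : q ≠ 0) (hA : A ≠ 0) (hb : b ≠ 0) (n : ℤ)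
    (h1 : -(n + 1) < 0 → A * q ^ (-(n + 1)) ≠ 1) (h2 : q * A / b * q ^ (-(n + 1)) ≠ 1) :
    twoSidedFactor q A b (n + 1) * (1 - A⁻¹ * q ^ (n + 1)) =
      twoSidedFactor q A b n * (1 - b * (A⁻¹ * q ^ n)) := by
  obtain ⟨m, rfl⟩ : ∃ m, n = -(m + 1) := ⟨-n - 1, by ring⟩
  unfold twoSidedFactor
  have e : -(-(m + 1) + 1) = m := by ring
  rw [e] at h1 h2
  rw [e, neg_neg, show -(m + 1) + 1 = -m by ring]
  have e1 := qPoch_div_add_one m h1 h2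
  have h2' : 1 - q * A / b * q ^ m ≠ 0 := sub_ne_zero.mpr (Ne.symm h2)
  have hx : A * q ^ m ≠ 0 := mul_ne_zero hA (zpow_ne_zero _ hq0)
  have e2 := one_sub_inv_mul_one_sub hx (div_ne_zero hq0 hb)
  have e3 : A⁻¹ * q ^ (-m) = (A * q ^ m)⁻¹ := by rw [zpow_neg, mul_inv]
  have e4 : b * (A⁻¹ * q ^ (-(m + 1))) = (q / b)⁻¹ * (A * q ^ m)⁻¹ := by
    rw [zpow_neg, zpow_add_one₀ hq0]
    field_simp
  have e5 : q * A / b * q ^ m = q / b * (A * q ^ m) := by ring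
  rw [e3, e4, zpow_add_one₀ (div_ne_zero hq0 hb)]
  rw [e5] at e1 h2'
  refine mul_right_cancel₀ h2' ?_
  set P := qPoch q A m / qPoch q (q * A / b) m
  set P' := qPoch q A (m + 1) / qPoch q (q * A / b) (m + 1)
  set r := q / b
  set x := A * q ^ m
  linear_combination (r ^ m * P) * e2 - r ^ m * r * (1 - r⁻¹ * x⁻¹) * e1

/-- The factor of `b_i` in the exponents `-β_i + n`, `n ≤ 0`. -/
noncomputable def minusFactor (q b : ℂ) (n : ℤ) : ℂ :=
  if n ≤ 0 then twoSidedFactor q b b n else 0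

/-- With A = b the denominator is (q)_{-n}, and the positive exponents can be dropped because 1 - b
(b⁻¹ q^n) vanishes at n = 0. -/
lemma minusFactor_recurrence (hq : ∀ n : ℕ, q * q ^ n ≠ 1) (hq0 : q ≠ 0) {b : ℂ} (hb : b ≠ 0)
    (n : ℤ) :
    minusFactor q b (n + 1) * (1 - b⁻¹ * q ^ (n + 1)) =
      minusFactor q b n * (1 - b * (b⁻¹ * q ^ n)) := by
  unfold minusFactor
  rcases lt_or_ge n 0 with h | h
  · rw [if_pos h.le, if_pos (by omega)]
    refine twoSidedFactor_recurrence hq0 hb hb n (fun h1 => by omega) ?_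
    obtain ⟨m, hm⟩ : ∃ m : ℕ, -(n + 1) = m := ⟨(-(n + 1)).toNat, by omega⟩
    rw [mul_div_cancel_right₀ _ hb, hm]
    exact_mod_cast hq m
  · rw [if_neg (show ¬ n + 1 ≤ 0 by omega), zero_mul]
    split_ifs with h1
    · have : n = 0 := by omega
      simp [this, hb]
    · simp

lemma plusFactor_mul_zpow (b t : ℂ) (m : ℕ) :
    plusFactor q b m * t ^ (m : ℤ) = qPoch q b m / qPoch q q m * t ^ m := by
  rw [plusFactor, if_pos (by omega), zpow_natCast]

lemma minusFactor_mul_zpow {b : ℂ} (hb : b ≠ 0) (t : ℂ) (m : ℕ) :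
    minusFactor q b (-m) * t ^ (-m : ℤ) =
      qPoch q b m / qPoch q q m * (q / (b * t)) ^ m := by
  rw [minusFactor, if_pos (by omega), twoSidedFactor, neg_neg, mul_div_cancel_right₀ _ hb,
    zpow_neg, zpow_natCast, zpow_natCast, ← div_div, div_pow _ t]
  ring

lemma twoSidedFactor_mul_zpow (A b t : ℂ) (s : ℤ) :
    twoSidedFactor q A b (-s) * t ^ (-s) =
      (q / (b * t)) ^ s * (qPoch q A s / qPoch q (q * A / b) s) := by
  rw [twoSidedFactor, neg_neg, zpow_neg, ← div_div, div_zpow _ t]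
  ring

end Recurrence

/-! ### The components as series over the lattice of exponents -/

noncomputable section Lattice

variable {N M : ℕ}

lemma sum_lt_add_sum_gt_add {R : Type*} [AddCommMonoid R] (l : Fin M) (f : Fin M → R) :
    (∑ i with i < l, f i) + (∑ i with l < i, f i) + f l = ∑ i, f i := by
  rw [← sum_erase_add univ f (mem_univ l),
    ← sum_filter_add_sum_filter_not (univ.erase l) fun i => i < l]
  congr 2
  · refine sum_congr ?_ fun _ _ => rfl
    ext i
    simp only [mem_filter, mem_erase, mem_univ, true_and, and_true]
    exact ⟨fun h => ⟨h.ne, h⟩, fun h => h.2⟩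
  · refine sum_congr ?_ fun _ _ => rfl
    ext i
    simp only [mem_filter, mem_erase, mem_univ, true_and, and_true, not_lt]
    exact ⟨fun h => ⟨h.ne', h.le⟩, fun h => lt_of_le_of_ne h.2 (Ne.symm h.1)⟩

/-- The exponent `δ` of the monomial prefactor of the component `i`. -/
def compExp (α : Fin N → ℂ) (β : Fin M → ℂ) (γ : Fin N → ℂ) (L : ℕ) :
    Option (Fin N × Fin M) → Fin M → ℂ
  | none => fun i => if (i : ℕ) < L then 0 else -β i
  | some (k, l) => fun i =>
      if i < l then 0 else if l < i then -β i
      else if (l : ℕ) < L then 1 + (∑ i with l < i, β i) - γ k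
      else -α k + ∑ i with l < i, β i

variable (α : Fin N → ℂ) (β : Fin M → ℂ) (γ : Fin N → ℂ) (L : ℕ)

variable {L} in
lemma compExp_of_lt (k : Fin N) {i l : Fin M} (h : i < l) :
    compExp α β γ L (some (k, l)) i = 0 := by
  simp only [compExp]; rw [if_pos h]

variable {L} in
lemma compExp_of_gt (k : Fin N) {i l : Fin M} (h : l < i) :
    compExp α β γ L (some (k, l)) i = -β i := by
  simp only [compExp]; rw [if_neg (not_lt.mpr h.le), if_pos h]

lemma compExp_self (k : Fin N) (l : Fin M) :
    compExp α β γ L (some (k, l)) l = if (l : ℕ) < L then 1 + (∑ i with l < i, β i) - γ k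
      else -α k + ∑ i with l < i, β i := by
  simp only [compExp, lt_irrefl, if_false]

lemma uMonomial_eq (z : Fin M → ℂ) (i : Option (Fin N × Fin M)) :
    uMonomial α β γ L z i = latticeMonomial (compExp α β γ L i) 0 z := by
  rcases i with _ | ⟨k, l⟩
  · simp only [uMonomial, latticeMonomial, Complex.exp_sum, compExp, prod_filter]
    refine prod_congr rfl fun i _ => ?_
    by_cases h : (i : ℕ) < L
    · simp [h]
    · simp [h, not_lt.mp h]
  · simp only [uMonomial, latticeMonomial, Complex.exp_sum]
    rw [← prod_lt_mul_prod_gt_mul l, mul_comm]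
    have e1 : ∏ i with i < l, Complex.exp ((compExp α β γ L (some (k, l)) i +
        ((0 : Fin M → ℤ) i : ℤ)) * z i) = 1 :=
      prod_eq_one fun i hi => by rw [compExp_of_lt α β γ k (by simpa using hi)]; simp
    have e2 : ∏ i with l < i, Complex.exp ((compExp α β γ L (some (k, l)) i +
        ((0 : Fin M → ℤ) i : ℤ)) * z i) = ∏ i with l < i, Complex.exp (-β i * z i) :=
      prod_congr rfl fun i hi => by rw [compExp_of_gt α β γ k (by simpa using hi)]; simp
    rw [e1, e2, one_mul, compExp_self]
    congr 1
    split_ifs <;> simp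

/-- The lattice point of the exponent of the term of index `μ` in the component `i`. -/
def compLattice (μ : Fin M → ℕ) : Option (Fin N × Fin M) → Fin M → ℤ
  | none => fun i => if (i : ℕ) < L then (μ i : ℤ) else -(μ i : ℤ)
  | some (k, l) => fun i =>
      if i < l then (μ i : ℤ) else if l < i then -(μ i : ℤ)
      else -signedSum μ (compCut L (some (k, l)))

variable {L} in
lemma compLattice_of_lt (μ : Fin M → ℕ) (k : Fin N) {i l : Fin M} (h : i < l) :
    compLattice L μ (some (k, l)) i = μ i := by
  simp only [compLattice]; rw [if_pos h]

variable {L} in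
lemma compLattice_of_gt (μ : Fin M → ℕ) (k : Fin N) {i l : Fin M} (h : l < i) :
    compLattice L μ (some (k, l)) i = -μ i := by
  simp only [compLattice]; rw [if_neg (not_lt.mpr h.le), if_pos h]

lemma compLattice_self (μ : Fin M → ℕ) (k : Fin N) (l : Fin M) :
    compLattice L μ (some (k, l)) l = -signedSum μ (compCut L (some (k, l))) := by
  simp only [compLattice, lt_irrefl, if_false]

/-- The pivot coordinate of the lattice point is minus the signed sum, so all other indices cancel
in the total and only ± the pivot index survives. This is why the one-sided pivot factor becomes the
factor Φ of the total degree. -/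
lemma sum_compLattice (μ : Fin M → ℕ) (k : Fin N) (l : Fin M) :
    ∑ i, compLattice L μ (some (k, l)) i = if (l : ℕ) < L then (μ l : ℤ) else -(μ l : ℤ) := by
  have h : signedSum μ (compCut L (some (k, l))) = (∑ i with i < l, (μ i : ℤ)) +
      (∑ i with l < i, -(μ i : ℤ)) + if (l : ℕ) < L then -(μ l : ℤ) else (μ l : ℤ) := by
    rw [signedSum, ← sum_lt_add_sum_gt_add l]
    congr 1
    · congr 1
      · refine sum_congr rfl fun i hi => if_pos ?_
        have : i < l := by simpa using hi
        simp only [compCut]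
        split_ifs <;> omega
      · refine sum_congr rfl fun i hi => if_neg ?_
        have : l < i := by simpa using hi
        simp only [compCut]
        split_ifs <;> omega
    · simp only [compCut]
      split_ifs <;> first | rfl | omega
  rw [← sum_lt_add_sum_gt_add l, compLattice_self, h,
    sum_congr rfl fun i hi => compLattice_of_lt μ k (show i < l by simpa using hi),
    sum_congr rfl fun i hi => compLattice_of_gt μ k (show l < i by simpa using hi)]
  split_ifs <;> ring

lemma compLattice_injective (i : Option (Fin N × Fin M)) :
    Function.Injective fun μ => compLattice L μ i := by
  intro μ ν h
  dsimp only at h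
  ext j
  rcases i with _ | ⟨k, l⟩
  · have := congrFun h j
    simp only [compLattice] at this
    split_ifs at this <;> omega
  · rcases lt_trichotomy j l with hj | rfl | hj
    · have := congrFun h j
      rw [compLattice_of_lt μ k hj, compLattice_of_lt ν k hj] at this
      omega
    · have h1 := sum_compLattice L μ k j
      rw [h, sum_compLattice] at h1
      split_ifs at h1 <;> omega
    · have := congrFun h j
      rw [compLattice_of_gt μ k hj, compLattice_of_gt ν k hj] at this
      omega

variable (q : ℂ) (a : Fin N → ℂ) (b : Fin M → ℂ) (c : Fin N → ℂ)

/-- The factor of the coefficient of `t^(δ+n)` that depends on `∑ n_i`. -/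
def compTotalFactor : Option (Fin N × Fin M) → ℤ → ℂ
  | none => compTwoSided q a b c L none
  | some (k, l) => fun n =>
      if (l : ℕ) < L then (if 0 ≤ n then pivotFactor q a c L k l n.toNat else 0)
      else (if n ≤ 0 then (∏ j, c j / a j) ^ (-n).toNat * pivotFactor q a c L k l (-n).toNat else 0)

/-- The factors of the coefficient of `t^(δ+n)` that depend on a single `n_i`. -/
def compLocalFactor : Option (Fin N × Fin M) → Fin M → ℤ → ℂ
  | none => fun i => if (i : ℕ) < L then plusFactor q (b i) else minusFactor q (b i)
  | some (k, l) => fun i =>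
      if i < l then plusFactor q (b i) else if l < i then minusFactor q (b i)
      else twoSidedFactor q (twoSidedBase q a b c L k l) (b l)

variable {L} in
lemma compLocalFactor_of_lt (k : Fin N) {i l : Fin M} (h : i < l) :
    compLocalFactor L q a b c (some (k, l)) i = plusFactor q (b i) := by
  simp only [compLocalFactor]; rw [if_pos h]

variable {L} in
lemma compLocalFactor_of_gt (k : Fin N) {i l : Fin M} (h : l < i) :
    compLocalFactor L q a b c (some (k, l)) i = minusFactor q (b i) := by
  simp only [compLocalFactor]; rw [if_neg (not_lt.mpr h.le), if_pos h]

lemma compLocalFactor_self (k : Fin N) (l : Fin M) :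
    compLocalFactor L q a b c (some (k, l)) l =
      twoSidedFactor q (twoSidedBase q a b c L k l) (b l) := by
  simp only [compLocalFactor, lt_irrefl, if_false]

/-- The cut-offs in the one-sided factors prescribe the sign of every non-pivot exponent and of the
total degree, or of every exponent for u_0. These sign conditions describe exactly the exponents
that occur. -/
lemma coeff_eq_zero_of_notMem_range (i : Option (Fin N × Fin M)) (n : Fin M → ℤ)
    (hn : n ∉ Set.range fun μ => compLattice L μ i) :
    compTotalFactor L q a b c i (∑ j, n j) * ∏ j, compLocalFactor L q a b c i j (n j) = 0 := by
  by_contra hne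
  obtain ⟨h1, h2⟩ := ne_zero_and_ne_zero_of_mul hne
  rw [prod_ne_zero_iff] at h2
  have hplus : ∀ {x : ℂ} {y : ℤ}, plusFactor q x y ≠ 0 → 0 ≤ y := fun {x y} h => by
    by_contra h'; exact h (by rw [plusFactor, if_neg h'])
  have hminus : ∀ {x : ℂ} {y : ℤ}, minusFactor q x y ≠ 0 → y ≤ 0 := fun {x y} h => by
    by_contra h'; exact h (by rw [minusFactor, if_neg h'])
  refine hn ?_
  rcases i with _ | ⟨k, l⟩
  · refine ⟨fun j => (n j).natAbs, funext fun j => ?_⟩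
    have h3 := h2 j (mem_univ j)
    simp only [compLattice]
    simp only [compLocalFactor] at h3
    split_ifs at h3 ⊢
    · have := hplus h3; omega
    · have := hminus h3; omega
  -- The pivot index is recovered from the total degree, the others from their own exponents.
  · set μ : Fin M → ℕ := fun j => if j = l then (∑ i, n i).natAbs else (n j).natAbs with hμ
    have hlt : ∀ j, j < l → compLattice L μ (some (k, l)) j = n j := fun j hj => by
      have h3 := h2 j (mem_univ j)
      rw [compLocalFactor_of_lt q a b c k hj] at h3
      have := hplus h3
      rw [compLattice_of_lt μ k hj, hμ]
      simp only [hj.ne, if_false]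
      omega
    have hgt : ∀ j, l < j → compLattice L μ (some (k, l)) j = n j := fun j hj => by
      have h3 := h2 j (mem_univ j)
      rw [compLocalFactor_of_gt q a b c k hj] at h3
      have := hminus h3
      rw [compLattice_of_gt μ k hj, hμ]
      simp only [hj.ne', if_false]
      omega
    have hsum : ∑ j, compLattice L μ (some (k, l)) j = ∑ j, n j := by
      rw [sum_compLattice, hμ]
      simp only [if_true]
      simp only [compTotalFactor] at h1
      split_ifs at h1 ⊢ with h3 h4 h4
      · omega
      · exact absurd rfl h1
      · omega
      · exact absurd rfl h1
    refine ⟨μ, funext fun j => ?_⟩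
    rcases lt_trichotomy j l with hj | rfl | hj
    · exact hlt j hj
    · rw [← sum_lt_add_sum_gt_add j, ← sum_lt_add_sum_gt_add j n,
        sum_congr rfl fun i hi => hlt i (by simpa using hi),
        sum_congr rfl fun i hi => hgt i (by simpa using hi)] at hsum
      exact add_left_cancel hsum
    · exact hgt j hj

lemma latticeMonomial_eq_mul (δ : Fin M → ℂ) (n : Fin M → ℤ) (z : Fin M → ℂ) :
    latticeMonomial δ n z = latticeMonomial δ 0 z * ∏ i, Complex.exp (z i) ^ n i := by
  simp only [latticeMonomial, ← Complex.exp_int_mul]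
  rw [← Complex.exp_sum, ← Complex.exp_add, ← sum_add_distrib]
  congr 1
  refine sum_congr rfl fun i _ => ?_
  simp; ring

variable {q b} in
lemma coeff_mul_prod_zpow (hq : q ≠ 0) (hb : ∀ i, b i ≠ 0) {t : Fin M → ℂ} (ht : ∀ i, t i ≠ 0)
    (i : Option (Fin N × Fin M)) (μ : Fin M → ℕ) :
    compTotalFactor L q a b c i (∑ j, compLattice L μ i j) *
      (∏ j, compLocalFactor L q a b c i j (compLattice L μ i j)) *
      ∏ j, t j ^ compLattice L μ i j =
    genTerm (compCut L i) (compTwoSided q a b c L i) (compOneSided q a b c L i)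
      (compVar q a b c L t i) μ := by
  rw [genTerm, mul_assoc, mul_assoc, ← prod_mul_distrib, ← prod_mul_distrib]
  rcases i with _ | ⟨k, l⟩
  · congr 1
    refine prod_congr rfl fun j _ => ?_
    simp only [compLocalFactor, compLattice, compOneSided, compVar]
    split_ifs
    · exact plusFactor_mul_zpow _ _ _
    · exact minusFactor_mul_zpow (hb j) _ _
  · set s := signedSum μ (compCut L (some (k, l))) with hs
    -- The power y^s that goes with the two-sided factor is distributed over all indices: y turns
    -- t_i into q t_i/(b_l t_l), and y⁻¹ turns q/(b_i t_i) into b_l t_l/(b_i t_i).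
    set y := q / (b l * t l) with hy
    have hy0 : y ≠ 0 := div_ne_zero hq (mul_ne_zero (hb l) (ht l))
    have hys : y ^ s = ∏ j : Fin M,
        if (j : ℕ) < compCut L (some (k, l)) then y ^ (μ j) else (y⁻¹) ^ (μ j) := by
      have : ∀ (S : Finset (Fin M)) (g : Fin M → ℤ), y ^ (∑ j ∈ S, g j) = ∏ j ∈ S, y ^ g j := by
        intro S g
        induction S using Finset.cons_induction with
        | empty => simp
        | cons j S hj ih => rw [sum_cons, prod_cons, zpow_add₀ hy0, ih]
      rw [hs, signedSum, this]
      refine prod_congr rfl fun j _ => ?_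
      split_ifs <;> simp
    have hr : compTwoSided q a b c L (some (k, l)) s * y ^ s =
        compLocalFactor L q a b c (some (k, l)) l (compLattice L μ (some (k, l)) l) *
          t l ^ compLattice L μ (some (k, l)) l := by
      rw [compLocalFactor_self, compLattice_self, ← hs, twoSidedFactor_mul_zpow, mul_comm]
      rfl
    have hbl := hb l
    have htl := ht l
    rw [← mul_prod_erase univ (fun j => compLocalFactor L q a b c (some (k, l)) j
        (compLattice L μ (some (k, l)) j) * t j ^ compLattice L μ (some (k, l)) j) (mem_univ l),
      ← hr, hys, sum_compLattice, ← mul_prod_erase univ _ (mem_univ l),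
      ← mul_prod_erase univ (fun j => compOneSided q a b c L (some (k, l)) j (μ j) *
        compVar q a b c L t (some (k, l)) j ^ μ j) (mem_univ l)]
    have e1 : (∏ j ∈ univ.erase l,
        (if (j : ℕ) < compCut L (some (k, l)) then y ^ (μ j) else (y⁻¹) ^ (μ j))) *
        ∏ j ∈ univ.erase l, compLocalFactor L q a b c (some (k, l)) j
          (compLattice L μ (some (k, l)) j) * t j ^ compLattice L μ (some (k, l)) j =
        ∏ j ∈ univ.erase l, compOneSided q a b c L (some (k, l)) j (μ j) *
          compVar q a b c L t (some (k, l)) j ^ μ j := by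
      rw [← prod_mul_distrib]
      refine prod_congr rfl fun j hj => ?_
      have hjl := (mem_erase.mp hj).1
      have e0 : compOneSided q a b c L (some (k, l)) j (μ j) =
          qPoch q (b j) (μ j) / qPoch q q (μ j) := by simp only [compOneSided, if_neg hjl]
      rw [e0]
      rcases lt_or_gt_of_ne hjl with h | h
      · have hc : (j : ℕ) < compCut L (some (k, l)) := by
          simp only [compCut]; split_ifs <;> omega
        rw [if_pos hc, compLocalFactor_of_lt q a b c k h, compLattice_of_lt μ k h,
          compVar_of_lt q a b c t k h, plusFactor_mul_zpow, mul_div_right_comm, mul_pow]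
        ring
      · have hc : ¬ (j : ℕ) < compCut L (some (k, l)) := by
          simp only [compCut]; split_ifs <;> omega
        have e5 : b l * t l / (b j * t j) = y⁻¹ * (q / (b j * t j)) := by
          rw [hy]; field_simp
        rw [if_neg hc, compLocalFactor_of_gt q a b c k h, compLattice_of_gt μ k h,
          compVar_of_gt q a b c t k h, minusFactor_mul_zpow (hb j), e5, mul_pow]
        ring
    have e2 : compTotalFactor L q a b c (some (k, l))
        (if (l : ℕ) < L then (μ l : ℤ) else -(μ l : ℤ)) *
        (if (l : ℕ) < compCut L (some (k, l)) then y ^ (μ l) else (y⁻¹) ^ (μ l)) =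
        compOneSided q a b c L (some (k, l)) l (μ l) *
          compVar q a b c L t (some (k, l)) l ^ μ l := by
      have e0 : compOneSided q a b c L (some (k, l)) l (μ l) = pivotFactor q a c L k l (μ l) := by
        simp only [compOneSided, if_true]
      rw [e0, compVar_self]
      by_cases hl : (l : ℕ) < L
      · simp [compTotalFactor, compCut, hl, hy]
      · simp only [compTotalFactor, compCut, hl, if_false, if_pos (Nat.lt_succ_self (l : ℕ))]
        rw [if_pos (by omega), neg_neg, Int.toNat_natCast, mul_pow]
        ring
    rw [← e1, ← e2]
    ring

end Lattice

/-! ### The components are solutions -/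

section ComponentSolution

variable {N M : ℕ} {τ : ℂ} {α : Fin N → ℂ} {β : Fin M → ℂ} {γ : Fin N → ℂ} {L : ℕ}

lemma qPow_ne_zero {ι : Type*} (τ : ℂ) (x : ι → ℂ) (i : ι) : qPow τ x i ≠ 0 :=
  Complex.exp_ne_zero _

lemma tailProd_qPow (τ : ℂ) (β : Fin M → ℂ) (l : ℕ) :
    tailProd (qPow τ β) l = Complex.exp (τ * ∑ i : Fin M with l ≤ i.val, β i) := by
  rw [mul_sum, Complex.exp_sum]; rfl

lemma tailProd_qPow_succ (τ : ℂ) (β : Fin M → ℂ) (l : Fin M) :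
    tailProd (qPow τ β) (l + 1) = Complex.exp (τ * ∑ i with l < i, β i) := by
  rw [tailProd_qPow]
  rfl

lemma exp_compExp_self (k : Fin N) (l : Fin M) :
    Complex.exp (τ * compExp α β γ L (some (k, l)) l) =
      (twoSidedBase (Complex.exp τ) (qPow τ α) (qPow τ β) (qPow τ γ) L k l)⁻¹ := by
  rw [compExp_self, twoSidedBase, tailProd_qPow_succ]
  simp only [qPow]
  split_ifs
  · rw [← Complex.exp_add, ← Complex.exp_sub, ← Complex.exp_neg]
    congr 1; ring
  · rw [← Complex.exp_sub, ← Complex.exp_neg]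
    congr 1; ring

lemma exp_neg_eq_inv_qPow (i : Fin M) : Complex.exp (τ * -β i) = (qPow τ β i)⁻¹ := by
  rw [qPow, ← Complex.exp_neg, mul_neg]

lemma compLocalFactor_recurrence (h : Admissible (Complex.exp τ) (qPow τ α) (qPow τ β) (qPow τ γ))
    (i : Option (Fin N × Fin M)) (j : Fin M) (n : ℤ) :
    compLocalFactor L (Complex.exp τ) (qPow τ α) (qPow τ β) (qPow τ γ) i j (n + 1) *
        (1 - Complex.exp (τ * compExp α β γ L i j) * Complex.exp τ ^ (n + 1)) =
      compLocalFactor L (Complex.exp τ) (qPow τ α) (qPow τ β) (qPow τ γ) i j n *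
        (1 - qPow τ β j * (Complex.exp (τ * compExp α β γ L i j) * Complex.exp τ ^ n)) := by
  have hp := plusFactor_recurrence h.pow_ne_one h.q_ne (qPow τ β j) n
  have hm := minusFactor_recurrence h.pow_ne_one h.q_ne (h.b_ne j) n
  rcases i with _ | ⟨k, l⟩
  · simp only [compLocalFactor, compExp]
    split_ifs
    · simpa using hp
    · rw [exp_neg_eq_inv_qPow]; exact hm
  · rcases lt_trichotomy j l with hj | rfl | hj
    · rw [compLocalFactor_of_lt _ _ _ _ k hj, compExp_of_lt _ _ _ k hj]
      simpa using hp
    · rw [compLocalFactor_self, exp_compExp_self]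
      exact twoSidedFactor_recurrence h.q_ne (h.twoSidedBase_ne k j) (h.b_ne j) n
        (fun _ => h.twoSidedBase_mul k j _) (h.twoSidedBase_div_mul k j _)
    · rw [compLocalFactor_of_gt _ _ _ _ k hj, compExp_of_gt _ _ _ k hj, exp_neg_eq_inv_qPow]
      exact hm

lemma exp_sum_compExp_none :
    Complex.exp (τ * ∑ i, compExp α β γ L none i) = (tailProd (qPow τ β) L)⁻¹ := by
  rw [tailProd_qPow, ← Complex.exp_neg, ← mul_neg, ← sum_neg_distrib, sum_filter]
  congr 2
  refine sum_congr rfl fun i _ => ?_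
  by_cases h : (i : ℕ) < L
  · simp [compExp, h]
  · simp [compExp, h, not_lt.mp h]

lemma exp_sum_compExp_some (k : Fin N) (l : Fin M) :
    Complex.exp (τ * ∑ i, compExp α β γ L (some (k, l)) i) =
      if (l : ℕ) < L then Complex.exp τ / qPow τ γ k else (qPow τ α k)⁻¹ := by
  have h : ∑ i, compExp α β γ L (some (k, l)) i = if (l : ℕ) < L then 1 - γ k else -α k := by
    rw [← sum_lt_add_sum_gt_add l, compExp_self,
      sum_congr rfl fun i hi => compExp_of_lt α β γ k (show i < l by simpa using hi),
      sum_congr rfl fun i hi => compExp_of_gt α β γ k (show l < i by simpa using hi)]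
    split_ifs <;> simp
    ring
  rw [h]
  split_ifs
  · rw [qPow, ← Complex.exp_sub]; congr 1; ring
  · rw [qPow, ← Complex.exp_neg]; congr 1; ring

lemma Admissible.compTotalFactor_recurrence_none {q : ℂ} {a : Fin N → ℂ} {b : Fin M → ℂ}
    {c : Fin N → ℂ} (h : Admissible q a b c) (hL : L ≤ M) (n : ℤ) :
    compTotalFactor L q a b c none (n + 1) * ∏ j, (1 - c j * ((tailProd b L)⁻¹ * q ^ n)) =
      compTotalFactor L q a b c none n * ∏ j, (1 - a j * ((tailProd b L)⁻¹ * q ^ n)) := by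
  simp only [compTotalFactor, compTwoSided]
  rw [← prod_mul_distrib, ← prod_mul_distrib]
  refine prod_congr rfl fun j _ => ?_
  simpa only [div_eq_mul_inv, mul_assoc] using
    qPoch_div_add_one n (fun _ => h.a_div_tail j hL n) (h.c_div_tail j hL n)

lemma Admissible.pivotFactor_recurrence_of_lt {q : ℂ} {a : Fin N → ℂ} {b : Fin M → ℂ}
    {c : Fin N → ℂ} (h : Admissible q a b c) (k : Fin N) {l : Fin M} (hl : (l : ℕ) < L) (m : ℕ) :
    pivotFactor q a c L k l (m + 1) * ∏ j, (1 - c j * (q / c k * q ^ m)) =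
      pivotFactor q a c L k l m * ∏ j, (1 - a j * (q / c k * q ^ m)) := by
  simp only [pivotFactor, if_pos hl]
  rw [← prod_mul_distrib, ← prod_mul_distrib]
  refine prod_congr rfl fun j _ => ?_
  have := qPoch_div_add_one (q := q) (x := q * a j / c k) (y := q * c j / c k) (m : ℤ)
    (fun h => by omega) (by exact_mod_cast (h.pivot_denominator_ne j k m).1)
  rw [zpow_natCast] at this
  rw [show c j * (q / c k * q ^ m) = q * c j / c k * q ^ m by ring,
    show a j * (q / c k * q ^ m) = q * a j / c k * q ^ m by ring]
  exact_mod_cast this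

/-- The total degree is -m here, so the recurrence runs backwards. Replacing each factor 1 - x by 1
- x⁻¹ produces c_j/a_j, which explains the power of ∏ c_j/a_j in `compTotalFactor`. -/
lemma Admissible.pivotFactor_recurrence_of_ge {q : ℂ} {a : Fin N → ℂ} {b : Fin M → ℂ}
    {c : Fin N → ℂ} (h : Admissible q a b c) (k : Fin N) {l : Fin M} (hl : ¬ (l : ℕ) < L) (m : ℕ) :
    pivotFactor q a c L k l m * ∏ j, (1 - c j * ((a k)⁻¹ * q ^ (-(m + 1) : ℤ))) =
      (∏ j, c j / a j) * pivotFactor q a c L k l (m + 1) *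
        ∏ j, (1 - a j * ((a k)⁻¹ * q ^ (-(m + 1) : ℤ))) := by
  simp only [pivotFactor, if_neg hl]
  rw [← prod_mul_distrib, ← prod_mul_distrib, ← prod_mul_distrib]
  refine prod_congr rfl fun j _ => ?_
  have hd := (h.pivot_denominator_ne j k m).2
  have hq := h.q_ne
  have ha := h.a_ne
  have hc := h.c_ne j
  have e := qPoch_div_add_one (q := q) (x := q * a k / c j) (y := q * a k / a j) (m : ℤ)
    (fun h => by omega) (by exact_mod_cast hd)
  rw [zpow_natCast] at e
  push_cast
  set P := qPoch q (q * a k / c j) m / qPoch q (q * a k / a j) m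
  set P' := qPoch q (q * a k / c j) (m + 1) / qPoch q (q * a k / a j) (m + 1)
  have hd' : 1 - q * a k / a j * q ^ m ≠ 0 := sub_ne_zero.mpr (Ne.symm hd)
  have hak := ha k
  have haj := ha j
  refine mul_right_cancel₀ hd' ?_
  have e1 : c j * ((a k)⁻¹ * q ^ (-(m + 1) : ℤ)) = (q * a k / c j * q ^ m)⁻¹ := by
    rw [zpow_neg, zpow_add_one₀ hq, zpow_natCast]; field_simp
  have e2 : a j * ((a k)⁻¹ * q ^ (-(m + 1) : ℤ)) = (q * a k / a j * q ^ m)⁻¹ := by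
    rw [zpow_neg, zpow_add_one₀ hq, zpow_natCast]; field_simp
  have e3 : (1 - (q * a k / c j * q ^ m)⁻¹) * (1 - q * a k / a j * q ^ m) =
      c j / a j * (1 - q * a k / c j * q ^ m) * (1 - (q * a k / a j * q ^ m)⁻¹) := by
    have hqm : q ^ m ≠ 0 := pow_ne_zero _ hq
    field_simp
    ring
  rw [e1, e2]
  linear_combination P * e3 - c j / a j * (1 - (q * a k / a j * q ^ m)⁻¹) * e

/-- The one-sided cut-offs are legitimate because q^|δ| is q/c_k or 1/a_k: in the first case the
factor of c_k vanishes at n = -1, in the second the factor of a_k vanishes at n = 0. -/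
lemma compTotalFactor_recurrence (h : Admissible (Complex.exp τ) (qPow τ α) (qPow τ β) (qPow τ γ))
    (hL : L ≤ M) (i : Option (Fin N × Fin M)) (n : ℤ) :
    compTotalFactor L (Complex.exp τ) (qPow τ α) (qPow τ β) (qPow τ γ) i (n + 1) *
        ∏ j, (1 - qPow τ γ j *
          (Complex.exp (τ * ∑ j, compExp α β γ L i j) * Complex.exp τ ^ n)) =
      compTotalFactor L (Complex.exp τ) (qPow τ α) (qPow τ β) (qPow τ γ) i n *
        ∏ j, (1 - qPow τ α j *
          (Complex.exp (τ * ∑ j, compExp α β γ L i j) * Complex.exp τ ^ n)) := by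
  rcases i with _ | ⟨k, l⟩
  · rw [exp_sum_compExp_none]
    exact h.compTotalFactor_recurrence_none hL n
  · rw [exp_sum_compExp_some]
    simp only [compTotalFactor]
    by_cases hl : (l : ℕ) < L
    · simp only [if_pos hl]
      rcases lt_or_ge n 0 with hn | hn
      · rw [if_neg (not_le.mpr hn), zero_mul]
        split_ifs with h1
        · have hn1 : n = -1 := by omega
          rw [prod_eq_zero (mem_univ k), mul_zero]
          rw [hn1, zpow_neg_one]
          have := h.q_ne
          have := h.c_ne k
          field_simp
          ring
        · simp
      · lift n to ℕ using hn
        rw [if_pos (by omega), if_pos (by omega), Int.toNat_natCast,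
          show ((n : ℤ) + 1).toNat = n + 1 by omega, zpow_natCast]
        exact h.pivotFactor_recurrence_of_lt k hl n
    · simp only [if_neg hl]
      rcases lt_or_ge n 0 with hn | hn
      · obtain ⟨m, rfl⟩ : ∃ m : ℕ, n = -(m + 1) := ⟨(-n - 1).toNat, by omega⟩
        rw [if_pos (by omega), if_pos (by omega), show (-(-((m : ℤ) + 1) + 1)).toNat = m by omega,
          show (-(-((m : ℤ) + 1))).toNat = m + 1 by omega]
        have := h.pivotFactor_recurrence_of_ge k hl m
        linear_combination (∏ j, qPow τ γ j / qPow τ α j) ^ m * this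
      · rw [if_neg (show ¬ n + 1 ≤ 0 by omega), zero_mul]
        split_ifs with h1
        · have hn1 : n = 0 := by omega
          refine (mul_eq_zero_of_right _ (prod_eq_zero (mem_univ k) ?_)).symm
          rw [hn1, zpow_zero, mul_one, mul_inv_cancel₀ (h.a_ne k), sub_self]
        · simp

lemma inRegion_of_mem {q : ℂ} {a : Fin N → ℂ} {b : Fin M → ℂ} {c : Fin N → ℂ} {z : Fin M → ℂ}
    (hz : z ∈ region q a b c L 1) : InRegion q a b c L fun i => Complex.exp (z i) :=
  ⟨fun _ => Complex.exp_ne_zero _, hz.1, hz.2.1, hz.2.2⟩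

lemma uSeriesTerm_one (hL : L ≤ M) (i : Option (Fin N × Fin M)) :
    ∃ s : Equiv.Perm (Fin M), ∀ (z : Fin M → ℂ) (m : Fin M → ℕ),
      uSeriesTerm τ α β γ L hL 1 i z m =
        genTerm (compCut L i)
        (compTwoSided (Complex.exp τ) (qPow τ α) (qPow τ β) (qPow τ γ) L i)
        (compOneSided (Complex.exp τ) (qPow τ α) (qPow τ β) (qPow τ γ) L i)
        (compVar (Complex.exp τ) (qPow τ α) (qPow τ β) (qPow τ γ) L (fun i => Complex.exp (z i)) i)
        ((s.arrowCongr (Equiv.refl ℕ)) m) := by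
  obtain ⟨s, hs⟩ := exists_uTerm_eq_genTerm (a := qPow τ α) (c := qPow τ γ) (L := L)
    (Complex.exp_ne_zero τ) (qPow_ne_zero τ β) hL i
  refine ⟨s.symm, fun z m => ?_⟩
  rw [uSeriesTerm]
  exact hs (fun i => Complex.exp (z i)) m

theorem summable_uSeriesTerm (h : Admissible (Complex.exp τ) (qPow τ α) (qPow τ β) (qPow τ γ))
    (hL : L ≤ M) (i : Option (Fin N × Fin M)) {z : Fin M → ℂ}
    (hz : z ∈ region (Complex.exp τ) (qPow τ α) (qPow τ β) (qPow τ γ) L 1) :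
    Summable (uSeriesTerm τ α β γ L hL 1 i z) := by
  obtain ⟨s, hs⟩ := uSeriesTerm_one (τ := τ) (α := α) (β := β) (γ := γ) hL i
  have h1 := h.summable hL (inRegion_of_mem hz) i
  have h2 := (s.arrowCongr (Equiv.refl ℕ)).summable_iff.mpr h1
  exact h2.congr fun m => (hs z m).symm

/-- The components of `u`, for the trivial permutation, in normal form. -/
lemma u_one_eq (hL : L ≤ M) (i : Option (Fin N × Fin M)) (z : Fin M → ℂ) :
    u τ α β γ L hL 1 i z = latticeMonomial (compExp α β γ L i) 0 z *
      ∑' μ, genTerm (compCut L i)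
        (compTwoSided (Complex.exp τ) (qPow τ α) (qPow τ β) (qPow τ γ) L i)
        (compOneSided (Complex.exp τ) (qPow τ α) (qPow τ β) (qPow τ γ) L i)
        (compVar (Complex.exp τ) (qPow τ α) (qPow τ β) (qPow τ γ) L
          (fun i => Complex.exp (z i)) i) μ := by
  obtain ⟨s, hs⟩ := uSeriesTerm_one (τ := τ) (α := α) (β := β) (γ := γ) hL i
  rw [u, tsum_congr (hs z), ← uMonomial_eq, Equiv.tsum_eq (s.arrowCongr (Equiv.refl ℕ))]
  rfl

theorem isSolutionOn_u_one (h : Admissible (Complex.exp τ) (qPow τ α) (qPow τ β) (qPow τ γ))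
    (hL : L ≤ M) (i : Option (Fin N × Fin M)) :
    IsSolutionOn τ (qPow τ α) (qPow τ β) (qPow τ γ)
      (region (Complex.exp τ) (qPow τ α) (qPow τ β) (qPow τ γ) L 1) (u τ α β γ L hL 1 i) := by
  refine isSolutionOn_of_recurrence τ _ _ _ _ _ (compExp α β γ L i)
    (compTotalFactor L (Complex.exp τ) (qPow τ α) (qPow τ β) (qPow τ γ) i)
    (compLocalFactor L (Complex.exp τ) (qPow τ α) (qPow τ β) (qPow τ γ) i)
    (compTotalFactor_recurrence h hL i) (compLocalFactor_recurrence h i) fun z hz => ?_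
  -- Coefficients outside the image of the index lattice vanish, so the sum over ℤ^M is the sum over
  -- the original indices.
  rw [← (compLattice_injective L i).hasSum_iff fun n hn => by
    rw [coeff_eq_zero_of_notMem_range L _ _ _ _ i n hn, zero_mul], u_one_eq]
  refine hasSum_of_eq ((h.summable hL (inRegion_of_mem hz) i).hasSum.mul_left _) fun μ => ?_
  rw [← coeff_mul_prod_zpow L _ _ h.q_ne h.b_ne (fun _ => Complex.exp_ne_zero _) i μ]
  simp only [Function.comp]
  rw [latticeMonomial_eq_mul]
  ring

end ComponentSolution

/-! ### Linear independence -/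

section Asymptotics

/-- In an asymptotic relation `∑ d_i x_i^k (1 + o(1)) = 0` the coefficients that belong to a given
value of `x_i` of maximal modulus add up to `0`. -/
lemma sum_coeff_eq_zero_of_asymptotic {ι : Type*} [Fintype ι] {x d : ι → ℂ} {g : ι → ℕ → ℂ}
    (hg : ∀ i, Tendsto (g i) atTop (𝓝 1)) (h0 : ∀ᶠ k in atTop, ∑ i, d i * x i ^ k * g i k = 0)
    {y : ℂ} (hy : y ≠ 0) (hmax : ∀ i, d i ≠ 0 → ‖x i‖ ≤ ‖y‖) [DecidablePred fun i => x i = y] :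
    ∑ i with x i = y, d i = 0 := by
  classical
  set r : ℝ := ‖y‖ with hr
  have hr0 : 0 < r := norm_pos_iff.mpr hy
  have hrc : (r : ℂ) ≠ 0 := by exact_mod_cast hr0.ne'
  set v : ι → ℂ := fun i => x i / r with hv
  have hv1 : ∀ i, d i ≠ 0 → ‖v i‖ ≤ 1 := fun i hi => by
    simp only [hv, norm_div, Complex.norm_real, Real.norm_eq_abs, abs_of_pos hr0]
    exact (div_le_one hr0).mpr (hmax i hi)
  set H : ℕ → ℂ := fun k => ∑ i, d i * v i ^ k with hH
  -- After division by r^k the terms with d_i ≠ 0 are bounded, so replacing g_i by its limit 1 costs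
  -- only a null sequence.
  have hlim : Tendsto H atTop (𝓝 0) := by
    have h1 : Tendsto (fun k => ∑ i, d i * v i ^ k * (1 - g i k)) atTop (𝓝 0) := by
      rw [← sum_const_zero (ι := ι) (s := univ)]
      refine tendsto_finsetSum _ fun i _ => ?_
      by_cases hi : d i = 0
      · simp [hi]
      · refine Tendsto.zero_mul_isBoundedUnder_le (f := fun k => 1 - g i k)
          (g := fun k => d i * v i ^ k) ?_ ?_ |>.congr fun k => mul_comm _ _
        · simpa using (hg i).const_sub 1
        · refine isBoundedUnder_of ⟨‖d i‖, fun k => ?_⟩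
          simp only [Function.comp, norm_mul, norm_pow]
          exact mul_le_of_le_one_right (norm_nonneg _) (pow_le_one₀ (norm_nonneg _) (hv1 i hi))
    refine h1.congr' ?_
    filter_upwards [h0] with k hk
    have h2 : ∑ i, d i * v i ^ k * g i k = 0 := by
      have : ∑ i, d i * v i ^ k * g i k = (∑ i, d i * x i ^ k * g i k) / (r : ℂ) ^ k := by
        rw [sum_div]
        exact sum_congr rfl fun i _ => by simp only [hv, div_pow]; ring
      rw [this, hk, zero_div]
    simp only [hH, mul_sub, mul_one, sum_sub_distrib, h2, sub_zero]
  set y' : ℂ := y / r with hy'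
  -- P kills every base v_i other than y'. Applied to the null sequence H as a polynomial in the
  -- shift of k, it isolates a multiple of y'^k; as |y'| = 1, the multiple must be zero.
  set P : Polynomial ℂ := ∏ w ∈ (univ.image v).erase y', (Polynomial.X - Polynomial.C w) with hP
  have hPv : ∀ i, v i ≠ y' → P.eval (v i) = 0 := fun i hi => by
    rw [hP, Polynomial.eval_prod]
    exact prod_eq_zero (mem_erase.mpr ⟨hi, mem_image_of_mem v (mem_univ i)⟩) (by simp)
  have hPy : P.eval y' ≠ 0 := by
    rw [hP, Polynomial.eval_prod, prod_ne_zero_iff]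
    intro w hw
    simpa [sub_eq_zero] using (mem_erase.mp hw).1.symm
  have hcomb : ∀ k, ∑ p ∈ range (P.natDegree + 1), P.coeff p * H (k + p) =
      (∑ i with x i = y, d i) * P.eval y' * y' ^ k := by
    intro k
    have h1 : ∀ i, ∑ p ∈ range (P.natDegree + 1), P.coeff p * (d i * v i ^ (k + p)) =
        d i * v i ^ k * P.eval (v i) := fun i => by
      rw [Polynomial.eval_eq_sum_range, mul_sum]
      exact sum_congr rfl fun p _ => by rw [pow_add]; ring
    simp only [hH, mul_sum]
    rw [sum_comm, sum_congr rfl fun i _ => h1 i, sum_filter, sum_mul, sum_mul]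
    refine sum_congr rfl fun i _ => ?_
    split_ifs with hi
    · simp only [hv, hi, hy']; ring
    · rw [hPv i fun h => hi ?_]
      · ring
      · exact (div_left_inj' hrc).mp h
  have hlim2 : Tendsto (fun k => (∑ i with x i = y, d i) * P.eval y' * y' ^ k) atTop (𝓝 0) := by
    rw [← funext hcomb, ← sum_const_zero (s := range (P.natDegree + 1))]
    refine tendsto_finsetSum _ fun p _ => ?_
    simpa using ((tendsto_add_atTop_iff_nat p).mpr hlim).const_mul (P.coeff p)
  have hy1 : ‖y'‖ = 1 := by
    simp only [hy', norm_div, Complex.norm_real, Real.norm_eq_abs, abs_of_pos hr0]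
    exact div_self hr0.ne'
  have hlim3 := hlim2.norm
  simp only [norm_mul, norm_pow, hy1, one_pow, mul_one, norm_zero] at hlim3
  have := tendsto_nhds_unique hlim3 tendsto_const_nhds
  rcases mul_eq_zero.mp this.symm with h | h
  · exact norm_eq_zero.mp h
  · exact absurd (norm_eq_zero.mp h) hPy

end Asymptotics

/-! ### Independence of the components on an orbit of the shifts -/

section Independence

variable {N M : ℕ}

/-- The points `q^n t` of the orbit of `t = exp z`. -/
def latticePt (τ : ℂ) (z : Fin M → ℂ) (n : Fin M → ℤ) : Fin M → ℂ := fun i => z i + τ * n i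

lemma exp_latticePt (τ : ℂ) (z : Fin M → ℂ) (n : Fin M → ℤ) (i : Fin M) :
    Complex.exp (latticePt τ z n i) = Complex.exp (z i) * Complex.exp τ ^ n i := by
  rw [latticePt, Complex.exp_add, mul_comm τ, Complex.exp_int_mul]

/-- The character `n ↦ ∏ Q_i^{n_i}`. -/
noncomputable def latticeChar (Q : Fin M → ℂ) (hQ : ∀ i, Q i ≠ 0) :
    Multiplicative (Fin M → ℤ) →* ℂ where
  toFun n := ∏ i, Q i ^ (Multiplicative.toAdd n) i
  map_one' := by simp
  map_mul' m n := by
    rw [← prod_mul_distrib]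
    exact prod_congr rfl fun i _ => by simp [zpow_add₀ (hQ i)]

lemma latticeChar_injective {Q Q' : Fin M → ℂ} {hQ : ∀ i, Q i ≠ 0} {hQ' : ∀ i, Q' i ≠ 0}
    (h : latticeChar Q hQ = latticeChar Q' hQ') : Q = Q' := by
  ext j
  have key : ∀ (Q : Fin M → ℂ) (hQ : ∀ i, Q i ≠ 0),
      latticeChar Q hQ (Multiplicative.ofAdd (Pi.single j 1)) = Q j := by
    intro Q hQ
    simp only [latticeChar, MonoidHom.coe_mk, OneHom.coe_mk, toAdd_ofAdd]
    rw [prod_eq_single j (fun i _ hi => by simp [hi]) (by simp)]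
    simp
  rw [← key Q hQ, ← key Q' hQ', h]

lemma latticeMonomial_latticePt (τ : ℂ) (δ : Fin M → ℂ) (z : Fin M → ℂ) (n : Fin M → ℤ) :
    latticeMonomial δ 0 (latticePt τ z n) = latticeMonomial δ 0 z *
      latticeChar (fun i => Complex.exp (τ * δ i)) (fun _ => Complex.exp_ne_zero _)
        (Multiplicative.ofAdd n) := by
  simp only [latticeMonomial, latticeChar, MonoidHom.coe_mk, OneHom.coe_mk, toAdd_ofAdd,
    ← Complex.exp_int_mul]
  rw [← Complex.exp_sum, ← Complex.exp_add, ← sum_add_distrib]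
  congr 1
  refine sum_congr rfl fun i _ => ?_
  simp only [latticePt, Pi.zero_apply]
  push_cast
  ring

variable {q τ : ℂ} {a : Fin N → ℂ} {b : Fin M → ℂ} {c : Fin N → ℂ} {L : ℕ}
  {α : Fin N → ℂ} {β : Fin M → ℂ} {γ : Fin N → ℂ}

/-- A direction that goes deep into the region. -/
def deepDir (M L : ℕ) (i : Fin M) : ℤ := if (i : ℕ) < L then (L : ℤ) - i else (L : ℤ) - i - 1

lemma deepDir_pos {i : Fin M} (h : (i : ℕ) < L) : 0 < deepDir M L i := by
  rw [deepDir, if_pos h]; omega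

lemma deepDir_neg {i : Fin M} (h : ¬ (i : ℕ) < L) : deepDir M L i < 0 := by
  rw [deepDir, if_neg h]; omega

lemma deepDir_lt {i j : Fin M} (h : i < j) : deepDir M L j < deepDir M L i := by
  rw [Fin.lt_def] at h
  unfold deepDir
  split_ifs <;> omega

lemma norm_zpow_lt_one (hq0 : q ≠ 0) (hq1 : ‖q‖ < 1) {n : ℤ} (hn : 0 < n) : ‖q ^ n‖ < 1 := by
  rw [norm_zpow]
  exact zpow_lt_one₀ (norm_pos_iff.mpr hq0) hq1 hn

/-- The exponents `deepDir` decrease strictly, are positive before the cut and negative after it.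
Each variable of a component is a constant times t_i, 1/t_i or a ratio t_i/t_j with the matching
order, so it is scaled by a positive power of q. -/
lemma compVar_geometric (hq0 : q ≠ 0) (hq1 : ‖q‖ < 1) (i : Option (Fin N × Fin M)) (j : Fin M) :
    ∃ r : ℂ, ‖r‖ < 1 ∧ ∀ (t : Fin M → ℂ) (k : ℕ),
      compVar q a b c L (fun i => t i * (q ^ deepDir M L i) ^ k) i j =
        compVar q a b c L t i j * r ^ k := by
  have hlt : ∀ {m n : ℤ}, m < n → ‖q ^ n / q ^ m‖ < 1 := fun {m n} h => by
    rw [← zpow_sub₀ hq0]; exact norm_zpow_lt_one hq0 hq1 (by omega)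
  have hinv : ∀ {n : ℤ}, n < 0 → ‖(q ^ n)⁻¹‖ < 1 := fun {n} h => by
    rw [← zpow_neg]; exact norm_zpow_lt_one hq0 hq1 (by omega)
  rcases i with _ | ⟨k, l⟩
  · by_cases h : (j : ℕ) < L
    · refine ⟨q ^ deepDir M L j, norm_zpow_lt_one hq0 hq1 (deepDir_pos h), fun t k => ?_⟩
      simp only [compVar, if_pos h]
    · refine ⟨(q ^ deepDir M L j)⁻¹, hinv (deepDir_neg h), fun t k => ?_⟩
      simp only [compVar, if_neg h]
      rw [inv_pow, ← mul_assoc, ← div_div, div_eq_mul_inv (q / _)]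
  · rcases lt_trichotomy j l with h | rfl | h
    · refine ⟨_, hlt (deepDir_lt (L := L) h), fun t n => ?_⟩
      rw [compVar_of_lt q a b c _ k h, compVar_of_lt q a b c _ k h, div_pow, ← mul_assoc,
        ← mul_assoc, mul_div_mul_comm]
    · by_cases h : (j : ℕ) < L
      · refine ⟨q ^ deepDir M L j, norm_zpow_lt_one hq0 hq1 (deepDir_pos h), fun t n => ?_⟩
        rw [compVar_self, compVar_self, if_pos h, if_pos h, ← mul_assoc, mul_div_right_comm]
      · refine ⟨(q ^ deepDir M L j)⁻¹, hinv (deepDir_neg h), fun t n => ?_⟩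
        rw [compVar_self, compVar_self, if_neg h, if_neg h, inv_pow, ← mul_assoc (b j), ← div_div,
          div_eq_mul_inv (q / _), mul_assoc]
    · refine ⟨_, hlt (deepDir_lt (L := L) h), fun t n => ?_⟩
      rw [compVar_of_gt q a b c _ k h, compVar_of_gt q a b c _ k h, div_pow, ← mul_assoc,
        ← mul_assoc, mul_div_mul_comm]

lemma exp_latticePt_deep (z : Fin M → ℂ) (w : Fin M → ℤ) (k : ℕ) (i : Fin M) :
    Complex.exp (latticePt τ z (k • deepDir M L + w) i) =
      Complex.exp (latticePt τ z w i) * (Complex.exp τ ^ deepDir M L i) ^ k := by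
  rw [exp_latticePt, exp_latticePt, mul_assoc, ← zpow_natCast (_ ^ deepDir M L i), ← zpow_mul,
    ← zpow_add₀ (Complex.exp_ne_zero τ)]
  congr 2
  simp
  ring

lemma eventually_norm_mul_pow_lt_one (x : ℂ) {r : ℂ} (hr : ‖r‖ < 1) :
    ∀ᶠ k : ℕ in atTop, ‖x * r ^ k‖ < 1 := by
  have h := ((tendsto_pow_atTop_nhds_zero_of_norm_lt_one hr).const_mul x).norm
  simp only [mul_zero, norm_zero] at h
  exact h.eventually_lt_const one_pos

lemma eventually_mem_region (hq : ‖Complex.exp τ‖ < 1) (z : Fin M → ℂ) (w : Fin M → ℤ) :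
    ∀ᶠ k : ℕ in atTop, latticePt τ z (k • deepDir M L + w) ∈
      region (Complex.exp τ) a b c L 1 := by
  have hq0 := Complex.exp_ne_zero τ
  have h1 : ∀ i : Fin M, ∀ᶠ k : ℕ in atTop, (i : ℕ) < L →
      ‖Complex.exp (latticePt τ z (k • deepDir M L + w) i)‖ < 1 := fun i => by
    by_cases h : (i : ℕ) < L
    · filter_upwards [eventually_norm_mul_pow_lt_one (Complex.exp (latticePt τ z w i))
        (norm_zpow_lt_one hq0 hq (deepDir_pos h))] with k hk _
      rwa [exp_latticePt_deep]
    · exact Eventually.of_forall fun _ h' => absurd h' h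
  have h2 : ∀ i : Fin M, ∀ᶠ k : ℕ in atTop, L ≤ (i : ℕ) →
      ‖(∏ j, c j / a j) * (Complex.exp τ / (b i *
        Complex.exp (latticePt τ z (k • deepDir M L + w) i)))‖ < 1 := fun i => by
    by_cases h : (i : ℕ) < L
    · exact Eventually.of_forall fun _ h' => absurd h (not_lt.mpr h')
    · filter_upwards [eventually_norm_mul_pow_lt_one
        ((∏ j, c j / a j) * (Complex.exp τ / (b i * Complex.exp (latticePt τ z w i))))
        (r := (Complex.exp τ ^ deepDir M L i)⁻¹) (by
          rw [← zpow_neg]; exact norm_zpow_lt_one hq0 hq (by have := deepDir_neg h; omega))]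
        with k hk _
      rw [exp_latticePt_deep, ← mul_assoc (b i), ← div_div, div_eq_mul_inv (Complex.exp τ / _),
        ← mul_assoc, ← inv_pow]
      exact hk
  have h3 : ∀ i j : Fin M, ∀ᶠ k : ℕ in atTop, i < j →
      ‖Complex.exp τ * Complex.exp (latticePt τ z (k • deepDir M L + w) i) /
        (b j * Complex.exp (latticePt τ z (k • deepDir M L + w) j))‖ < 1 := fun i j => by
    by_cases h : i < j
    · filter_upwards [eventually_norm_mul_pow_lt_one
        (Complex.exp τ * Complex.exp (latticePt τ z w i) /
          (b j * Complex.exp (latticePt τ z w j)))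
        (r := Complex.exp τ ^ deepDir M L i / Complex.exp τ ^ deepDir M L j) (by
          rw [← zpow_sub₀ hq0]
          exact norm_zpow_lt_one hq0 hq (by have := deepDir_lt (L := L) h; omega))] with k hk _
      rwa [exp_latticePt_deep, exp_latticePt_deep, ← mul_assoc, ← mul_assoc, mul_div_mul_comm,
        ← div_pow]
    · exact Eventually.of_forall fun _ h' => absurd h' h
  filter_upwards [eventually_all.mpr h1, eventually_all.mpr h2,
    eventually_all.mpr fun i => eventually_all.mpr (h3 i)] with k h1 h2 h3
  exact ⟨h1, h2, h3⟩

/-- Write A for `twoSidedBase`. At its own pivot l, u_{k,l} has q^δ_l = A⁻¹, whereas u_0 and the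
components with a larger pivot have 1 or, for u_0 after the cut, b_l⁻¹. Non-resonance excludes A = 1
and A = b_l; for a common pivot it separates the a_k or the c_k. -/
lemma exp_compExp_injective
    (h : Admissible (Complex.exp τ) (qPow τ α) (qPow τ β) (qPow τ γ)) :
    Function.Injective fun (i : Option (Fin N × Fin M)) (j : Fin M) =>
      Complex.exp (τ * compExp α β γ L i j) := by
  have hA1 : ∀ k l, (twoSidedBase (Complex.exp τ) (qPow τ α) (qPow τ β) (qPow τ γ) L k l)⁻¹ ≠ 1 :=
    fun k l h1 => by simpa [inv_eq_one.mp h1] using h.twoSidedBase_mul (L := L) k l 0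
  have none_some : ∀ k l, (fun j => Complex.exp (τ * compExp α β γ L none j)) ≠
      fun j => Complex.exp (τ * compExp α β γ L (some (k, l)) j) := by
    intro k l h1
    have h2 := congrFun h1 l
    rw [exp_compExp_self] at h2
    by_cases hl : (l : ℕ) < L
    · simp only [compExp, if_pos hl, mul_zero, Complex.exp_zero] at h2
      exact hA1 k l h2.symm
    · simp only [compExp, if_neg hl] at h2
      rw [exp_neg_eq_inv_qPow, inv_inj] at h2
      have h3 := h.twoSidedBase_div_mul (L := L) k l (-1)
      rw [← h2, mul_div_cancel_right₀ _ (h.b_ne l), zpow_neg_one, mul_inv_cancel₀ h.q_ne] at h3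
      exact h3 rfl
  have some_lt : ∀ k l k' l', l < l' → (fun j => Complex.exp (τ * compExp α β γ L (some (k, l)) j)) ≠
      fun j => Complex.exp (τ * compExp α β γ L (some (k', l')) j) := by
    intro k l k' l' hl h1
    have h2 := congrFun h1 l
    rw [exp_compExp_self, compExp_of_lt _ _ _ _ hl, mul_zero, Complex.exp_zero] at h2
    exact hA1 k l h2
  rintro (_ | ⟨k, l⟩) (_ | ⟨k', l'⟩) hi
  · rfl
  · exact absurd hi (none_some k' l')
  · exact absurd hi.symm (none_some k l)
  · rcases lt_trichotomy l l' with hl | rfl | hl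
    · exact absurd hi (some_lt k l k' l' hl)
    · by_contra hne
      have hk : k ≠ k' := fun hk => hne (by rw [hk])
      have h2 := congrFun hi l
      dsimp only at h2
      rw [exp_compExp_self, exp_compExp_self, inv_inj] at h2
      unfold twoSidedBase at h2
      have ht := h.tailProd_ne (l + 1)
      split_ifs at h2
      · rw [div_left_inj' (mul_ne_zero h.q_ne ht)] at h2
        exact h.c_div_c k k' hk 0 (by rw [h2, div_self (h.c_ne k'), zpow_zero])
      · rw [div_left_inj' ht] at h2
        exact h.a_div_a k k' hk 0 (by rw [h2, div_self (h.a_ne k'), zpow_zero])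
    · exact absurd hi.symm (some_lt k' l' k l hl)

/-- On every orbit of the `q`-shifts, the components of `u` are linearly independent over `ℂ`. -/
theorem linearIndependent_u_one
    (h : Admissible (Complex.exp τ) (qPow τ α) (qPow τ β) (qPow τ γ)) (hL : L ≤ M)
    (z : Fin M → ℂ) (C : Option (Fin N × Fin M) → ℂ)
    (hC : ∀ n, latticePt τ z n ∈ region (Complex.exp τ) (qPow τ α) (qPow τ β) (qPow τ γ) L 1 →
      ∑ i, C i * u τ α β γ L hL 1 i (latticePt τ z n) = 0) : C = 0 := by
  classical
  set χ : Option (Fin N × Fin M) → Multiplicative (Fin M → ℤ) →* ℂ := fun i =>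
    latticeChar (fun j => Complex.exp (τ * compExp α β γ L i j)) (fun _ => Complex.exp_ne_zero _)
    with hχ
  have hχinj : Function.Injective χ := fun i i' hi =>
    exp_compExp_injective h (latticeChar_injective hi)
  set A : Option (Fin N × Fin M) → ℂ := fun i => latticeMonomial (compExp α β γ L i) 0 z with hA
  have hA0 : ∀ i, A i ≠ 0 := fun i => Complex.exp_ne_zero _
  set v := Multiplicative.ofAdd (deepDir M L) with hv
  have hχ0 : ∀ i, χ i v ≠ 0 := fun i => ((Group.isUnit v).map (χ i)).ne_zero
  set g : (Fin M → ℤ) → Option (Fin N × Fin M) → ℕ → ℂ := fun w i k =>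
    ∑' μ, genTerm (compCut L i)
        (compTwoSided (Complex.exp τ) (qPow τ α) (qPow τ β) (qPow τ γ) L i)
        (compOneSided (Complex.exp τ) (qPow τ α) (qPow τ β) (qPow τ γ) L i)
        (compVar (Complex.exp τ) (qPow τ α) (qPow τ β) (qPow τ γ) L
          (fun j => Complex.exp (latticePt τ z (k • deepDir M L + w) j)) i) μ with hg
  have hglim : ∀ w i, Tendsto (g w i) atTop (𝓝 1) := by
    intro w i
    -- The series at one point of the ray inside the region dominates those at all later points.
    obtain ⟨k₀, hk₀⟩ := (eventually_mem_region (a := qPow τ α) (b := qPow τ β) (c := qPow τ γ)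
      (L := L) h.q_lt z w).exists
    choose r hr1 hr using compVar_geometric (a := qPow τ α) (b := qPow τ β) (c := qPow τ γ)
      (L := L) h.q_ne h.q_lt i
    have hx : ∀ k j, compVar (Complex.exp τ) (qPow τ α) (qPow τ β) (qPow τ γ) L
        (fun j => Complex.exp (latticePt τ z (k • deepDir M L + w) j)) i j =
        compVar (Complex.exp τ) (qPow τ α) (qPow τ β) (qPow τ γ) L
          (fun j => Complex.exp (latticePt τ z w j)) i j * r j ^ k := fun k j => by
      rw [← hr]; simp only [exp_latticePt_deep]
    refine tendsto_tsum_genTerm _ (h.summable hL (inRegion_of_mem hk₀) i) (compTwoSided_zero i)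
      (compOneSided_zero i) ?_ ?_
    · filter_upwards [eventually_ge_atTop k₀] with k hk j
      rw [hx, hx, norm_mul, norm_mul, norm_pow, norm_pow]
      exact mul_le_mul_of_nonneg_left (pow_le_pow_of_le_one (norm_nonneg _) (hr1 j).le hk)
        (norm_nonneg _)
    · intro j
      simp only [hx]
      simpa using (tendsto_pow_atTop_nhds_zero_of_norm_lt_one (hr1 j)).const_mul _
  have hrel : ∀ w : Fin M → ℤ, ∀ᶠ k : ℕ in atTop,
      ∑ i, (C i * A i * χ i (Multiplicative.ofAdd w)) * χ i v ^ k * g w i k = 0 := by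
    intro w
    filter_upwards [eventually_mem_region (a := qPow τ α) (b := qPow τ β) (c := qPow τ γ)
      (L := L) h.q_lt z w] with k hk
    rw [← hC _ hk]
    refine sum_congr rfl fun i _ => ?_
    rw [u_one_eq, latticeMonomial_latticePt, ofAdd_add, map_mul, ofAdd_nsmul, map_pow]
    ring
  by_contra hne
  obtain ⟨i₁, hi₁⟩ := Function.ne_iff.mp hne
  -- Take a component of fastest growth among those that occur. Several components may share its
  -- rate along the single direction v; letting the base point w vary over the lattice separates
  -- them through their characters.
  obtain ⟨i₀, hi₀, hmax⟩ := exists_max_image ({i | C i ≠ 0} : Finset (Option (Fin N × Fin M)))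
    (fun i => ‖χ i v‖) ⟨i₁, by simpa using hi₁⟩
  have hi₀' : C i₀ ≠ 0 := by simpa using hi₀
  have hdep : ∀ w : Fin M → ℤ, ∑ i with χ i v = χ i₀ v,
      C i * A i * χ i (Multiplicative.ofAdd w) = 0 := fun w =>
    sum_coeff_eq_zero_of_asymptotic (hglim w) (hrel w) (hχ0 i₀) fun i hi =>
      hmax i (by simpa using left_ne_zero_of_mul (left_ne_zero_of_mul hi))
  have hli := (linearIndependent_monoidHom (Multiplicative (Fin M → ℤ)) ℂ).comp χ hχinj
  rw [linearIndependent_iff'] at hli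
  have := hli _ (fun i => C i * A i) (by
    ext w
    simpa [Finset.sum_apply] using hdep (Multiplicative.toAdd w)) i₀ (by simp)
  exact mul_ne_zero hi₀' (hA0 i₀) this

end Independence

/-! ### Propagation of zeros on polyhedral regions of the lattice -/

section Polyhedron

variable {m : ℕ}

/-- The polyhedron `{P ; D_{ab} ≤ P_a - P_b for a < b}`. -/
def polyhedron (D : Fin m → Fin m → ℤ) : Set (Fin m → ℤ) :=
  {P | ∀ a b, a < b → D a b ≤ P a - P b}

/-- The point `P + u e_a - w e_b`. -/
def movePt (P : Fin m → ℤ) (a b : Fin m) (u w : ℕ) : Fin m → ℤ :=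
  P + Pi.single a (u : ℤ) - Pi.single b (w : ℤ)

/-- If each value at a corner is determined by the other values on a rectangle in the directions
`e_a`, `-e_b`, then a function that vanishes on the deep part of a polyhedron vanishes on it. -/
theorem eq_zero_of_deep (N : ℕ) (D R : Fin m → Fin m → ℤ) (F : (Fin m → ℤ) → ℂ)
    (hDR : ∀ a b, a < b → D a b ≤ R a b)
    (hR : ∀ a b c, a < b → b < c → R a b + R b c + N ≤ R a c)
    (hrel : ∀ a b, a < b → ∀ P, (∀ u ≤ N, ∀ w ≤ N, movePt P a b u w ∈ polyhedron D) →
      (∀ u ≤ N, ∀ w ≤ N, u ≠ 0 ∨ w ≠ 0 → F (movePt P a b u w) = 0) → F P = 0)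
    (hdeep : ∀ P ∈ polyhedron R, F P = 0) : ∀ P ∈ polyhedron D, F P = 0 := by
  -- V is the total amount by which P violates the inequalities of R; the induction is on V.
  set V : (Fin m → ℤ) → ℕ := fun P =>
    ∑ x : Fin m × Fin m, if x.1 < x.2 then (R x.1 x.2 - (P x.1 - P x.2)).toNat else 0 with hV
  suffices h : ∀ n P, V P = n → P ∈ polyhedron D → F P = 0 from fun P hP => h _ P rfl hP
  intro n
  induction n using Nat.strong_induction_on with
  | _ n ih =>
  intro P hn hP
  by_cases hviol : ∃ x : Fin m × Fin m, x.1 < x.2 ∧ P x.1 - P x.2 < R x.1 x.2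
  -- Choose a violated pair with b - a maximal: all longer pairs that start at a or end at b then
  -- satisfy their inequalities.
  · obtain ⟨⟨a, b⟩, hab, hmax⟩ := exists_max_image
      ({x | x.1 < x.2 ∧ P x.1 - P x.2 < R x.1 x.2} : Finset (Fin m × Fin m))
      (fun x => (x.2 : ℤ) - x.1) (by simpa [Finset.Nonempty] using hviol)
    simp only [mem_filter, mem_univ, true_and] at hab hmax
    obtain ⟨hab, hPab⟩ := hab
    have hright : ∀ y, b < y → R a y ≤ P a - P y := fun y hy => by
      by_contra hlt
      have := hmax (a, y) ⟨hab.trans hy, not_le.mp hlt⟩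
      simp only [Fin.lt_def] at *
      omega
    have hleft : ∀ x, x < a → R x b ≤ P x - P b := fun x hx => by
      by_contra hlt
      have := hmax (x, b) ⟨hx.trans hab, not_le.mp hlt⟩
      simp only [Fin.lt_def] at *
      omega
    -- Only differences with x = b or y = a can decrease. For x = b, subtracting the violated
    -- inequality for (a,b) from the valid one for (a,y) and using the superadditivity of R leaves a
    -- margin N for (b,y), which covers the loss w ≤ N; the case y = a is symmetric.
    have hmove : ∀ u ≤ N, ∀ w ≤ N, ∀ x y, x < y →
        P x - P y ≤ movePt P a b u w x - movePt P a b u w y ∨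
        R x y ≤ movePt P a b u w x - movePt P a b u w y := by
      intro u hu w hw x y hxy
      have hu' : (u : ℤ) ≤ N := by exact_mod_cast hu
      have hw' : (w : ℤ) ≤ N := by exact_mod_cast hw
      simp only [movePt, Pi.add_apply, Pi.sub_apply]
      by_cases h1 : x = b
      · subst h1
        right
        have e1 := hright y hxy
        have e2 := hR a x y hab hxy
        rw [Pi.single_eq_of_ne hab.ne', Pi.single_eq_same, Pi.single_eq_of_ne (hab.trans hxy).ne',
          Pi.single_eq_of_ne hxy.ne']
        omega
      by_cases h2 : y = a
      · subst h2
        right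
        have e1 := hleft x hxy
        have e2 := hR x y b hxy hab
        rw [Pi.single_eq_of_ne hxy.ne, Pi.single_eq_of_ne h1, Pi.single_eq_same,
          Pi.single_eq_of_ne hab.ne]
        omega
      left
      have e1 : (0 : ℤ) ≤ (Pi.single a (u : ℤ) : Fin m → ℤ) x := by
        by_cases h : x = a
        · subst h; simp
        · simp [h]
      have e2 : (0 : ℤ) ≤ (Pi.single b (w : ℤ) : Fin m → ℤ) y := by
        by_cases h : y = b
        · subst h; simp
        · simp [h]
      rw [Pi.single_eq_of_ne h1, Pi.single_eq_of_ne h2]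
      omega
    have hmem : ∀ u ≤ N, ∀ w ≤ N, movePt P a b u w ∈ polyhedron D := by
      intro u hu w hw x y hxy
      have := hDR x y hxy
      have := hP x y hxy
      rcases hmove u hu w hw x y hxy with h | h <;> omega
    refine hrel a b hab P hmem fun u hu w hw huw => ih _ ?_ _ rfl (hmem u hu w hw)
    rw [← hn]
    refine sum_lt_sum (fun x _ => ?_) ⟨(a, b), mem_univ _, ?_⟩
    · split_ifs with hx
      · rcases hmove u hu w hw x.1 x.2 hx with h | h <;> omega
      · exact le_rfl
    · rw [if_pos hab, if_pos hab]
      have e1 : movePt P a b u w a = P a + u := by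
        simp [movePt, Pi.single_eq_of_ne hab.ne]
      have e2 : movePt P a b u w b = P b - w := by
        simp [movePt, Pi.single_eq_of_ne hab.ne']
      rw [e1, e2]
      dsimp only at hPab ⊢
      omega
  · refine hdeep P fun a b hab => ?_
    by_contra h
    exact hviol ⟨(a, b), hab, not_le.mp h⟩

/-- Two points of a polyhedron with the same coordinate `s` are joined by unit steps in the other
coordinates, inside the polyhedron. -/
theorem polyhedron_connected (R : Fin m → Fin m → ℤ) (s : Fin m) (Y : (Fin m → ℤ) → Prop)
    (hstep : ∀ r, r ≠ s → ∀ P ∈ polyhedron R, P + Pi.single r 1 ∈ polyhedron R →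
      (Y P ↔ Y (P + Pi.single r 1)))
    {P Q : Fin m → ℤ} (hP : P ∈ polyhedron R) (hQ : Q ∈ polyhedron R) (hs : P s = Q s)
    (hY : Y P) : Y Q := by
  suffices h : ∀ n P, (∑ a, (P a - Q a).natAbs) = n → P ∈ polyhedron R → P s = Q s → Y P → Y Q from
    h _ P rfl hP hs hY
  intro n
  induction n using Nat.strong_induction_on with
  | _ n ih =>
  intro P hn hP hs hY
  by_cases hup : ∃ r, P r < Q r
  -- Raising P_r only threatens the pairs (a,r) with a < r. By minimality Q_a ≤ P_a, so the
  -- inequality for Q protects them.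
  · obtain ⟨r, hr, hmin⟩ := exists_min_image ({r | P r < Q r} : Finset (Fin m)) id
      (by simpa [Finset.Nonempty] using hup)
    simp only [mem_filter, mem_univ, true_and, id] at hr hmin
    have hrs : r ≠ s := fun h => by rw [h] at hr; omega
    have hmem : P + Pi.single r 1 ∈ polyhedron R := fun a b hab => by
      have h1 := hP a b hab
      simp only [Pi.add_apply]
      by_cases hbr : b = r
      · subst hbr
        have h2 : Q a ≤ P a := by
          by_contra h; exact absurd (hmin a (not_le.mp h)) (not_le.mpr hab)
        have h3 := hQ a b hab
        rw [Pi.single_eq_same, Pi.single_eq_of_ne hab.ne]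
        omega
      · rw [Pi.single_eq_of_ne hbr]
        by_cases har : a = r
        · subst har; rw [Pi.single_eq_same]; omega
        · rw [Pi.single_eq_of_ne har]; omega
    refine ih _ ?_ _ rfl hmem (by simp [hrs.symm, hs]) ((hstep r hrs P hP hmem).mp hY)
    rw [← hn]
    refine sum_lt_sum (fun a _ => ?_) ⟨r, mem_univ _, ?_⟩
    · by_cases har : a = r
      · subst har; simp only [Pi.add_apply, Pi.single_eq_same]; omega
      · simp [har]
    · simp only [Pi.add_apply, Pi.single_eq_same]; omega
  push Not at hup
  by_cases hdown : ∃ r, Q r < P r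
  -- Dually, lowering the last coordinate that is too large only threatens the pairs (r,b) with r <
  -- b, where P_b ≤ Q_b.
  · obtain ⟨r, hr, hmax⟩ := exists_max_image ({r | Q r < P r} : Finset (Fin m)) id
      (by simpa [Finset.Nonempty] using hdown)
    simp only [mem_filter, mem_univ, true_and, id] at hr hmax
    have hrs : r ≠ s := fun h => by rw [h] at hr; omega
    have hmem : P - Pi.single r 1 ∈ polyhedron R := fun a b hab => by
      have h1 := hP a b hab
      simp only [Pi.sub_apply]
      by_cases har : a = r
      · subst har
        have h2 : P b ≤ Q b := by
          by_contra h; exact absurd (hmax b (not_le.mp h)) (not_le.mpr hab)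
        have h3 := hQ a b hab
        rw [Pi.single_eq_same, Pi.single_eq_of_ne hab.ne']
        omega
      · rw [Pi.single_eq_of_ne har]
        by_cases hbr : b = r
        · subst hbr; rw [Pi.single_eq_same]; omega
        · rw [Pi.single_eq_of_ne hbr]; omega
    refine ih _ ?_ _ rfl hmem (by simp [hrs.symm, hs])
      ((hstep r hrs _ hmem (by simpa using hP)).mpr (by simpa using hY))
    rw [← hn]
    refine sum_lt_sum (fun a _ => ?_) ⟨r, mem_univ _, ?_⟩
    · by_cases har : a = r
      · subst har; simp only [Pi.sub_apply, Pi.single_eq_same]; omega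
      · simp [har]
    · simp only [Pi.sub_apply, Pi.single_eq_same]; omega
  · push Not at hdown
    have : P = Q := funext fun r => le_antisymm (hdown r) (hup r)
    exact this ▸ hY

end Polyhedron

/-! ### Local propagation of zeros through unit squares and long rectangles -/

section LocalPropagation

variable {M : ℕ}

/-- The lattice point `(k, …, k)`. -/
def diagPt (M k : ℕ) : Fin M → ℤ := fun _ => k

/-- The indicator of `S`, as a lattice point. -/
def indPt (S : Finset (Fin M)) : Fin M → ℤ := fun i => if i ∈ S then 1 else 0

@[simp] lemma indPt_empty : indPt (∅ : Finset (Fin M)) = 0 := by ext; simp [indPt]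

lemma indPt_insert {r : Fin M} {S : Finset (Fin M)} (h : r ∉ S) :
    indPt (insert r S) = indPt S + Pi.single r 1 := by
  ext i
  by_cases hi : i = r
  · subst hi; simp [indPt, h]
  · simp [indPt, hi]

lemma indPt_eq_erase_add {r : Fin M} {S : Finset (Fin M)} (h : r ∈ S) :
    indPt S = indPt (S.erase r) + Pi.single r 1 := by
  rw [← indPt_insert (notMem_erase r S), insert_erase h]

lemma diagPt_succ (k : ℕ) : diagPt M (k + 1) = diagPt M k + indPt univ := by
  ext i; simp [diagPt, indPt]

@[simp] lemma diagPt_zero : diagPt M 0 = 0 := by ext; simp [diagPt]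

/-- Zeros of `F` propagate along the unit squares and the rectangles of the system at `p`. -/
structure ZeroRules (N : ℕ) (F : (Fin M → ℤ) → ℂ) (p : Fin M → ℤ) : Prop where
  square_top : ∀ r s, r ≠ s → F p = 0 → F (p + Pi.single r 1) = 0 → F (p + Pi.single s 1) = 0 →
    F (p + Pi.single r 1 + Pi.single s 1) = 0
  square_side : ∀ r s, r ≠ s → F p = 0 → F (p + Pi.single s 1) = 0 →
    F (p + Pi.single s 1 + Pi.single r 1) = 0 → F (p + Pi.single r 1) = 0
  rect_top : ∀ s, (∀ k ≤ N, F (p + diagPt M k) = 0) →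
    (∀ k < N, F (p + diagPt M k + Pi.single s 1) = 0) → F (p + diagPt M N + Pi.single s 1) = 0
  rect_bot : ∀ s, (∀ k, 1 ≤ k → k ≤ N → F (p + diagPt M k) = 0) →
    (∀ k ≤ N, F (p + diagPt M k + Pi.single s 1) = 0) → F p = 0

variable {N : ℕ} {F : (Fin M → ℤ) → ℂ}

/-- The rules hold on the cube with corner `n` and side `B`. -/
def RulesNear (N : ℕ) (F : (Fin M → ℤ) → ℂ) (B : ℕ) (n : Fin M → ℤ) : Prop :=
  ∀ p, (∀ i, n i ≤ p i ∧ p i ≤ n i + B) → ZeroRules N F p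

lemma single_bounds (s i : Fin M) :
    0 ≤ (Pi.single s 1 : Fin M → ℤ) i ∧ (Pi.single s 1 : Fin M → ℤ) i ≤ 1 := by
  by_cases h : i = s
  · subst h; simp
  · simp [h]

lemma indPt_bounds (S : Finset (Fin M)) (i : Fin M) : 0 ≤ indPt S i ∧ indPt S i ≤ 1 := by
  unfold indPt; split_ifs <;> simp

lemma RulesNear.mono {B B' : ℕ} {n n' : Fin M → ℤ} (h : RulesNear N F B n)
    (hn : ∀ i, n i ≤ n' i ∧ n' i + B' ≤ n i + B) : RulesNear N F B' n' := fun p hp =>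
  h p fun i => ⟨(hn i).1.trans (hp i).1, (hp i).2.trans (hn i).2⟩

lemma RulesNear.add_single {B : ℕ} {n : Fin M → ℤ} (h : RulesNear N F (B + 1) n) (r : Fin M) :
    RulesNear N F B (n + Pi.single r 1) :=
  h.mono fun i => by
    have := single_bounds r i
    simp only [Pi.add_apply]
    push_cast
    constructor <;> linarith

lemma zero_on_cube {p : Fin M → ℤ} (hG : RulesNear N F 1 p) (A : Finset (Fin M)) (h0 : F p = 0)
    (h1 : ∀ s ∈ A, F (p + Pi.single s 1) = 0) : ∀ S ⊆ A, F (p + indPt S) = 0 := by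
  intro S
  induction S using Finset.strongInduction with
  | _ S ih =>
  intro hS
  rcases S.eq_empty_or_nonempty with rfl | ⟨r, hr⟩
  · simpa using h0
  rcases (S.erase r).eq_empty_or_nonempty with he | ⟨s, hs⟩
  · rw [indPt_eq_erase_add hr, he, indPt_empty, zero_add]
    exact h1 r (hS hr)
  have hsS := mem_of_mem_erase hs
  have hsr := ne_of_mem_erase hs
  have hrs : r ∈ S.erase s := mem_erase.mpr ⟨hsr.symm, hr⟩
  set S' := (S.erase r).erase s with hS'
  have e1 : indPt (S.erase r) = indPt S' + Pi.single s 1 := indPt_eq_erase_add hs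
  have e2 : indPt (S.erase s) = indPt S' + Pi.single r 1 := by
    rw [hS', erase_right_comm]; exact indPt_eq_erase_add hrs
  have e3 : indPt S = indPt S' + Pi.single s 1 + Pi.single r 1 := by
    rw [← e1]; exact indPt_eq_erase_add hr
  have hss : S' ⊂ S := (erase_ssubset hs).trans (erase_ssubset hr)
  have f0 := ih S' hss (hss.subset.trans hS)
  have f1 := ih (S.erase r) (erase_ssubset hr) ((erase_subset _ _).trans hS)
  have f2 := ih (S.erase s) (erase_ssubset hsS) ((erase_subset _ _).trans hS)
  rw [e1, ← add_assoc] at f1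
  rw [e2, ← add_assoc] at f2
  rw [e3, ← add_assoc, ← add_assoc]
  refine (hG (p + indPt S') fun i => ?_).square_top s r hsr f0 f1 f2
  have := indPt_bounds S' i
  simp only [Pi.add_apply]
  push_cast
  constructor <;> linarith

/-- The face of the cube without direction r vanishes by `zero_on_cube`. Starting at the opposite
vertex, the edges in direction r are descended one square at a time, each by `square_side`. -/
lemma zero_of_zero_diag {p : Fin M → ℤ} (hG : RulesNear N F 1 p) (r : Fin M) (h0 : F p = 0)
    (h1 : ∀ s, s ≠ r → F (p + Pi.single s 1) = 0) (hd : F (p + indPt univ) = 0) :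
    F (p + Pi.single r 1) = 0 := by
  have hc := zero_on_cube hG (univ.erase r) h0 fun s hs => h1 s (ne_of_mem_erase hs)
  have key : ∀ S : Finset (Fin M), S ⊆ univ.erase r → F (p + indPt S + Pi.single r 1) = 0 →
      F (p + Pi.single r 1) = 0 := by
    intro S
    induction S using Finset.induction_on with
    | empty => intro _ h; simpa using h
    | insert s S hs ih =>
      intro hS h
      have hS' : S ⊆ univ.erase r := (subset_insert s S).trans hS
      have hsr : s ≠ r := ne_of_mem_erase (hS (mem_insert_self s S))
      refine ih hS' ?_
      have f1 := hc _ hS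
      rw [indPt_insert hs, ← add_assoc] at h f1
      refine (hG (p + indPt S) fun i => ?_).square_side r s hsr.symm (hc S hS') f1 h
      have := indPt_bounds S i
      simp only [Pi.add_apply]
      push_cast
      constructor <;> linarith
  refine key (univ.erase r) subset_rfl ?_
  rw [add_assoc, ← indPt_eq_erase_add (mem_univ r)]
  exact hd

/-- The initial values at `n` vanish. -/
def InitZero (N : ℕ) (F : (Fin M → ℤ) → ℂ) (n : Fin M → ℤ) : Prop :=
  F n = 0 ∧ ∀ k < N, ∀ s, F (n + diagPt M k + Pi.single s 1) = 0

/-- The opposite vertex of the cube at n + (k,…,k) is the next diagonal point, so the diagonal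
vanishes up to k = N; the top rule of the rectangles then supplies the neighbours at k = N. -/
lemma InitZero.extend {n : Fin M → ℤ} (hG : RulesNear N F (N + 1) n) (h : InitZero N F n) :
    (∀ k ≤ N, F (n + diagPt M k) = 0) ∧ ∀ k ≤ N, ∀ s, F (n + diagPt M k + Pi.single s 1) = 0 := by
  have h1 : ∀ k ≤ N, F (n + diagPt M k) = 0 := by
    intro k
    induction k with
    | zero => intro _; simpa using h.1
    | succ k ih =>
      intro hk
      rw [diagPt_succ, ← add_assoc]
      refine zero_on_cube (hG.mono fun i => ?_) univ (ih (by omega))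
        (fun s _ => h.2 k (by omega) s) univ subset_rfl
      simp only [Pi.add_apply, diagPt]
      omega
  refine ⟨h1, fun k hk s => ?_⟩
  rcases hk.lt_or_eq with hk | rfl
  · exact h.2 k hk s
  · refine (hG n fun i => ?_).rect_top s h1 fun j hj => h.2 j hj s
    omega

lemma InitZero.cube {n : Fin M → ℤ} (hG : RulesNear N F (N + 1) n) (h : InitZero N F n) {k : ℕ}
    (hk : k ≤ N) (S : Finset (Fin M)) : F (n + diagPt M k + indPt S) = 0 := by
  obtain ⟨h1, h2⟩ := h.extend hG
  refine zero_on_cube (hG.mono fun i => ?_) univ (h1 k hk) (fun s _ => h2 k hk s) S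
    (subset_univ S)
  simp only [Pi.add_apply, diagPt]
  omega

lemma InitZero.forward {n : Fin M → ℤ} (hG : RulesNear N F (N + 2) n) (h : InitZero N F n)
    (r : Fin M) : InitZero N F (n + Pi.single r 1) := by
  have hG' : RulesNear N F (N + 1) n := hG.mono fun i => by omega
  obtain ⟨h1, h2⟩ := h.extend hG'
  have hpair : ∀ k ≤ N, ∀ s, s ≠ r → F (n + diagPt M k + Pi.single r 1 + Pi.single s 1) = 0 := by
    intro k hk s hs
    have := h.cube hG' hk {r, s}
    rw [pair_comm, indPt_insert (by simpa using hs)] at this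
    have e : indPt ({r} : Finset (Fin M)) = Pi.single r 1 := by
      rw [← insert_empty_eq, indPt_insert (notMem_empty r), indPt_empty, zero_add]
    rwa [e, ← add_assoc] at this
  refine ⟨by simpa using h2 0 (Nat.zero_le _) r, fun k hk s => ?_⟩
  rw [add_right_comm n]
  by_cases hs : s = r
  · subst hs
    -- The double step 2 e_r lies in no cube already known to vanish. It is an edge of the cube at n
    -- + (k,…,k) + e_r, whose opposite vertex is a neighbour of the next diagonal point; this uses
    -- the extension to k = N.
    refine zero_of_zero_diag (hG.mono fun i => ?_) s (h2 k hk.le s) (hpair k hk.le) ?_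
    · have := single_bounds s i
      simp only [Pi.add_apply, diagPt]
      omega
    · rw [add_right_comm, add_assoc n, ← diagPt_succ]
      exact h2 (k + 1) hk s
  · exact hpair k hk.le s hs

lemma InitZero.backward {n : Fin M → ℤ} (hG : RulesNear N F (N + 3) n) (r : Fin M)
    (h : InitZero N F (n + Pi.single r 1)) : InitZero N F n := by
  have hGr : RulesNear N F (N + 2) (n + Pi.single r 1) := hG.add_single r
  have hGr' : RulesNear N F (N + 1) (n + Pi.single r 1) := hGr.mono fun i => by omega
  obtain ⟨h1, h2⟩ := h.extend hGr'
  have hdiag : ∀ (x : Fin M → ℤ) (k : ℕ), x + diagPt M (k + 1) =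
      x + Pi.single r 1 + diagPt M k + indPt (univ.erase r) := by
    intro x k
    rw [diagPt_succ, indPt_eq_erase_add (mem_univ r)]
    abel
  have f1 : ∀ k ≤ N, F (n + diagPt M (k + 1)) = 0 := fun k hk => by
    rw [hdiag]; exact h.cube hGr' hk _
  have f2 : ∀ s, s ≠ r → ∀ k ≤ N, F (n + diagPt M (k + 1) + Pi.single s 1) = 0 := by
    intro s _ k hk
    have h3 := h.forward hGr s
    have hGs : RulesNear N F (N + 1) (n + Pi.single r 1 + Pi.single s 1) := hGr.add_single s
    rw [add_right_comm, hdiag, add_right_comm n]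
    exact h3.cube hGs hk _
  have f3 : ∀ k ≤ N, F (n + diagPt M k + Pi.single r 1) = 0 := fun k hk => by
    rw [add_right_comm]; exact h1 k hk
  have hrules : ZeroRules N F n := hG n fun i => by omega
  -- All other points of the rectangle in direction r are reached forwards from n + e_r, so the
  -- bottom rule gives the value at n itself.
  have f0 : F n = 0 := hrules.rect_bot r (fun k hk1 hk2 => by
    obtain ⟨k, rfl⟩ := Nat.exists_eq_add_of_le' hk1
    exact f1 k (by omega)) f3
  refine ⟨f0, fun k hk s => ?_⟩
  by_cases hs : s = r
  · subst hs; exact f3 k hk.le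
  · cases k with
    | zero =>
      rw [diagPt_zero, add_zero]
      have h4 := h2 0 (Nat.zero_le _) s
      have h5 := f3 0 (Nat.zero_le _)
      rw [diagPt_zero, add_zero] at h4 h5
      exact hrules.square_side s r hs f0 h5 h4
    | succ k => exact f2 s hs k (by omega)

lemma initZero_add_single_iff {n : Fin M → ℤ} (hG : RulesNear N F (N + 3) n) (r : Fin M) :
    InitZero N F n ↔ InitZero N F (n + Pi.single r 1) :=
  ⟨fun h => h.forward (hG.mono fun i => by omega) r, InitZero.backward hG r⟩

end LocalPropagation

/-! ### Solutions on an orbit are determined by finitely many values -/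

section Orbit

variable {N M : ℕ} {τ : ℂ} {a : Fin N → ℂ} {b : Fin M → ℂ} {c : Fin N → ℂ} {L : ℕ}
  {D : Set (Fin M → ℂ)} {f : (Fin M → ℂ) → ℂ} {z : Fin M → ℂ}

lemma shiftPt_latticePt (s : Fin M) (n : Fin M → ℤ) :
    shiftPt τ s (latticePt τ z n) = latticePt τ z (n + Pi.single s 1) := by
  ext i
  by_cases h : i = s
  · subst h
    simp [shiftPt, latticePt]
    ring
  · simp [shiftPt, latticePt, h]

lemma shiftAllPt_latticePt (k : ℕ) (n : Fin M → ℤ) :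
    (shiftAllPt τ)^[k] (latticePt τ z n) = latticePt τ z (n + diagPt M k) := by
  rw [shiftAllPt_iterate]
  ext i
  simp [latticePt, diagPt]
  ring

lemma IsSolutionOn.lattice_eq_two (hf : IsSolutionOn τ a b c D f) {r s : Fin M} (hrs : r ≠ s)
    {n : Fin M → ℤ} (h0 : latticePt τ z n ∈ D) (hr : latticePt τ z (n + Pi.single r 1) ∈ D)
    (hs : latticePt τ z (n + Pi.single s 1) ∈ D)
    (hrs' : latticePt τ z (n + Pi.single s 1 + Pi.single r 1) ∈ D) :
    Complex.exp (latticePt τ z n r) * (f (latticePt τ z n) - f (latticePt τ z (n + Pi.single s 1)) -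
      b r * (f (latticePt τ z (n + Pi.single r 1)) -
        f (latticePt τ z (n + Pi.single s 1 + Pi.single r 1)))) =
    Complex.exp (latticePt τ z n s) * (f (latticePt τ z n) - f (latticePt τ z (n + Pi.single r 1)) -
      b s * (f (latticePt τ z (n + Pi.single s 1)) -
        f (latticePt τ z (n + Pi.single s 1 + Pi.single r 1)))) := by
  have := ((isSolutionOn_iff τ a b c D f).mp hf).2 r s hrs (latticePt τ z n) h0
    (by rwa [shiftPt_latticePt]) (by rwa [shiftPt_latticePt])
    (by rwa [shiftPt_latticePt, shiftPt_latticePt])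
  simpa only [EqTwoAt, shiftPt_latticePt] using this

lemma IsSolutionOn.lattice_eq_one (hf : IsSolutionOn τ a b c D f) {s : Fin M} {n : Fin M → ℤ}
    (h0 : ∀ k ≤ N, latticePt τ z (n + diagPt M k) ∈ D)
    (h1 : ∀ k ≤ N, latticePt τ z (n + diagPt M k + Pi.single s 1) ∈ D) :
    Complex.exp (latticePt τ z n s) * ∑ k ∈ range (N + 1), (oneSubPoly a).coeff k *
      (f (latticePt τ z (n + diagPt M k)) -
        b s * f (latticePt τ z (n + diagPt M k + Pi.single s 1))) =
    ∑ k ∈ range (N + 1), (oneSubPoly fun j => c j * (Complex.exp τ)⁻¹).coeff k *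
      (f (latticePt τ z (n + diagPt M k)) - f (latticePt τ z (n + diagPt M k + Pi.single s 1))) := by
  have := ((isSolutionOn_iff τ a b c D f).mp hf).1 s (latticePt τ z n) fun k hk => by
    rw [shiftPt_latticePt, shiftAllPt_latticePt, shiftAllPt_latticePt, add_right_comm]
    exact ⟨h0 k hk, h1 k hk⟩
  simpa only [EqOneAt, shiftPt_latticePt, shiftAllPt_latticePt, add_right_comm n] using this

/-- Solving the second equation for the value at n + e_r divides by t_r b_r - t_s. -/
lemma IsSolutionOn.square_side (hf : IsSolutionOn τ a b c D f) {r s : Fin M} (hrs : r ≠ s)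
    {n : Fin M → ℤ} (h0 : latticePt τ z n ∈ D) (hr : latticePt τ z (n + Pi.single r 1) ∈ D)
    (hs : latticePt τ z (n + Pi.single s 1) ∈ D)
    (hrs' : latticePt τ z (n + Pi.single s 1 + Pi.single r 1) ∈ D)
    (hne : Complex.exp (latticePt τ z n r) * b r ≠ Complex.exp (latticePt τ z n s))
    (e0 : f (latticePt τ z n) = 0) (es : f (latticePt τ z (n + Pi.single s 1)) = 0)
    (ers : f (latticePt τ z (n + Pi.single s 1 + Pi.single r 1)) = 0) :
    f (latticePt τ z (n + Pi.single r 1)) = 0 := by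
  have h := hf.lattice_eq_two hrs h0 hr hs hrs'
  rw [e0, es, ers] at h
  refine (mul_eq_zero.mp ?_).resolve_left (sub_ne_zero.mpr hne)
  linear_combination -h

lemma IsSolutionOn.square_top (hf : IsSolutionOn τ a b c D f) {r s : Fin M} (hrs : r ≠ s)
    {n : Fin M → ℤ} (h0 : latticePt τ z n ∈ D) (hr : latticePt τ z (n + Pi.single r 1) ∈ D)
    (hs : latticePt τ z (n + Pi.single s 1) ∈ D)
    (hrs' : latticePt τ z (n + Pi.single s 1 + Pi.single r 1) ∈ D)
    (hne : Complex.exp (latticePt τ z n r) * b r ≠ Complex.exp (latticePt τ z n s) * b s)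
    (e0 : f (latticePt τ z n) = 0) (er : f (latticePt τ z (n + Pi.single r 1)) = 0)
    (es : f (latticePt τ z (n + Pi.single s 1)) = 0) :
    f (latticePt τ z (n + Pi.single s 1 + Pi.single r 1)) = 0 := by
  have h := hf.lattice_eq_two hrs h0 hr hs hrs'
  rw [e0, es, er] at h
  refine (mul_eq_zero.mp ?_).resolve_left (sub_ne_zero.mpr hne)
  linear_combination h

/-- Only the leading coefficients of the two polynomials in T survive, and these are the two
products in `hne`. -/
lemma IsSolutionOn.rect_top (hf : IsSolutionOn τ a b c D f) {s : Fin M} {n : Fin M → ℤ}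
    (h0 : ∀ k ≤ N, latticePt τ z (n + diagPt M k) ∈ D)
    (h1 : ∀ k ≤ N, latticePt τ z (n + diagPt M k + Pi.single s 1) ∈ D)
    (hne : Complex.exp (latticePt τ z n s) * b s * ∏ j, (-a j) ≠
      ∏ j, (-(c j * (Complex.exp τ)⁻¹)))
    (e0 : ∀ k ≤ N, f (latticePt τ z (n + diagPt M k)) = 0)
    (e1 : ∀ k < N, f (latticePt τ z (n + diagPt M k + Pi.single s 1)) = 0) :
    f (latticePt τ z (n + diagPt M N + Pi.single s 1)) = 0 := by
  have h := hf.lattice_eq_one h0 h1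
  rw [sum_range_succ, sum_range_succ, sum_eq_zero fun k hk => by
      rw [e0 k (mem_range.mp hk).le, e1 k (mem_range.mp hk)]; ring,
    sum_eq_zero fun k hk => by
      rw [e0 k (mem_range.mp hk).le, e1 k (mem_range.mp hk)]; ring, e0 N le_rfl,
    coeff_top_oneSubPoly, coeff_top_oneSubPoly] at h
  refine (mul_eq_zero.mp ?_).resolve_left (sub_ne_zero.mpr hne)
  linear_combination -h

/-- Both polynomials in T have constant term 1, so the surviving coefficient is t_s - 1. -/
lemma IsSolutionOn.rect_bot (hf : IsSolutionOn τ a b c D f) {s : Fin M} {n : Fin M → ℤ}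
    (h0 : ∀ k ≤ N, latticePt τ z (n + diagPt M k) ∈ D)
    (h1 : ∀ k ≤ N, latticePt τ z (n + diagPt M k + Pi.single s 1) ∈ D)
    (hne : Complex.exp (latticePt τ z n s) ≠ 1)
    (e0 : ∀ k, 1 ≤ k → k ≤ N → f (latticePt τ z (n + diagPt M k)) = 0)
    (e1 : ∀ k ≤ N, f (latticePt τ z (n + diagPt M k + Pi.single s 1)) = 0) :
    f (latticePt τ z n) = 0 := by
  have h := hf.lattice_eq_one h0 h1
  have hz : ∀ (x : ℕ → ℂ) (y : ℂ), ∀ k ∈ range N, x (k + 1) *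
      (f (latticePt τ z (n + diagPt M (k + 1))) -
        y * f (latticePt τ z (n + diagPt M (k + 1) + Pi.single s 1))) = 0 := fun x y k hk => by
    have hk := mem_range.mp hk
    rw [e0 (k + 1) (by omega) (by omega), e1 (k + 1) (by omega)]; ring
  have hz' := fun x => hz x 1
  simp only [one_mul] at hz'
  rw [sum_range_succ', sum_range_succ', sum_eq_zero (hz _ _), sum_eq_zero (hz' _),
    e1 0 (Nat.zero_le _), coeff_zero_oneSubPoly, coeff_zero_oneSubPoly, diagPt_zero, add_zero] at h
  refine (mul_eq_zero.mp ?_).resolve_left (sub_ne_zero.mpr hne)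
  linear_combination h

/-- The nonvanishing of the coefficients that are used in the propagation of zeros. -/
structure GenericAt (τ : ℂ) (a : Fin N → ℂ) (b : Fin M → ℂ) (c : Fin N → ℂ)
    (w : Fin M → ℂ) : Prop where
  ne_top : ∀ r s, r ≠ s → Complex.exp (w r) * b r ≠ Complex.exp (w s) * b s
  ne_side : ∀ r s, r ≠ s → Complex.exp (w r) * b r ≠ Complex.exp (w s)
  ne_rect_top : ∀ s, Complex.exp (w s) * b s * ∏ j, (-a j) ≠ ∏ j, (-(c j * (Complex.exp τ)⁻¹))
  ne_rect_bot : ∀ s, Complex.exp (w s) ≠ 1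

lemma IsSolutionOn.zeroRules (hf : IsSolutionOn τ a b c D f) (hN : 1 ≤ N) {n : Fin M → ℤ}
    (hD : ∀ p, (∀ i, n i ≤ p i ∧ p i ≤ n i + (N + 1)) → latticePt τ z p ∈ D)
    (hgen : GenericAt τ a b c (latticePt τ z n)) :
    ZeroRules N (fun p => f (latticePt τ z p)) n := by
  have h0 : latticePt τ z n ∈ D := hD _ fun i => by omega
  have h1 : ∀ r, latticePt τ z (n + Pi.single r 1) ∈ D := fun r => hD _ fun i => by
    have := single_bounds r i
    simp only [Pi.add_apply]; omega
  have h2 : ∀ r s, latticePt τ z (n + Pi.single r 1 + Pi.single s 1) ∈ D := fun r s =>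
    hD _ fun i => by
      have := single_bounds r i
      have := single_bounds s i
      simp only [Pi.add_apply]; omega
  have h3 : ∀ k ≤ N, latticePt τ z (n + diagPt M k) ∈ D := fun k hk => hD _ fun i => by
    simp only [Pi.add_apply, diagPt]; omega
  have h4 : ∀ s, ∀ k ≤ N, latticePt τ z (n + diagPt M k + Pi.single s 1) ∈ D := fun s k hk =>
    hD _ fun i => by
      have := single_bounds s i
      simp only [Pi.add_apply, diagPt]; omega
  exact
    { square_top := fun r s hrs e0 er es =>
        hf.square_top hrs.symm h0 (h1 s) (h1 r) (h2 r s) (hgen.ne_top s r hrs.symm) e0 es er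
      square_side := fun r s hrs e0 es ers =>
        hf.square_side hrs h0 (h1 r) (h1 s) (h2 s r) (hgen.ne_side r s hrs) e0 es ers
      rect_top := fun s e0 e1 => hf.rect_top h3 (h4 s) (hgen.ne_rect_top s) e0 e1
      rect_bot := fun s e0 e1 => hf.rect_bot h3 (h4 s) (hgen.ne_rect_bot s) e0 e1 }

end Orbit

/-! ### The region in homogeneous lattice coordinates -/

section Homogeneous

variable {M : ℕ}

/-- Dehomogenization of lattice points with respect to the coordinate `p`. -/
def dehom (p : Fin (M + 1)) (H : Fin (M + 1) → ℤ) : Fin M → ℤ := fun i => H (p.succAbove i) - H p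

lemma dehom_insertNth (p : Fin (M + 1)) (x : ℤ) (n : Fin M → ℤ) :
    dehom p (p.insertNth x fun i => n i + x) = n := by
  ext i; simp [dehom]

lemma dehom_add_single (p : Fin (M + 1)) (H : Fin (M + 1) → ℤ) (i : Fin M) :
    dehom p (H + Pi.single (p.succAbove i) 1) = dehom p H + Pi.single i 1 := by
  ext j
  by_cases h : j = i
  · subst h; simp [dehom, (Fin.succAbove_ne p j).symm]; ring
  · simp [dehom, h, (Fin.succAbove_ne p i).symm]

lemma dehom_movePt_succAbove (p : Fin (M + 1)) (H : Fin (M + 1) → ℤ) (i j : Fin M) (u w : ℕ) :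
    dehom p (movePt H (p.succAbove i) (p.succAbove j) u w) =
      dehom p H + Pi.single i (u : ℤ) - Pi.single j (w : ℤ) := by
  have hp : movePt H (p.succAbove i) (p.succAbove j) u w p = H p := by
    simp [movePt, (Fin.succAbove_ne p i).symm, (Fin.succAbove_ne p j).symm]
  have hs : ∀ (x : ℤ) (k l : Fin M), (Pi.single (p.succAbove k) x : Fin (M + 1) → ℤ)
      (p.succAbove l) = (Pi.single k x : Fin M → ℤ) l := by
    intro x k l
    by_cases h : l = k
    · subst h; simp
    · simp [h]
  ext k
  simp only [dehom, hp, Pi.add_apply, Pi.sub_apply]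
  simp only [movePt, Pi.add_apply, Pi.sub_apply, hs]
  ring

/-- Lowering the dummy coordinate raises all affine coordinates at once. The long rectangles in the
direction (1,…,1) thus become moves of the same type as the unit squares. -/
lemma dehom_movePt_self_right (p : Fin (M + 1)) (H : Fin (M + 1) → ℤ) (i : Fin M) (u w : ℕ) :
    dehom p (movePt H (p.succAbove i) p u w) = dehom p H + Pi.single i (u : ℤ) + diagPt M w := by
  ext k
  by_cases h : k = i
  · subst h; simp [dehom, movePt, diagPt, (Fin.succAbove_ne p k).symm]; ring
  · simp [dehom, movePt, diagPt, h, (Fin.succAbove_ne p i).symm]; ring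

lemma dehom_movePt_self_left (p : Fin (M + 1)) (H : Fin (M + 1) → ℤ) (j : Fin M) (u w : ℕ) :
    dehom p (movePt H p (p.succAbove j) u w) = dehom p H - diagPt M u - Pi.single j (w : ℤ) := by
  ext k
  by_cases h : k = j
  · subst h; simp [dehom, movePt, diagPt, (Fin.succAbove_ne p k).symm]; ring
  · simp [dehom, movePt, diagPt, h, (Fin.succAbove_ne p j).symm]; ring

lemma forall_lt_iff_succAbove (p : Fin (M + 1)) (Q : Fin (M + 1) → Fin (M + 1) → Prop) :
    (∀ a b, a < b → Q a b) ↔ (∀ i, p.succAbove i < p → Q (p.succAbove i) p) ∧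
      (∀ i, p < p.succAbove i → Q p (p.succAbove i)) ∧
      ∀ i j, i < j → Q (p.succAbove i) (p.succAbove j) := by
  constructor
  · intro h
    exact ⟨fun i => h _ _, fun i => h _ _, fun i j hij =>
      h _ _ (Fin.succAbove_lt_succAbove_iff.mpr hij)⟩
  · rintro ⟨h1, h2, h3⟩ a b hab
    rcases Fin.eq_self_or_eq_succAbove p a with rfl | ⟨i, rfl⟩
    · rcases Fin.eq_self_or_eq_succAbove a b with rfl | ⟨j, rfl⟩
      · exact absurd hab (lt_irrefl _)
      · exact h2 j hab
    · rcases Fin.eq_self_or_eq_succAbove p b with rfl | ⟨j, rfl⟩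
      · exact h1 i hab
      · exact h3 i j (Fin.succAbove_lt_succAbove_iff.mp hab)

lemma succAbove_mk_lt_iff {L : ℕ} (hL : L < M + 1) (i : Fin M) :
    (⟨L, hL⟩ : Fin (M + 1)).succAbove i < ⟨L, hL⟩ ↔ (i : ℕ) < L := by
  rw [Fin.succAbove_lt_iff_castSucc_lt]; rfl

lemma lt_succAbove_mk_iff {L : ℕ} (hL : L < M + 1) (i : Fin M) :
    (⟨L, hL⟩ : Fin (M + 1)) < (⟨L, hL⟩ : Fin (M + 1)).succAbove i ↔ L ≤ (i : ℕ) := by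
  rw [Fin.lt_succAbove_iff_le_castSucc]; rfl

lemma exists_threshold {x ρ : ℝ} (hx : 0 < x) (hρ0 : 0 < ρ) (hρ1 : ρ < 1) :
    ∃ d : ℤ, ∀ k : ℤ, x * ρ ^ k < 1 ↔ d ≤ k := by
  refine ⟨⌊Real.log x / -Real.log ρ⌋ + 1, fun k => ?_⟩
  have hl : 0 < -Real.log ρ := neg_pos.mpr (Real.log_neg hρ0 hρ1)
  rw [Int.add_one_le_iff, Int.floor_lt, div_lt_iff₀ hl, ← Real.log_neg_iff (by positivity),
    Real.log_mul hx.ne' (by positivity), Real.log_zpow]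
  constructor <;> intro h <;> linarith

variable {N : ℕ} {τ : ℂ} {a : Fin N → ℂ} {b : Fin M → ℂ} {c : Fin N → ℂ} {L : ℕ}

/-- On an orbit of the `q`-shifts the region is a polyhedron, in homogeneous coordinates. -/
lemma Admissible.exists_region_iff (h : Admissible (Complex.exp τ) a b c) (hL : L < M + 1)
    (z : Fin M → ℂ) :
    ∃ D : Fin (M + 1) → Fin (M + 1) → ℤ, ∀ H,
      latticePt τ z (dehom ⟨L, hL⟩ H) ∈ region (Complex.exp τ) a b c L 1 ↔ H ∈ polyhedron D := by
  set p : Fin (M + 1) := ⟨L, hL⟩ with hp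
  set q := Complex.exp τ with hq
  have hq0 : 0 < ‖q‖ := norm_pos_iff.mpr h.q_ne
  -- The dummy variable contributes 1 at the place p. Then A_x B_y is the constant of the inequality
  -- for the pair (x,y), up to the factor ρ that appears exactly when x = p.
  set A : Fin (M + 1) → ℝ := p.insertNth 1 fun i => ‖Complex.exp (z i)‖ with hA
  set B : Fin (M + 1) → ℝ := p.insertNth 1 fun i => ‖q / (b i * Complex.exp (z i))‖ with hB
  set ρ : ℝ := ‖∏ j, c j / a j‖ with hρ
  have hρ0 : 0 < ρ := norm_pos_iff.mpr (prod_ne_zero_iff.mpr fun j _ =>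
    div_ne_zero (h.c_ne j) (h.a_ne j))
  have hA0 : ∀ x, 0 < A x := by
    rw [Fin.forall_iff_succAbove p]
    exact ⟨by simp [hA], fun i => by simp [hA]⟩
  have hB0 : ∀ x, 0 < B x := by
    rw [Fin.forall_iff_succAbove p]
    refine ⟨by simp [hB], fun i => ?_⟩
    simp only [hB, Fin.insertNth_apply_succAbove]
    exact norm_pos_iff.mpr (div_ne_zero h.q_ne (mul_ne_zero (h.b_ne i) (Complex.exp_ne_zero _)))
  choose D hD using fun x y : Fin (M + 1) => exists_threshold
    (x := A x * B y * if x = p then ρ else 1)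
    (mul_pos (mul_pos (hA0 x) (hB0 y)) (by split_ifs <;> [exact hρ0; exact one_pos])) hq0 h.q_lt
  refine ⟨D, fun H => ?_⟩
  simp only [polyhedron, Set.mem_ofPred_eq, ← hD]
  rw [forall_lt_iff_succAbove p]
  simp only [hp, succAbove_mk_lt_iff, lt_succAbove_mk_iff]
  simp only [← hp]
  refine and_congr (forall_congr' fun i => imp_congr_right fun _ => ?_)
    (and_congr (forall_congr' fun i => imp_congr_right fun _ => ?_)
      (forall_congr' fun i => forall_congr' fun j => imp_congr_right fun _ => ?_))
  · simp only [hA, hB, Fin.insertNth_apply_succAbove, Fin.insertNth_apply_same,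
      Fin.succAbove_ne, if_false, Equiv.Perm.coe_one, id, exp_latticePt, norm_mul, norm_zpow, dehom,
      mul_one, hq]
  · simp only [hA, hB, Fin.insertNth_apply_succAbove, Fin.insertNth_apply_same,
      if_true, Equiv.Perm.coe_one, id, exp_latticePt]
    rw [← mul_assoc (b i), ← div_div, ← mul_div_assoc, div_eq_mul_inv, ← zpow_neg, norm_mul,
      norm_mul, norm_zpow, one_mul, mul_comm ρ]
    simp only [dehom, neg_sub, hq]
  · simp only [hA, hB, Fin.insertNth_apply_succAbove,
      Fin.succAbove_ne, if_false, Equiv.Perm.coe_one, id, exp_latticePt, mul_one]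
    have e : q * (Complex.exp (z i) * q ^ dehom p H i) /
        (b j * (Complex.exp (z j) * q ^ dehom p H j)) =
        Complex.exp (z i) * (q / (b j * Complex.exp (z j))) *
          q ^ (H (p.succAbove i) - H (p.succAbove j)) := by
      have : H (p.succAbove i) - H (p.succAbove j) = dehom p H i - dehom p H j := by
        simp [dehom]
      rw [this, zpow_sub₀ h.q_ne]
      ring
    rw [e, norm_mul, norm_mul, norm_zpow]

lemma exists_hom_near (p : Fin (M + 1)) {H : Fin (M + 1) → ℤ} {K : ℤ} (B : ℕ)
    (hH : ∀ x y, x < y → K + B ≤ H x - H y) {n : Fin M → ℤ}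
    (hn : ∀ i, dehom p H i ≤ n i ∧ n i ≤ dehom p H i + B) :
    ∃ H', dehom p H' = n ∧ ∀ x y, x < y → K ≤ H' x - H' y := by
  refine ⟨p.insertNth (H p) fun i => n i + H p, dehom_insertNth p _ n, ?_⟩
  rw [forall_lt_iff_succAbove p] at hH ⊢
  simp only [Fin.insertNth_apply_succAbove, Fin.insertNth_apply_same]
  simp only [dehom] at hn
  refine ⟨fun i hi => ?_, fun i hi => ?_, fun i j hij => ?_⟩
  · have := hH.1 i hi
    have := hn i
    omega
  · have := hH.2.1 i hi
    have := hn i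
    omega
  · have := hH.2.2 i j hij
    have := hn i
    have := hn j
    omega

/-- The powers of q are pairwise distinct, so at most one exponent is bad. -/
lemma Admissible.exists_zpow_bound (h : Admissible (Complex.exp τ) a b c) (x : ℂ) :
    ∃ K : ℕ, ∀ k : ℤ, (K : ℤ) ≤ |k| → x * Complex.exp τ ^ k ≠ 1 := by
  by_cases h0 : ∃ k₀ : ℤ, x * Complex.exp τ ^ k₀ = 1
  · obtain ⟨k₀, hk₀⟩ := h0
    refine ⟨k₀.natAbs + 1, fun k hk hk1 => ?_⟩
    have hne : k - k₀ ≠ 0 := fun hkk => by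
      have : k = k₀ := by omega
      rw [this, Int.abs_eq_natAbs] at hk
      omega
    refine h.zpow_ne_one hne ?_
    rw [zpow_sub₀ h.q_ne, div_eq_one_iff_eq (zpow_ne_zero _ h.q_ne)]
    exact mul_left_cancel₀ (left_ne_zero_of_mul_eq_one hk₀) (hk1.trans hk₀.symm)
  · push Not at h0
    exact ⟨0, fun k _ => h0 k⟩

lemma exists_uniform_bound {ι : Type*} [Finite ι] (K : ι → ℕ) : ∃ B, ∀ i, K i ≤ B := by
  obtain ⟨B, hB⟩ := (Set.finite_range K).bddAbove
  exact ⟨B, fun i => hB ⟨i, rfl⟩⟩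

/-- Every condition in `GenericAt` has the form x q^k ≠ 1 with x fixed on the orbit and k a
difference of two homogeneous coordinates; large differences avoid the finitely many bad exponents.
-/
lemma Admissible.exists_generic (h : Admissible (Complex.exp τ) a b c) (p : Fin (M + 1))
    (z : Fin M → ℂ) :
    ∃ K : ℕ, ∀ H : Fin (M + 1) → ℤ, (∀ x y, x < y → (K : ℤ) ≤ H x - H y) →
      GenericAt τ a b c (latticePt τ z (dehom p H)) := by
  have hC : ∏ j, (-(c j * (Complex.exp τ)⁻¹)) ≠ 0 := prod_ne_zero_iff.mpr fun j _ =>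
    neg_ne_zero.mpr (mul_ne_zero (h.c_ne j) (inv_ne_zero h.q_ne))
  choose K₁ hK₁ using fun x : Fin M × Fin M => h.exists_zpow_bound
    (Complex.exp (z x.1) * b x.1 / (Complex.exp (z x.2) * b x.2))
  choose K₂ hK₂ using fun x : Fin M × Fin M => h.exists_zpow_bound
    (Complex.exp (z x.1) * b x.1 / Complex.exp (z x.2))
  choose K₃ hK₃ using fun s : Fin M => h.exists_zpow_bound
    (Complex.exp (z s) * b s * (∏ j, (-a j)) / ∏ j, (-(c j * (Complex.exp τ)⁻¹)))
  choose K₄ hK₄ using fun s : Fin M => h.exists_zpow_bound (Complex.exp (z s))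
  obtain ⟨B₁, hB₁⟩ := exists_uniform_bound K₁
  obtain ⟨B₂, hB₂⟩ := exists_uniform_bound K₂
  obtain ⟨B₃, hB₃⟩ := exists_uniform_bound K₃
  obtain ⟨B₄, hB₄⟩ := exists_uniform_bound K₄
  refine ⟨B₁ + B₂ + B₃ + B₄, fun H hH => ?_⟩
  have habs : ∀ x y, x ≠ y → ((B₁ + B₂ + B₃ + B₄ : ℕ) : ℤ) ≤ |H x - H y| := fun x y hxy => by
    rcases lt_or_gt_of_ne hxy with h | h
    · exact (hH x y h).trans (le_abs_self _)
    · rw [abs_sub_comm]; exact (hH y x h).trans (le_abs_self _)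
  have hpair : ∀ r s, r ≠ s → ((B₁ + B₂ + B₃ + B₄ : ℕ) : ℤ) ≤ |dehom p H r - dehom p H s| :=
    fun r s hrs => by
      have := habs (p.succAbove r) (p.succAbove s) (by simpa using hrs)
      simpa [dehom] using this
  have hone : ∀ s, ((B₁ + B₂ + B₃ + B₄ : ℕ) : ℤ) ≤ |dehom p H s| := fun s =>
    habs _ _ (Fin.succAbove_ne p s)
  constructor
  · intro r s hrs heq
    have hb := h.b_ne s
    have hz := Complex.exp_ne_zero (z s)
    have hqs := zpow_ne_zero (dehom p H s) h.q_ne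
    refine hK₁ (r, s) (dehom p H r - dehom p H s) ?_ ?_
    · have := hpair r s hrs; have := hB₁ (r, s); omega
    · rw [exp_latticePt, exp_latticePt] at heq
      dsimp only
      rw [zpow_sub₀ h.q_ne]
      field_simp
      linear_combination heq
  · intro r s hrs heq
    have hz := Complex.exp_ne_zero (z s)
    have hqs := zpow_ne_zero (dehom p H s) h.q_ne
    refine hK₂ (r, s) (dehom p H r - dehom p H s) ?_ ?_
    · have := hpair r s hrs; have := hB₂ (r, s); omega
    · rw [exp_latticePt, exp_latticePt] at heq
      dsimp only
      rw [zpow_sub₀ h.q_ne]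
      field_simp
      linear_combination heq
  · intro s heq
    refine hK₃ s (dehom p H s) ?_ ?_
    · have := hone s; have := hB₃ s; omega
    · rw [exp_latticePt] at heq
      rw [div_mul_eq_mul_div, div_eq_one_iff_eq hC]
      linear_combination heq
  · intro s heq
    refine hK₄ s (dehom p H s) ?_ ?_
    · have := hone s; have := hB₄ s; omega
    · rwa [exp_latticePt] at heq

end Homogeneous

/-! ### Propagation from the deep part to the whole region -/

section Uniqueness

variable {N M : ℕ} {τ : ℂ} {a : Fin N → ℂ} {b : Fin M → ℂ} {c : Fin N → ℂ} {L : ℕ}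
  {f : (Fin M → ℂ) → ℂ} {z : Fin M → ℂ}

/-- The square rule based at n - e_j applies: its coefficient vanishes only if q t_i/(b_j t_j) = 1,
which the ratio inequality of the region forbids. -/
lemma IsSolutionOn.corner_side (h : Admissible (Complex.exp τ) a b c)
    (hf : IsSolutionOn τ a b c (region (Complex.exp τ) a b c L 1) f) {i j : Fin M} (hij : i < j)
    {n : Fin M → ℤ}
    (hD : ∀ u : ℕ, u ≤ 1 → ∀ w : ℕ, w ≤ 1 → latticePt τ z (n + Pi.single i (u : ℤ) - Pi.single j (w : ℤ)) ∈
      region (Complex.exp τ) a b c L 1)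
    (hz : ∀ u : ℕ, u ≤ 1 → ∀ w : ℕ, w ≤ 1 → u ≠ 0 ∨ w ≠ 0 →
      f (latticePt τ z (n + Pi.single i (u : ℤ) - Pi.single j (w : ℤ))) = 0) :
    f (latticePt τ z n) = 0 := by
  have D00 := hD 0 (by simp) 0 (by simp)
  have D01 := hD 0 (by simp) 1 (by simp)
  have D10 := hD 1 (by simp) 0 (by simp)
  have D11 := hD 1 (by simp) 1 (by simp)
  have z01 := hz 0 (by simp) 1 (by simp) (by simp)
  have z10 := hz 1 (by simp) 0 (by simp) (by simp)
  have z11 := hz 1 (by simp) 1 (by simp) (by simp)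
  simp only [Nat.cast_zero, Nat.cast_one, Pi.single_zero, add_zero, sub_zero] at *
  have e0 : n - Pi.single j 1 + Pi.single j 1 = n := by abel
  have e1 : n - Pi.single j 1 + Pi.single i 1 = n + Pi.single i 1 - Pi.single j 1 := by abel
  have e2 : n - Pi.single j 1 + Pi.single i 1 + Pi.single j 1 = n + Pi.single i 1 := by abel
  have key := hf.square_side (z := z) (r := j) (s := i) hij.ne' (n := n - Pi.single j 1) D01
    (by rwa [e0]) (by rwa [e1]) (by rwa [e2]) ?_ z01 (by rwa [e1]) (by rwa [e2])
  · rwa [e0] at key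
  · intro heq
    have hlt := D00.2.2 i j hij
    simp only [Equiv.Perm.coe_one, id] at hlt
    refine hlt.ne ?_
    rw [exp_latticePt, exp_latticePt, Pi.sub_apply, Pi.sub_apply, Pi.single_eq_same,
      Pi.single_eq_of_ne hij.ne, sub_zero, zpow_sub₀ h.q_ne, zpow_one] at heq
    rw [exp_latticePt, exp_latticePt]
    have h1 := h.q_ne
    have h2 := h.b_ne j
    have h3 := zpow_ne_zero (n j) h.q_ne
    have h4 := Complex.exp_ne_zero (z j)
    rw [← heq]
    rw [show Complex.exp τ * (Complex.exp (z j) * (Complex.exp τ ^ n j / Complex.exp τ) * b j) =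
      b j * (Complex.exp (z j) * Complex.exp τ ^ n j) by field_simp,
      div_self (mul_ne_zero h2 (mul_ne_zero h4 h3)), norm_one]

/-- Here the coefficient t_i - 1 is nonzero because |t_i| < 1 in the region. -/
lemma IsSolutionOn.corner_bot
    (hf : IsSolutionOn τ a b c (region (Complex.exp τ) a b c L 1) f) {i : Fin M} (hi : (i : ℕ) < L)
    {n : Fin M → ℤ} (hN : 1 ≤ N)
    (hD : ∀ u ≤ N, ∀ w ≤ N, latticePt τ z (n + Pi.single i (u : ℤ) + diagPt M w) ∈
      region (Complex.exp τ) a b c L 1)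
    (hz : ∀ u ≤ N, ∀ w ≤ N, u ≠ 0 ∨ w ≠ 0 →
      f (latticePt τ z (n + Pi.single i (u : ℤ) + diagPt M w)) = 0) :
    f (latticePt τ z n) = 0 := by
  refine hf.rect_bot (s := i) (fun k hk => ?_) (fun k hk => ?_) ?_ (fun k hk0 hk => ?_)
    fun k hk => ?_
  · simpa using hD 0 (by simp) k hk
  · rw [add_right_comm]; simpa using hD 1 hN k hk
  · have := (hD 0 (by simp) 0 (by simp)).1 i hi
    simp only [Equiv.Perm.coe_one, id, Nat.cast_zero, Pi.single_zero, add_zero, diagPt_zero] at this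
    intro heq
    rw [heq, norm_one] at this
    exact lt_irrefl _ this
  · simpa using hz 0 (by simp) k hk (by omega)
  · rw [add_right_comm]; simpa using hz 1 hN k hk (by simp)

/-- The value at n is the far corner of the rectangle based at n - (N,…,N) - e_j. Its coefficient
vanishes only if ∏ (c/a) q/(b_j t_j) = 1, which the inequality for the large variables forbids. -/
lemma IsSolutionOn.corner_top (h : Admissible (Complex.exp τ) a b c)
    (hf : IsSolutionOn τ a b c (region (Complex.exp τ) a b c L 1) f) {j : Fin M} (hj : L ≤ (j : ℕ))
    {n : Fin M → ℤ} (hN : 1 ≤ N)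
    (hD : ∀ u ≤ N, ∀ w ≤ N, latticePt τ z (n - diagPt M u - Pi.single j (w : ℤ)) ∈
      region (Complex.exp τ) a b c L 1)
    (hz : ∀ u ≤ N, ∀ w ≤ N, u ≠ 0 ∨ w ≠ 0 →
      f (latticePt τ z (n - diagPt M u - Pi.single j (w : ℤ))) = 0) :
    f (latticePt τ z n) = 0 := by
  have e0 : ∀ k ≤ N, n - diagPt M N - Pi.single j 1 + diagPt M k =
      n - diagPt M (N - k) - Pi.single j ((1 : ℕ) : ℤ) := fun k hk => by
    ext i
    simp only [diagPt, Pi.add_apply, Pi.sub_apply, Nat.cast_one, Nat.cast_sub hk]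
    ring
  have e1 : ∀ k ≤ N, n - diagPt M N - Pi.single j 1 + diagPt M k + Pi.single j 1 =
      n - diagPt M (N - k) - Pi.single j ((0 : ℕ) : ℤ) := fun k hk => by
    rw [e0 k hk]; simp
  have key := hf.rect_top (z := z) (s := j) (n := n - diagPt M N - Pi.single j 1)
    (fun k hk => by rw [e0 k hk]; exact hD _ (by omega) 1 hN)
    (fun k hk => by rw [e1 k hk]; exact hD _ (by omega) 0 (by simp)) ?_
    (fun k hk => by rw [e0 k hk]; exact hz _ (by omega) 1 hN (by simp))
    (fun k hk => by rw [e1 k hk.le]; exact hz _ (by omega) 0 (by simp) (by omega))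
  · rw [e1 N le_rfl] at key
    simpa using key
  · intro heq
    have hlt := (hD 0 (by simp) 0 (by simp)).2.1 j hj
    simp only [Equiv.Perm.coe_one, id, Nat.cast_zero, Pi.single_zero, sub_zero, diagPt_zero] at hlt
    refine hlt.ne ?_
    have hA : ∏ j, a j ≠ 0 := prod_ne_zero_iff.mpr fun j _ => h.a_ne j
    have h1 := h.q_ne
    have h2 := h.b_ne j
    have h3 := zpow_ne_zero (n j) h.q_ne
    have h4 := Complex.exp_ne_zero (z j)
    have h5 : ((-1 : ℂ)) ^ N ≠ 0 := pow_ne_zero _ (by norm_num)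
    have hneg : ∀ x : Fin N → ℂ, ∏ j, (-x j) = (-1) ^ N * ∏ j, x j := fun x => by
      rw [prod_neg, card_univ, Fintype.card_fin]
    rw [exp_latticePt, Pi.sub_apply, Pi.sub_apply, Pi.single_eq_same, diagPt,
      zpow_sub₀ h.q_ne, zpow_sub₀ h.q_ne, zpow_natCast, zpow_one, hneg, hneg, prod_mul_distrib,
      prod_const, card_univ, Fintype.card_fin, inv_pow] at heq
    rw [exp_latticePt, prod_div_distrib]
    have h6 := pow_ne_zero N h.q_ne
    have h7 : ∏ j, c j = Complex.exp (z j) * Complex.exp τ ^ n j / Complex.exp τ * b j *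
        ∏ j, a j := by
      have h8 := mul_left_cancel₀ h5 ((by linear_combination heq :
        (-1 : ℂ) ^ N * (Complex.exp (z j) * (Complex.exp τ ^ n j / Complex.exp τ ^ N /
          Complex.exp τ) * b j * ∏ j, a j) =
        (-1 : ℂ) ^ N * ((∏ j, c j) * (Complex.exp τ ^ N)⁻¹)))
      field_simp at h8 ⊢
      linear_combination -h8
    rw [h7, ← norm_one (α := ℂ)]
    congr 1
    field_simp

/-- A solution is determined, on an orbit of the `q`-shifts, by `N M + 1` of its values. -/
theorem exists_initZero_determines (h : Admissible (Complex.exp τ) a b c) (hN : 1 ≤ N) (hL : L ≤ M)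
    (z : Fin M → ℂ) :
    ∃ n₀ : Fin M → ℤ,
      ∀ f, IsSolutionOn τ a b c (region (Complex.exp τ) a b c L 1) f →
      InitZero N (fun n => f (latticePt τ z n)) n₀ →
      ∀ n, latticePt τ z n ∈ region (Complex.exp τ) a b c L 1 → f (latticePt τ z n) = 0 := by
  have hL' : L < M + 1 := by omega
  set p : Fin (M + 1) := ⟨L, hL'⟩ with hp
  obtain ⟨D, hD⟩ := h.exists_region_iff hL' z
  obtain ⟨K₀, hK₀⟩ := h.exists_generic p z
  obtain ⟨B, hB⟩ := exists_uniform_bound fun x : Fin (M + 1) × Fin (M + 1) => (D x.1 x.2).toNat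
  have hDB : ∀ x y, D x y ≤ B := fun x y => by
    have := hB (x, y)
    dsimp only at this
    omega
  -- The margin 2N + 4 is N + 3 for the cube of base points needed by a unit step, plus N + 1 for
  -- the reach of a rectangle from its base point.
  set K : ℤ := (K₀ : ℤ) + B + (2 * N + 4 : ℕ) with hK
  -- R is affine in y - x so that R x y + R y w + N = R x w, the superadditivity required by
  -- `eq_zero_of_deep`, while R x y ≥ K for x < y.
  set R : Fin (M + 1) → Fin (M + 1) → ℤ := fun x y => ((y : ℤ) - x) * (K + N) - N with hR
  have hKR : ∀ x y, x < y → K ≤ R x y := fun x y hxy => by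
    have h1 : (1 : ℤ) ≤ (y : ℤ) - x := by
      have := Fin.lt_def.mp hxy
      omega
    have h2 : 0 ≤ K + N := by omega
    simp only [hR]
    nlinarith
  have hmem : ∀ H ∈ polyhedron R, ∀ n : Fin M → ℤ,
      (∀ i, dehom p H i ≤ n i ∧ n i ≤ dehom p H i + (2 * N + 4 : ℕ)) →
      latticePt τ z n ∈ region (Complex.exp τ) a b c L 1 ∧ GenericAt τ a b c (latticePt τ z n) := by
    intro H hH n hn
    obtain ⟨H', rfl, hH'⟩ := exists_hom_near p (H := H) (K := K₀ + B) (2 * N + 4)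
      (fun x y hxy => (hKR x y hxy).trans (hH x y hxy)) hn
    exact ⟨(hD H').mpr fun x y hxy => by have := hH' x y hxy; have := hDB x y; omega,
      hK₀ H' fun x y hxy => by have := hH' x y hxy; omega⟩
  set H₀ : Fin (M + 1) → ℤ := fun x => (K + N) * ((L : ℤ) - x) with hH₀
  have hH₀R : H₀ ∈ polyhedron R := fun x y _ => by
    have : R x y + N = H₀ x - H₀ y := by simp only [hR, hH₀]; ring
    omega
  have hH₀p : H₀ p = 0 := by simp [hH₀, hp]
  refine ⟨dehom p H₀, fun f hf hinit n hn => ?_⟩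
  set F : (Fin M → ℤ) → ℂ := fun n => f (latticePt τ z n) with hF
  have hnear : ∀ H ∈ polyhedron R, RulesNear N F (N + 3) (dehom p H) := fun H hH x hx =>
    hf.zeroRules hN (fun y hy => (hmem H hH y fun i => by
      have := hx i; have := hy i; omega).1) (hmem H hH x fun i => by have := hx i; omega).2
  have hdeep : ∀ H ∈ polyhedron R, F (dehom p H) = 0 := by
    intro H hH
    -- Translation by a constant changes neither the polyhedron condition nor the affine point, so
    -- the dummy coordinate can be normalized to 0 and kept fixed along the path.
    have hH' : (fun x => H x - H p) ∈ polyhedron R := fun x y hxy => by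
      have := hH x y hxy
      dsimp only
      omega
    have hY := polyhedron_connected R p (fun H => InitZero N F (dehom p H)) (fun r hr P hP _ => by
      obtain ⟨i, rfl⟩ := Fin.exists_succAbove_eq hr
      rw [dehom_add_single]
      exact initZero_add_single_iff (hnear P hP) i) hH₀R hH' (by simp [hH₀p]) hinit
    have := hY.1
    have e : dehom p (fun x => H x - H p) = dehom p H := by ext i; simp [dehom]
    rwa [e] at this
  have main := eq_zero_of_deep N D R (fun H => F (dehom p H))
    (fun x y hxy => by have := hKR x y hxy; have := hDB x y; omega)
    (fun x y w _ _ => by simp only [hR]; apply le_of_eq; ring) ?_ hdeep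
  · obtain ⟨H, rfl⟩ : ∃ H, dehom p H = n := ⟨_, dehom_insertNth p 0 n⟩
    exact main H ((hD H).mp hn)
  · simp only [hF]
    simp only [← hD]
    rw [forall_lt_iff_succAbove p]
    refine ⟨fun i hi P hP hz => ?_, fun j hj P hP hz => ?_, fun i j hij P hP hz => ?_⟩
    · simp only [← hp, dehom_movePt_self_right] at hP hz
      exact hf.corner_bot ((succAbove_mk_lt_iff hL' i).mp hi) hN hP hz
    · simp only [← hp, dehom_movePt_self_left] at hP hz
      exact hf.corner_top h ((lt_succAbove_mk_iff hL' j).mp hj) hN hP hz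
    · simp only [← hp, dehom_movePt_succAbove] at hP hz
      exact hf.corner_side h hij (fun u hu w hw => hP u (hu.trans hN) w (hw.trans hN))
        fun u hu w hw => hz u (hu.trans hN) w (hw.trans hN)

end Uniqueness

/-! ### Fundamental solutions -/

section Fundamental

variable {N M : ℕ} {τ : ℂ}

/-- The solutions in `D` form a complex vector space. -/
def solutionSpace (τ : ℂ) (a : Fin N → ℂ) (b : Fin M → ℂ) (c : Fin N → ℂ)
    (D : Set (Fin M → ℂ)) : Submodule ℂ ((Fin M → ℂ) → ℂ) where
  carrier := {f | IsSolutionOn τ a b c D f}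
  zero_mem' := ⟨fun s z _ => by simp, fun r s _ z _ _ _ _ => by simp⟩
  add_mem' {f g} hf hg := by
    refine ⟨fun s z hz => ?_, fun r s hrs z h0 hr hs hrs' => ?_⟩
    · have h1 := hf.eq_one s z hz
      have h2 := hg.eq_one s z hz
      rw [map_add, map_add, Pi.add_apply, Pi.add_apply]
      linear_combination h1 + h2
    · have h1 := hf.eq_two r s hrs z h0 hr hs hrs'
      have h2 := hg.eq_two r s hrs z h0 hr hs hrs'
      rw [map_add, map_add, Pi.add_apply, Pi.add_apply]
      linear_combination h1 + h2
  smul_mem' x f hf := by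
    refine ⟨fun s z hz => ?_, fun r s hrs z h0 hr hs hrs' => ?_⟩
    · have h1 := hf.eq_one s z hz
      rw [map_smul, map_smul, Pi.smul_apply, Pi.smul_apply, smul_eq_mul, smul_eq_mul]
      linear_combination x * h1
    · have h1 := hf.eq_two r s hrs z h0 hr hs hrs'
      rw [map_smul, map_smul, Pi.smul_apply, Pi.smul_apply, smul_eq_mul, smul_eq_mul]
      linear_combination x * h1

lemma mem_solutionSpace {a : Fin N → ℂ} {b : Fin M → ℂ} {c : Fin N → ℂ} {D : Set (Fin M → ℂ)}
    {f : (Fin M → ℂ) → ℂ} : f ∈ solutionSpace τ a b c D ↔ IsSolutionOn τ a b c D f := Iff.rfl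

lemma latticePt_zero (z : Fin M → ℂ) : latticePt τ z 0 = z := by ext; simp [latticePt]

lemma latticePt_latticePt (z : Fin M → ℂ) (n n' : Fin M → ℤ) :
    latticePt τ (latticePt τ z n) n' = latticePt τ z (n + n') := by
  ext; simp [latticePt]; ring

lemma shiftPt_eq_latticePt (s : Fin M) (z : Fin M → ℂ) :
    shiftPt τ s z = latticePt τ z (Pi.single s 1) := by
  have := shiftPt_latticePt (τ := τ) (z := z) s 0
  rwa [latticePt_zero, zero_add] at this

lemma IsPseudoConstant.latticePt {C : (Fin M → ℂ) → ℂ} (hC : IsPseudoConstant τ C)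
    (z : Fin M → ℂ) (n : Fin M → ℤ) : C (latticePt τ z n) = C z := by
  let S : AddSubgroup (Fin M → ℤ) :=
    { carrier := {n | ∀ z, C (QHyp.latticePt τ z n) = C z}
      zero_mem' := fun z => by rw [latticePt_zero]
      add_mem' := fun {n n'} hn hn' z => by rw [← latticePt_latticePt, hn', hn]
      neg_mem' := fun {n} hn z => by
        rw [← hn, latticePt_latticePt, neg_add_cancel, latticePt_zero] }
  have hS : ∀ s, Pi.single s 1 ∈ S := fun s z => by
    rw [← shiftPt_eq_latticePt]
    exact congrFun (hC s) z
  have h : n ∈ S := by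
    have e : n = ∑ s, n s • Pi.single s (1 : ℤ) := by
      ext i
      simp [Finset.sum_apply, Pi.single_apply]
    rw [e]
    exact S.sum_mem fun s _ => S.zsmul_mem (hS s) _
  exact h z

variable {α : Fin N → ℂ} {β : Fin M → ℂ} {γ : Fin N → ℂ} {L : ℕ}

/-- On an orbit of the `q`-shifts, a solution is a linear combination of the components of `u`. -/
theorem exists_eq_sum_u_one (h : Admissible (Complex.exp τ) (qPow τ α) (qPow τ β) (qPow τ γ))
    (hN : 1 ≤ N) (hL : L ≤ M) {f : (Fin M → ℂ) → ℂ}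
    (hf : IsSolutionOn τ (qPow τ α) (qPow τ β) (qPow τ γ)
      (region (Complex.exp τ) (qPow τ α) (qPow τ β) (qPow τ γ) L 1) f) (z : Fin M → ℂ) :
    ∃ C : Option (Fin N × Fin M) → ℂ, ∀ n,
      latticePt τ z n ∈ region (Complex.exp τ) (qPow τ α) (qPow τ β) (qPow τ γ) L 1 →
      f (latticePt τ z n) = ∑ i, C i * u τ α β γ L hL 1 i (latticePt τ z n) := by
  obtain ⟨n₀, hn₀⟩ := exists_initZero_determines h hN hL z
  let pt : Option (Fin N × Fin M) → Fin M → ℤ := fun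
    | none => n₀
    | some (k, s) => n₀ + diagPt M k + Pi.single s 1
  have hinit : ∀ F : (Fin M → ℤ) → ℂ, (∀ i, F (pt i) = 0) → InitZero N F n₀ := fun F hF =>
    ⟨hF none, fun k hk s => hF (some (⟨k, hk⟩, s))⟩
  let v : (Option (Fin N × Fin M) → ℂ) →ₗ[ℂ] (Fin M → ℂ) → ℂ :=
    Fintype.linearCombination ℂ (u τ α β γ L hL 1)
  have hv : ∀ C w, v C w = ∑ i, C i * u τ α β γ L hL 1 i w := fun C w => by
    simp [v, Fintype.linearCombination_apply]
  have hvS : ∀ C, v C ∈ solutionSpace τ (qPow τ α) (qPow τ β) (qPow τ γ)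
      (region (Complex.exp τ) (qPow τ α) (qPow τ β) (qPow τ γ) L 1) := fun C =>
    Submodule.sum_mem _ fun i _ => Submodule.smul_mem _ _ (isSolutionOn_u_one h hL i)
  let Φ : (Option (Fin N × Fin M) → ℂ) →ₗ[ℂ] Option (Fin N × Fin M) → ℂ :=
    (LinearMap.funLeft ℂ ℂ fun i => latticePt τ z (pt i)) ∘ₗ v
  -- A combination that vanishes at the initial points vanishes on the part of the orbit in the
  -- region, so its coefficients are zero by independence. Source and target have the same
  -- dimension, which gives surjectivity.
  have hΦ : Function.Injective Φ := by
    rw [← LinearMap.ker_eq_bot, LinearMap.ker_eq_bot']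
    intro C hC
    refine linearIndependent_u_one h hL z C fun n hn => ?_
    rw [← hv]
    exact hn₀ (v C) (hvS C) (hinit _ fun i => congrFun hC i) n hn
  obtain ⟨C, hC⟩ := (LinearMap.injective_iff_surjective.mp hΦ) fun i => f (latticePt τ z (pt i))
  refine ⟨C, fun n hn => ?_⟩
  rw [← hv, ← sub_eq_zero]
  refine hn₀ (f - v C) (Submodule.sub_mem _ (mem_solutionSpace.mpr hf) (hvS C))
    (hinit _ fun i => ?_) n hn
  exact sub_eq_zero.mpr (congrFun hC i).symm

theorem isFundamentalSolutionOn_u_one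
    (h : Admissible (Complex.exp τ) (qPow τ α) (qPow τ β) (qPow τ γ)) (hN : 1 ≤ N) (hL : L ≤ M) :
    IsFundamentalSolutionOn τ (qPow τ α) (qPow τ β) (qPow τ γ)
      (region (Complex.exp τ) (qPow τ α) (qPow τ β) (qPow τ γ) L 1) (u τ α β γ L hL 1) where
  isSolution := isSolutionOn_u_one h hL
  linearIndependent C hC h0 i := by
    ext z
    refine congrFun (linearIndependent_u_one h hL z (fun i => C i z) fun n hn => ?_) i
    rw [← h0 _ hn]
    exact sum_congr rfl fun i _ => by rw [(hC i).latticePt]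
  spanning f hf := by
    -- P z depends only on the orbit of z, so a choice made from the predicate itself is
    -- automatically invariant under the shifts, hence a pseudo-constant.
    let P : (Fin M → ℂ) → (Option (Fin N × Fin M) → ℂ) → Prop := fun z C => ∀ n,
      latticePt τ z n ∈ region (Complex.exp τ) (qPow τ α) (qPow τ β) (qPow τ γ) L 1 →
      f (latticePt τ z n) = ∑ i, C i * u τ α β γ L hL 1 i (latticePt τ z n)
    have hP : ∀ z, P z (Classical.epsilon (P z)) := fun z =>
      Classical.epsilon_spec (exists_eq_sum_u_one h hN hL hf z)
    have hshift : ∀ s z, P (shiftPt τ s z) = P z := fun s z => by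
      funext C
      rw [shiftPt_eq_latticePt]
      refine propext ⟨fun hC n hn => ?_, fun hC n hn => ?_⟩
      · have e : latticePt τ (latticePt τ z (Pi.single s 1)) (n - Pi.single s 1) =
            latticePt τ z n := by rw [latticePt_latticePt, add_sub_cancel]
        have := hC (n - Pi.single s 1)
        rw [e] at this
        exact this hn
      · rw [latticePt_latticePt] at hn ⊢
        exact hC _ hn
    refine ⟨fun i z => Classical.epsilon (P z) i, fun i s => ?_, fun z hz => ?_⟩
    · ext z
      exact congrFun (congrArg Classical.epsilon (hshift s z)) i
    · have := hP z 0
      rw [latticePt_zero] at this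
      exact this hz

/-! ### Permutations of the variables -/

lemma shiftPt_comp_perm (σ : Equiv.Perm (Fin M)) (s : Fin M) (z : Fin M → ℂ) :
    (fun i => shiftPt τ s z (σ i)) = shiftPt τ (σ.symm s) fun i => z (σ i) := by
  ext i
  simp only [shiftPt, Function.update_apply, Equiv.apply_symm_apply, Equiv.eq_symm_apply]

lemma shiftAllPt_iterate_comp_perm (σ : Equiv.Perm (Fin M)) (k : ℕ) (z : Fin M → ℂ) :
    (fun i => (shiftAllPt τ)^[k] z (σ i)) = (shiftAllPt τ)^[k] fun i => z (σ i) := by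
  simp only [shiftAllPt_iterate]

variable {a : Fin N → ℂ} {b : Fin M → ℂ} {c : Fin N → ℂ}

lemma IsSolutionOn.comp_perm {σ : Equiv.Perm (Fin M)} {D : Set (Fin M → ℂ)}
    {f : (Fin M → ℂ) → ℂ} (hf : IsSolutionOn τ a (fun i => b (σ i)) c D f) :
    IsSolutionOn τ a b c {z | (fun i => z (σ i)) ∈ D} fun z => f fun i => z (σ i) := by
  rw [isSolutionOn_iff] at hf ⊢
  simp only [Set.mem_ofPred_eq, EqOneAt, EqTwoAt, shiftAllPt_iterate_comp_perm,
    shiftPt_comp_perm] at hf ⊢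
  refine ⟨fun s z hz => ?_, fun r s hrs z h0 hr hs hrs' => ?_⟩
  · simpa using hf.1 (σ.symm s) _ hz
  · simpa using hf.2 (σ.symm r) (σ.symm s) (by simpa using hrs) _ h0 hr hs hrs'

lemma IsPseudoConstant.comp_perm {C : (Fin M → ℂ) → ℂ} (hC : IsPseudoConstant τ C)
    (σ : Equiv.Perm (Fin M)) : IsPseudoConstant τ fun z => C fun i => z (σ i) := fun s => by
  ext z
  have := congrFun (hC (σ.symm s)) fun i => z (σ i)
  simp only [T, LinearMap.coe_mk, AddHom.coe_mk] at this ⊢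
  rw [shiftPt_comp_perm, this]

theorem IsFundamentalSolutionOn.comp_perm {σ : Equiv.Perm (Fin M)} {D : Set (Fin M → ℂ)}
    {ι : Type*} [Fintype ι] {v : ι → (Fin M → ℂ) → ℂ}
    (hv : IsFundamentalSolutionOn τ a (fun i => b (σ i)) c D v) :
    IsFundamentalSolutionOn τ a b c {z | (fun i => z (σ i)) ∈ D}
      fun i z => v i fun j => z (σ j) where
  isSolution i := (hv.isSolution i).comp_perm
  linearIndependent C hC h0 i := by
    have := hv.linearIndependent (fun i z => C i fun j => z (σ.symm j))
      (fun i => (hC i).comp_perm σ.symm)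
      (fun z hz => by simpa using h0 (fun j => z (σ.symm j)) (by simpa using hz)) i
    ext z
    simpa using congrFun this fun j => z (σ j)
  spanning f hf := by
    have hf' : IsSolutionOn τ a (fun i => b (σ i)) c D fun z => f fun i => z (σ.symm i) := by
      have := IsSolutionOn.comp_perm (σ := σ.symm) (b := fun i => b (σ i)) (by simpa using hf)
      simp only [Set.mem_ofPred_eq, Equiv.symm_apply_apply] at this
      exact this
    obtain ⟨C, hC, h⟩ := hv.spanning _ hf'
    refine ⟨fun i z => C i fun j => z (σ j), fun i => (hC i).comp_perm σ, fun z hz => ?_⟩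
    simpa using h _ hz

lemma NonResonant.admissible {q : ℂ} {σ : Equiv.Perm (Fin M)} (h : NonResonant q a b c σ)
    (hq0 : q ≠ 0) (hq1 : ‖q‖ < 1) (ha : ∀ j, a j ≠ 0) (hb : ∀ i, b i ≠ 0) (hc : ∀ j, c j ≠ 0) :
    Admissible q a (fun i => b (σ i)) c :=
  ⟨hq0, hq1, ha, fun i => hb (σ i), hc, h.a_div_a, h.c_div_c, h.a_div_b, h.c_div_b⟩

end Fundamental

end QHyp

end

theorem proposition4 {N M : ℕ} (hN : 1 ≤ N) (hM : 1 ≤ M)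
    (q τ : ℂ) (hq0 : 0 < ‖q‖) (hq1 : ‖q‖ < 1) (hτ : Complex.exp τ = q)
    (α : Fin N → ℂ) (β : Fin M → ℂ) (γ : Fin N → ℂ)
    (a : Fin N → ℂ) (b : Fin M → ℂ) (c : Fin N → ℂ)
    (ha : a = QHyp.qPow τ α) (hb : b = QHyp.qPow τ β) (hc : c = QHyp.qPow τ γ)
    (L : ℕ) (hL : L ≤ M) (σ : Equiv.Perm (Fin M))
    (hres : QHyp.NonResonant q a b c σ) :
    (∀ i : Option (Fin N × Fin M), ∀ z ∈ QHyp.region q a b c L σ,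
      Summable (QHyp.uSeriesTerm τ α β γ L hL σ i z)) ∧
    QHyp.IsFundamentalSolutionOn τ a b c (QHyp.region q a b c L σ)
      (QHyp.u τ α β γ L hL σ) := by
  subst ha hb hc hτ
  -- With b and the coordinates both permuted by σ, the region and the functions u for σ are by
  -- definition those for the identity, pulled back along z ↦ z ∘ σ.
  have h : QHyp.Admissible (Complex.exp τ) (QHyp.qPow τ α) (QHyp.qPow τ fun i => β (σ i))
      (QHyp.qPow τ γ) := hres.admissible (norm_pos_iff.mp hq0) hq1 (QHyp.qPow_ne_zero τ α)
    (QHyp.qPow_ne_zero τ β) (QHyp.qPow_ne_zero τ γ)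
  refine ⟨fun i z hz => ?_, ?_⟩
  · exact QHyp.summable_uSeriesTerm h hL i (z := fun j => z (σ j)) hz
  · exact (QHyp.isFundamentalSolutionOn_u_one h hN hL).comp_perm (b := QHyp.qPow τ β)
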